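/- Let $L_1,L_2>0$, let $\mathbb T^2=[0,L_1]\times[0,L_2]$ with periodic boundary conditions, and write $\bar f=\frac1{L_1L_2}\int_{\mathbb T^2}f\,dx$ for the average of $f$. Let $\mathbf v\in L^\infty([0,\infty);W^{1,\infty}(\mathbb T^2))$ be divergence free, and let $\mathcal S_{s,t}$, $0\le s\le t$, be the solution operator of $\partial_t f+\mathbf v\cdot\nabla f+\Delta^2 f=0$ (it maps the value of a solution at time $s$ to its value at time $t$). The dissipation time of $\mathbf v$ is $$\tau^*=\inf\{t\ge 0:\ \|\mathcal S_{s,s+t}\|_{\mathring L^2\to\mathring L^2}\le \tfrac12\ \text{ for all } s\ge 0\}\in(0,\infty),$$ where $\mathring L^2$ is the space of mean-free functions in $L^2(\mathbb T^2)$. For constants $C,\mu,B>0$ put $$T_0(B)=\int_{B^2}^{4B^2}\frac{dy}{Cy+Cy^3},\qquad T_1(B)=\frac{1}{4C(2\mu+4C+64CB^4)B+4C(2\mu+4C+64CB^4)^{1/2}}.$$ A mild solution on $[0,T]$ of the advective Kuramoto–Sivashinsky equation $$\partial_t\phi+\mathbf v\cdot\nabla\phi+\tfrac12|\nabla\phi|^2=-\Delta^2\phi-\Delta\phi,\qquad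 \phi(0)=\phi_0,$$ is a function $\phi\in C([0,T];L^2(\mathbb T^2))$ with $\sup_{0<t\le T}t^{1/4}\|\nabla\phi(t)\|_{L^2}<\infty$ such that, with $\mathcal L=\Delta^2+\Delta$, $$\phi(t)=e^{-t\mathcal L}\phi_0-\int_0^t e^{-(t-\tau)\mathcal L}\Big(\tfrac12|\nabla\phi(\tau)|^2+\mathbf v(\tau)\cdot\nabla\phi(\tau)\Big)d\tau\quad\text{in } L^2(\mathbb T^2),\qquad 0\le t\le T.$$ Solutions of the linear equation $\partial_t f+\mathbf v\cdot\nabla f+\Delta^2 f=0$ are understood in the same mild sense, with $\Delta^2$ in place of $\mathcal L$. **Theorem.** There is a constant $C=C(L_1,L_2)>0$ with the following property. For all $\mu>0$, $B>0$ and $m\in\mathbb R$ there is a constant $C_1>0$, depending only on $L_1,L_2,\mu,B,m$, such that: if the dissipation time of $\mathbf v$ satisfies $$\tau^*\le\min\Big(T_0(B),\ T_1(B),\ \frac1{4\mu}\Big),$$ if $\phi_0\in L^2(\mathbb T^2)$ satisfies $\|\phi_0-\bar\phi_0\|_{L^2}\le B$ and $|\bar\phi_0|\le m$, and if $\phi$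 is the mild solution on $[0,T]$ with initial value $\phi_0$, for some $T>0$, then $$\|\phi(t)\|_{L^2}\le C_1\qquad\text{for all } t\in[0,T].$$ In particular $C_1$ does not depend on $t$ or on $T$. -/

import Mathlib

open MeasureTheory Set

noncomputable section

namespace AKS

/-- The two-dimensional torus with periods `L₁` and `L₂`. Its volume is Lebesgue measure,
of total mass `L₁ * L₂`. -/
abbrev Torus (L₁ L₂ : ℝ) : Type := AddCircle L₁ × AddCircle L₂

section Torus

variable {L₁ L₂ : ℝ} [Fact (0 < L₁)] [Fact (0 < L₂)]

variable (L₁ L₂) in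
/-- The real Hilbert space `L²` of the torus. -/
abbrev L2 : Type := Lp ℝ 2 (volume : Measure (Torus L₁ L₂))

/-- The Fourier coefficient of `f` at the frequency `k`, that is
`(L₁ L₂)⁻¹ ∫ exp (- i (k̃₁ x₁ + k̃₂ x₂)) f(x) dx` with `k̃ = 2π (k₁ / L₁, k₂ / L₂)`. -/
def coeff (f : Torus L₁ L₂ → ℝ) (k : ℤ × ℤ) : ℂ :=
  ((L₁ * L₂ : ℝ) : ℂ)⁻¹ *
    ∫ x : Torus L₁ L₂, fourier (-k.1) x.1 * fourier (-k.2) x.2 * (f x : ℂ)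

variable (L₁ L₂) in
/-- First component of the wave vector `k̃`. -/
def wave₁ (k : ℤ × ℤ) : ℝ := 2 * Real.pi * (k.1 / L₁)

variable (L₁ L₂) in
/-- Second component of the wave vector `k̃`. -/
def wave₂ (k : ℤ × ℤ) : ℝ := 2 * Real.pi * (k.2 / L₂)

variable (L₁ L₂) in
/-- `κ² = |k̃|²`. -/
def kappaSq (k : ℤ × ℤ) : ℝ := wave₁ L₁ k ^ 2 + wave₂ L₂ k ^ 2

/-- `g` is the image of `f` under the Fourier multiplier with symbol `m`. A function in `L²` is
determined by its Fourier coefficients, so there is at most one such `g`. -/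
def IsMultiplierImage (m : ℤ × ℤ → ℂ) (f : Torus L₁ L₂ → ℝ) (g : L2 L₁ L₂) : Prop :=
  ∀ k, coeff g k = m k * coeff f k

open Classical in
/-- The image of `f` under the Fourier multiplier with symbol `m`, as an element of `L²`
(and `0` if the image is not a real function in `L²`). -/
def multiplier (m : ℤ × ℤ → ℂ) (f : Torus L₁ L₂ → ℝ) : L2 L₁ L₂ :=
  if h : ∃ g : L2 L₁ L₂, IsMultiplierImage m f g then h.choose else 0

variable (L₁ L₂) in
/-- The symbol of `∂₁`. -/
def symb₁ (k : ℤ × ℤ) : ℂ := Complex.I * (wave₁ L₁ k : ℂ)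

variable (L₁ L₂) in
/-- The symbol of `∂₂`. -/
def symb₂ (k : ℤ × ℤ) : ℂ := Complex.I * (wave₂ L₂ k : ℂ)

/-- `f` belongs to the Sobolev space `H¹`: both distributional derivatives are in `L²`. -/
def MemH1 (f : L2 L₁ L₂) : Prop :=
  (∃ g : L2 L₁ L₂, IsMultiplierImage (symb₁ L₁) f g) ∧
    (∃ g : L2 L₁ L₂, IsMultiplierImage (symb₂ L₂) f g)

/-- The distributional derivative `∂₁ f` of `f` in `H¹`. -/
def partial₁ (f : L2 L₁ L₂) : L2 L₁ L₂ := multiplier (symb₁ L₁) f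

/-- The distributional derivative `∂₂ f` of `f` in `H¹`. -/
def partial₂ (f : L2 L₁ L₂) : L2 L₁ L₂ := multiplier (symb₂ L₂) f

/-- The `L²` norm of the gradient. -/
def gradNorm (f : L2 L₁ L₂) : ℝ := √(‖partial₁ f‖ ^ 2 + ‖partial₂ f‖ ^ 2)

/-- The function `|∇ f|²` (which is in `L¹` for `f` in `H¹`). -/
def gradSq (f : L2 L₁ L₂) (x : Torus L₁ L₂) : ℝ :=
  (partial₁ f : Torus L₁ L₂ → ℝ) x ^ 2 + (partial₂ f : Torus L₁ L₂ → ℝ) x ^ 2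

/-- The function `w · ∇ f`, for a vector field `w` on the torus. -/
def advect (w : Torus L₁ L₂ → ℝ × ℝ) (f : L2 L₁ L₂) (x : Torus L₁ L₂) : ℝ :=
  (w x).1 * (partial₁ f : Torus L₁ L₂ → ℝ) x + (w x).2 * (partial₂ f : Torus L₁ L₂ → ℝ) x

/-- The semigroup `e^{-tA}`, for `A` the Fourier multiplier with real symbol `σ`. It is applied to
functions in `L²` and, for `t > 0`, to functions in `L¹`. -/
def semigroup (σ : ℤ × ℤ → ℝ) (t : ℝ) (f : Torus L₁ L₂ → ℝ) : L2 L₁ L₂ :=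
  multiplier (fun k => ((Real.exp (-t * σ k) : ℝ) : ℂ)) f

/-- `u` is a mild solution on `[s, T]` of `∂ₜ u + A u + F(t, u) = 0`, `u(s) = u₀`, where `A` is the
Fourier multiplier with symbol `σ` of fourth order: `u` is continuous with values in `L²`,
`(t - s)^{1/4} ‖∇u(t)‖_{L²}` is bounded on `(s, T]`, and the Duhamel formula
`u(t) = e^{-(t-s)A} u₀ - ∫ₛᵗ e^{-(t-τ)A} F(τ, u(τ)) dτ` holds in `L²` for every `t` in `[s, T]`, with
a convergent Bochner integral. -/
structure IsMildSolution (σ : ℤ × ℤ → ℝ) (F : ℝ → L2 L₁ L₂ → Torus L₁ L₂ → ℝ) (s T : ℝ)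
    (u₀ : L2 L₁ L₂) (u : ℝ → L2 L₁ L₂) : Prop where
  continuousOn : ContinuousOn u (Icc s T)
  memH1 : ∀ t ∈ Ioc s T, MemH1 (u t)
  gradBound : ∃ M : ℝ, ∀ t ∈ Ioc s T, (t - s) ^ (1 / 4 : ℝ) * gradNorm (u t) ≤ M
  integrable : ∀ t ∈ Icc s T,
    IntervalIntegrable (fun τ => semigroup σ (t - τ) (F τ (u τ))) volume s t
  duhamel : ∀ t ∈ Icc s T,
    u t = semigroup σ (t - s) u₀ - ∫ τ in s..t, semigroup σ (t - τ) (F τ (u τ))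

/-- `φ` is the mild solution on `[0, T]` of the Kuramoto-Sivashinsky equation with advection
`∂ₜ φ + v · ∇φ + ½ |∇φ|² = - Δ² φ - Δ φ`, with initial value `φ₀`. -/
def IsAKSSolution (v : ℝ → Torus L₁ L₂ → ℝ × ℝ) (T : ℝ) (φ₀ : L2 L₁ L₂) (φ : ℝ → L2 L₁ L₂) : Prop :=
  IsMildSolution (fun k => kappaSq L₁ L₂ k ^ 2 - kappaSq L₁ L₂ k)
    (fun t f x => 1 / 2 * gradSq f x + advect (v t) f x) 0 T φ₀ φ

/-- `f` is the solution on `[s, T]` of the advection-hyperdiffusion equation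
`∂ₜ f + v · ∇f + Δ² f = 0`, with value `f₀` at time `s`; that is, `f(t) = 𝓢_{s,t} f₀`. -/
def IsAdvHypSolution (v : ℝ → Torus L₁ L₂ → ℝ × ℝ) (s T : ℝ) (f₀ : L2 L₁ L₂)
    (f : ℝ → L2 L₁ L₂) : Prop :=
  IsMildSolution (fun k => kappaSq L₁ L₂ k ^ 2) (fun t f x => advect (v t) f x) s T f₀ f

/-- `v` is in `L^∞([0,∞); W^{1,∞})` and is divergence free: it is (jointly) measurable, and for
almost every `t ≥ 0` it is bounded and Lipschitz in space, with constants that do not depend on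
`t`, and has distributional divergence zero. -/
structure IsAdmissibleVelocity (v : ℝ → Torus L₁ L₂ → ℝ × ℝ) : Prop where
  measurable : Measurable (Function.uncurry v)
  lipschitz : ∃ K : NNReal, ∀ᵐ t ∂(volume.restrict (Ici (0 : ℝ))),
    LipschitzWith K (v t) ∧ ∀ x, ‖v t x‖ ≤ K
  divFree : ∀ᵐ t ∂(volume.restrict (Ici (0 : ℝ))), ∀ k,
    symb₁ L₁ k * coeff (fun x => (v t x).1) k + symb₂ L₂ k * coeff (fun x => (v t x).2) k = 0

/-- The average of `f` over the torus. -/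
def mean (f : L2 L₁ L₂) : ℝ := (L₁ * L₂)⁻¹ * ∫ x : Torus L₁ L₂, f x

/-- The projection of `f` onto the mean-free functions. -/
def meanFreePart (f : L2 L₁ L₂) : L2 L₁ L₂ := f - Lp.const 2 volume (mean f)

/-- The norm of the solution operator `𝓢_{s,s+t}` on the space of mean-free functions in `L²` is
at most `1/2`. -/
def HalvesEnergy (v : ℝ → Torus L₁ L₂ → ℝ × ℝ) (s t : ℝ) : Prop :=
  ∀ (f₀ : L2 L₁ L₂) (f : ℝ → L2 L₁ L₂), mean f₀ = 0 → IsAdvHypSolution v s (s + t) f₀ f →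
    ‖f (s + t)‖ ≤ 1 / 2 * ‖f₀‖

/-- `τ` is the dissipation time of `v`: `0 < τ < ∞`, and `τ` is the infimum of the `t ≥ 0` such
that `‖𝓢_{s,s+t}‖ ≤ 1/2` on mean-free functions for all `s ≥ 0`. -/
def IsDissipationTime (v : ℝ → Torus L₁ L₂ → ℝ × ℝ) (τ : ℝ) : Prop :=
  0 < τ ∧ IsGLB {t : ℝ | 0 ≤ t ∧ ∀ s : ℝ, 0 ≤ s → HalvesEnergy v s t} τ

end Torus

/-- The time `T₀(B)`, for the constant `C`. -/
def T0 (C B : ℝ) : ℝ := ∫ y in (B ^ 2)..(4 * B ^ 2), 1 / (C * y + C * y ^ 3)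

/-- The time `T₁(B)`, for the constants `C` and `μ`. -/
def T1 (C μ B : ℝ) : ℝ :=
  1 / (4 * C * (2 * μ + 4 * C + 64 * C * B ^ 4) * B
    + 4 * C * √(2 * μ + 4 * C + 64 * C * B ^ 4))

end AKS

end

open MeasureTheory Set

set_option linter.unusedSectionVars false

noncomputable section

namespace AKS

open scoped ComplexConjugate BoundedContinuousFunction

/-! Write ψ for the mean-free part of φ and work with the Fourier coefficients a of ψ. Let X = ∑ ‖a
k‖², let D = ∑ κ⁴ ‖a k‖², and let Λ = 2 `latticeConst`. Transport by a divergence free field does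
not change X. The coefficients of ½|∇ψ|² are at most ½ ∑ κ² ‖a k‖² ≤ ½ √(X D), and Agmon's
inequality (`InH2.agmon`) gives (∑ ‖a k‖)² ≤ Λ √(X D). Young's inequality then yields, in integrated
form, X' ≤ -D + 2X + Λ² X³ (`IsMeanFreeSolution.energy_le`).

Suppose X ≤ b at time s, and let τ be small compared with 1 / (1 + b²). On [s, s + τ] the energy
stays below 4b and ∫ D ≤ 2b (`IsMeanFreeSolution.short_time`). Compare ψ with the solution f of the
linear equation that starts from ψ(s). The difference starts from zero, and its energy at time s + τ
is at most b/16 (`IsMeanFreeSolution.sub_energy_le`), while the norm of f is halved. Hence the norm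
of ψ(s + τ) is at most 1/2 + 1/4 of its initial bound, that is X ≤ (9/16) b
(`IsMeanFreeSolution.contract`). Iterating gives X ≤ 4b on every later time interval and, by a
geometric series, ∫ D ≤ 5b, independently of its length (`IsMeanFreeSolution.bound`).

The average of φ changes only through the average of ½|∇φ|², which Poincaré's inequality bounds by a
multiple of D; so its total change is bounded by the same series (`IsAKSSolution.abs_mean_le`). The
hypothesis τ* ≤ T₀(B) provides the smallness of τ, because T₀(B) ≤ 3 / (C (1 + B⁴)).

Two points need work before the energy estimates apply. A mild solution is bounded in H² only away
from the initial time (`IsAKSSolution.exists_isH2Path`), so the argument starts at a small ε > 0.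
And the halving property speaks about given solutions of the linear equation, so one must be
constructed (`exists_isAdvHypSolution`); this is done by a contraction for the equation damped by a
large constant, in variables weighted by (1 + Δ²)^{1/2}. -/

variable {L₁ L₂ : ℝ} [hL₁ : Fact (0 < L₁)] [hL₂ : Fact (0 < L₂)]

/-! ### The Fourier basis of the torus and Parseval's identity. -/

/-- The exponential `x ↦ exp (i k̃ · x)` on the torus. -/
def expo (k : ℤ × ℤ) : C(Torus L₁ L₂, ℂ) where
  toFun x := fourier k.1 x.1 * fourier k.2 x.2

lemma expo_apply (k : ℤ × ℤ) (x : Torus L₁ L₂) :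
    expo k x = fourier k.1 x.1 * fourier k.2 x.2 := rfl

lemma expo_neg (k : ℤ × ℤ) (x : Torus L₁ L₂) : expo (-k) x = conj (expo k x) := by
  simp only [expo_apply, Prod.fst_neg, Prod.snd_neg, fourier_neg, map_mul]

lemma expo_add (j k : ℤ × ℤ) (x : Torus L₁ L₂) : expo (j + k) x = expo j x * expo k x := by
  simp only [expo_apply, Prod.fst_add, Prod.snd_add, fourier_add]; ring

lemma expo_zero (x : Torus L₁ L₂) : expo 0 x = 1 := by simp [expo_apply]

lemma norm_expo (k : ℤ × ℤ) (x : Torus L₁ L₂) : ‖expo k x‖ = 1 := by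
  rw [expo_apply, fourier_apply, fourier_apply, norm_mul, Circle.norm_coe, Circle.norm_coe, one_mul]

/-- The star subalgebra of `C(Torus, ℂ)` generated by the exponentials. -/
def expoSubalgebra (L₁ L₂ : ℝ) [Fact (0 < L₁)] [Fact (0 < L₂)] :
    StarSubalgebra ℂ C(Torus L₁ L₂, ℂ) where
  toSubalgebra := Algebra.adjoin ℂ (range expo)
  star_mem' := by
    change Algebra.adjoin ℂ (range expo) ≤ star (Algebra.adjoin ℂ (range expo))
    refine Algebra.adjoin_le ?_
    rintro _ ⟨n, rfl⟩
    refine Algebra.subset_adjoin ⟨-n, ?_⟩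
    ext1 x
    simp only [expo_neg, starRingEnd_apply, ContinuousMap.star_apply]

lemma expoSubalgebra_coe :
    (expoSubalgebra L₁ L₂).toSubalgebra.toSubmodule = Submodule.span ℂ (range expo) := by
  apply Algebra.adjoin_eq_span_of_subset
  refine .trans (fun x ↦ Submonoid.closure_induction (fun _ ↦ id) ⟨0, ?_⟩ ?_)
    Submodule.subset_span
  · ext z; simp [expo_zero]
  · rintro _ _ _ _ ⟨m, rfl⟩ ⟨n, rfl⟩
    exact ⟨m + n, by ext z; simp [expo_add]⟩

lemma expoSubalgebra_separatesPoints : (expoSubalgebra L₁ L₂).SeparatesPoints := by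
  intro x y hxy
  rcases not_and_or.1 (fun h => hxy (Prod.ext_iff.2 h)) with h | h
  · refine ⟨_, ⟨expo (1, 0), Algebra.subset_adjoin ⟨(1, 0), rfl⟩, rfl⟩, ?_⟩
    simp only [expo_apply, fourier_zero, mul_one, fourier_one]
    exact fun h' => h (AddCircle.injective_toCircle hL₁.out.ne' (Subtype.coe_injective h'))
  · refine ⟨_, ⟨expo (0, 1), Algebra.subset_adjoin ⟨(0, 1), rfl⟩, rfl⟩, ?_⟩
    simp only [expo_apply, fourier_zero, one_mul, fourier_one]
    exact fun h' => h (AddCircle.injective_toCircle hL₂.out.ne' (Subtype.coe_injective h'))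

/-- Stone–Weierstrass: products of exponentials are exponentials, so their span is already a star
subalgebra, and it separates points. -/
lemma span_expo_closure_eq_top :
    (Submodule.span ℂ (range (expo (L₁ := L₁) (L₂ := L₂)))).topologicalClosure = ⊤ := by
  rw [← expoSubalgebra_coe]
  exact congr_arg (Subalgebra.toSubmodule <| StarSubalgebra.toSubalgebra ·)
    (ContinuousMap.starSubalgebra_topologicalClosure_eq_top_of_separatesPoints _
      expoSubalgebra_separatesPoints)

variable (L₁ L₂) in
/-- The area of the torus. -/
def area : ℝ := L₁ * L₂

lemma area_pos : 0 < area L₁ L₂ := mul_pos hL₁.out hL₂.out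

lemma measureReal_univ_torus : (volume : Measure (Torus L₁ L₂)).real univ = area L₁ L₂ := by
  rw [Measure.volume_eq_prod, ← univ_prod_univ, measureReal_prod_prod]
  simp [Measure.real, AddCircle.measure_univ, hL₁.out.le, hL₂.out.le, area]

lemma integral_expo (k : ℤ × ℤ) :
    ∫ x : Torus L₁ L₂, expo k x = if k = 0 then (area L₁ L₂ : ℂ) else 0 := by
  split_ifs with h
  · subst h
    simp [expo_zero, measureReal_univ_torus]
  · simp only [expo_apply]
    rw [Measure.volume_eq_prod, integral_prod_mul (fun x => (fourier k.1 x : ℂ))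
      (fun y => (fourier k.2 y : ℂ))]
    have key : ∀ (L : ℝ) [Fact (0 < L)] (n : ℤ), n ≠ 0 →
        ∫ x : AddCircle L, (fourier n x : ℂ) = 0 := by
      intro L _ n hn
      have := (orthonormal_iff_ite.mp (orthonormal_fourier (T := L))) 0 n
      rw [if_neg hn.symm] at this
      simp only [ContinuousMap.inner_toLp, fourier_zero, map_one, mul_one] at this
      rw [AddCircle.volume_eq_smul_haarAddCircle, integral_smul_measure, this, smul_zero]
    rcases not_and_or.1 (fun h' => h (Prod.ext_iff.2 h')) with h1 | h1
    · rw [key L₁ _ h1, zero_mul]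
    · rw [key L₂ _ h1, mul_zero]

/-- The normalised exponentials as elements of complex `L²`. -/
def expoLp (k : ℤ × ℤ) : Lp ℂ 2 (volume : Measure (Torus L₁ L₂)) :=
  ((√(area L₁ L₂))⁻¹ : ℂ) • ContinuousMap.toLp (E := ℂ) 2 volume ℂ (expo k)

lemma orthonormal_expoLp : Orthonormal ℂ (expoLp (L₁ := L₁) (L₂ := L₂)) := by
  rw [orthonormal_iff_ite]
  intro m n
  have hA := area_pos (L₁ := L₁) (L₂ := L₂)
  have h2 : ((√(area L₁ L₂) : ℝ) : ℂ) * (√(area L₁ L₂) : ℝ) = (area L₁ L₂ : ℝ) := by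
    rw [← Complex.ofReal_mul, Real.mul_self_sqrt hA.le]
  have h1 : ((√(area L₁ L₂) : ℝ) : ℂ) ≠ 0 := by
    simpa using (Real.sqrt_pos.2 hA).ne'
  simp only [expoLp, inner_smul_left, inner_smul_right, ContinuousMap.inner_toLp, ← expo_neg,
    ← expo_add, integral_expo]
  rw [map_inv₀, Complex.conj_ofReal]
  by_cases h : m = n
  · subst h
    simp only [add_neg_cancel, if_true]
    rw [← h2]; field_simp
  · rw [if_neg h, if_neg]
    · simp
    · intro h'; exact h (by rw [add_neg_eq_zero] at h'; exact h'.symm)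

/-- The Fourier basis of complex `L²` of the torus. -/
def expoBasis : HilbertBasis (ℤ × ℤ) ℂ (Lp ℂ 2 (volume : Measure (Torus L₁ L₂))) :=
  HilbertBasis.mk orthonormal_expoLp <| by
    have h := (ContinuousMap.toLp_denseRange ℂ (volume : Measure (Torus L₁ L₂)) ℂ
      (p := 2) (by simp)).topologicalClosure_map_submodule span_expo_closure_eq_top
    rw [← h]
    refine Submodule.topologicalClosure_mono ?_
    rw [Submodule.map_span, Submodule.span_le]
    rintro _ ⟨_, ⟨k, rfl⟩, rfl⟩
    have hA := area_pos (L₁ := L₁) (L₂ := L₂)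
    have h1 : ((√(area L₁ L₂) : ℝ) : ℂ) ≠ 0 := by simpa using (Real.sqrt_pos.2 hA).ne'
    have : (ContinuousMap.toLp (E := ℂ) 2 volume ℂ (expo k) :
        Lp ℂ 2 (volume : Measure (Torus L₁ L₂))) = ((√(area L₁ L₂) : ℝ) : ℂ) • expoLp k := by
      rw [expoLp, smul_smul, mul_inv_cancel₀ h1, one_smul]
    change (ContinuousMap.toLp (E := ℂ) 2 volume ℂ (expo k) :
        Lp ℂ 2 (volume : Measure (Torus L₁ L₂))) ∈ _
    rw [this]
    exact Submodule.smul_mem _ _ (Submodule.subset_span ⟨k, rfl⟩)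

lemma expoBasis_apply (k : ℤ × ℤ) : expoBasis (L₁ := L₁) (L₂ := L₂) k = expoLp k := by
  rw [expoBasis, HilbertBasis.coe_mk]

/-- The Fourier coefficient of a complex function. -/
def ccoeff (f : Torus L₁ L₂ → ℂ) (k : ℤ × ℤ) : ℂ :=
  ((area L₁ L₂ : ℝ) : ℂ)⁻¹ * ∫ x, expo (-k) x * f x

lemma coeff_eq_ccoeff (f : Torus L₁ L₂ → ℝ) (k : ℤ × ℤ) :
    coeff f k = ccoeff (fun x => (f x : ℂ)) k := rfl

lemma ccoeff_congr_ae {f g : Torus L₁ L₂ → ℂ} (h : f =ᵐ[volume] g) (k : ℤ × ℤ) :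
    ccoeff f k = ccoeff g k := by
  unfold ccoeff
  congr 1
  exact integral_congr_ae (h.mono fun x hx => by simp only [hx])

lemma coeff_congr_ae {f g : Torus L₁ L₂ → ℝ} (h : f =ᵐ[volume] g) (k : ℤ × ℤ) :
    coeff f k = coeff g k :=
  ccoeff_congr_ae (h.mono fun x hx => by simp only [hx]) k

lemma expoBasis_repr (f : Lp ℂ 2 (volume : Measure (Torus L₁ L₂))) (k : ℤ × ℤ) :
    expoBasis.repr f k = (√(area L₁ L₂) : ℂ) * ccoeff f k := by
  have hA := area_pos (L₁ := L₁) (L₂ := L₂)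
  have h2 : ((√(area L₁ L₂) : ℝ) : ℂ) * (√(area L₁ L₂) : ℝ) = (area L₁ L₂ : ℝ) := by
    rw [← Complex.ofReal_mul, Real.mul_self_sqrt hA.le]
  have h1 : ((√(area L₁ L₂) : ℝ) : ℂ) ≠ 0 := by simpa using (Real.sqrt_pos.2 hA).ne'
  rw [HilbertBasis.repr_apply_apply, expoBasis_apply, expoLp, inner_smul_left, L2.inner_def]
  rw [map_inv₀, Complex.conj_ofReal, ccoeff, ← h2, mul_inv, ← mul_assoc, ← mul_assoc,
    mul_inv_cancel₀ h1, one_mul]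
  congr 1
  refine integral_congr_ae ?_
  filter_upwards [ContinuousMap.coeFn_toLp (p := 2) (𝕜 := ℂ) volume (expo (L₁ := L₁) (L₂ := L₂) k)]
    with x hx
  rw [hx, expo_neg]
  simp [mul_comm]

/-- Parseval's identity. -/
lemma hasSum_ccoeff_mul {f g : Torus L₁ L₂ → ℂ} (hf : MemLp f 2 volume) (hg : MemLp g 2 volume) :
    HasSum (fun k => conj (ccoeff f k) * ccoeff g k)
      (((area L₁ L₂ : ℝ) : ℂ)⁻¹ * ∫ x, conj (f x) * g x) := by
  have hA := area_pos (L₁ := L₁) (L₂ := L₂)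
  have h2 : ((√(area L₁ L₂) : ℝ) : ℂ) * (√(area L₁ L₂) : ℝ) = (area L₁ L₂ : ℝ) := by
    rw [← Complex.ofReal_mul, Real.mul_self_sqrt hA.le]
  have h1 : ((√(area L₁ L₂) : ℝ) : ℂ) ≠ 0 := by simpa using (Real.sqrt_pos.2 hA).ne'
  have h := (expoBasis.hasSum_inner_mul_inner (hf.toLp f) (hg.toLp g)).mul_left
    (((area L₁ L₂ : ℝ) : ℂ)⁻¹)
  have e1 : ∀ {f : Torus L₁ L₂ → ℂ} (hf : MemLp f 2 volume) (k : ℤ × ℤ),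
      inner ℂ (expoBasis k) (hf.toLp f) = (√(area L₁ L₂) : ℂ) * ccoeff f k := by
    intro f hf k
    rw [← HilbertBasis.repr_apply_apply, expoBasis_repr, ccoeff_congr_ae hf.coeFn_toLp]
  have e2 : inner ℂ (hf.toLp f) (hg.toLp g) = ∫ x, conj (f x) * g x := by
    rw [L2.inner_def]
    refine integral_congr_ae ?_
    filter_upwards [hf.coeFn_toLp, hg.coeFn_toLp] with x h1 h2
    rw [h1, h2]; simp [mul_comm]
  rw [e2] at h
  refine h.congr_fun fun k => ?_
  rw [e1 hg, ← inner_conj_symm, e1 hf, map_mul, Complex.conj_ofReal, ← h2]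
  field_simp

/-! ### Real functions -/

lemma memLp_ofReal {f : Torus L₁ L₂ → ℝ} {p : ENNReal} (hf : MemLp f p volume) :
    MemLp (fun x => (f x : ℂ)) p volume := hf.ofReal

/-- Parseval's identity for real functions. -/
lemma hasSum_coeff_mul {f g : Torus L₁ L₂ → ℝ} (hf : MemLp f 2 volume) (hg : MemLp g 2 volume) :
    HasSum (fun k => conj (coeff f k) * coeff g k)
      (((area L₁ L₂)⁻¹ * ∫ x, f x * g x : ℝ) : ℂ) := by
  have h := hasSum_ccoeff_mul (memLp_ofReal hf) (memLp_ofReal hg)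
  simp only [Complex.conj_ofReal] at h
  have e : (((area L₁ L₂)⁻¹ * ∫ x, f x * g x : ℝ) : ℂ) =
      ((area L₁ L₂ : ℝ) : ℂ)⁻¹ * ∫ x, (f x : ℂ) * (g x : ℂ) := by
    rw [Complex.ofReal_mul, Complex.ofReal_inv, ← integral_complex_ofReal]
    simp only [Complex.ofReal_mul]
  rw [e]
  exact h

lemma hasSum_norm_coeff_sq' {f : Torus L₁ L₂ → ℝ} (hf : MemLp f 2 volume) :
    HasSum (fun k => ‖coeff f k‖ ^ 2) ((area L₁ L₂)⁻¹ * ∫ x, f x ^ 2) := by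
  have h := Complex.hasSum_re (hasSum_coeff_mul hf hf)
  convert h using 1
  · ext k
    rw [mul_comm, Complex.mul_conj, Complex.ofReal_re, Complex.normSq_eq_norm_sq]
  · simp [sq]

lemma norm_sq_eq_integral (f : L2 L₁ L₂) : ‖f‖ ^ 2 = ∫ x, (f x) ^ 2 := by
  rw [← real_inner_self_eq_norm_sq, L2.inner_def]
  simp [sq]

lemma hasSum_norm_coeff_sq (f : L2 L₁ L₂) :
    HasSum (fun k => ‖coeff f k‖ ^ 2) ((area L₁ L₂)⁻¹ * ‖f‖ ^ 2) := by
  rw [norm_sq_eq_integral]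
  exact hasSum_norm_coeff_sq' (Lp.memLp f)

lemma norm_sq_eq_tsum (f : L2 L₁ L₂) : ‖f‖ ^ 2 = area L₁ L₂ * ∑' k, ‖coeff f k‖ ^ 2 := by
  rw [(hasSum_norm_coeff_sq f).tsum_eq, mul_inv_cancel_left₀ area_pos.ne']

lemma integrable_expo_mul {f : Torus L₁ L₂ → ℂ} (hf : Integrable f volume) (k : ℤ × ℤ) :
    Integrable (fun x => expo k x * f x) volume :=
  hf.bdd_mul (c := 1) (expo k).continuous.aestronglyMeasurable
    (Filter.Eventually.of_forall fun x => (norm_expo k x).le)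

lemma ccoeff_add {f g : Torus L₁ L₂ → ℂ} (hf : Integrable f volume) (hg : Integrable g volume)
    (k : ℤ × ℤ) : ccoeff (fun x => f x + g x) k = ccoeff f k + ccoeff g k := by
  simp only [ccoeff, mul_add]
  rw [integral_add (integrable_expo_mul hf _) (integrable_expo_mul hg _), mul_add]

lemma ccoeff_const_mul (f : Torus L₁ L₂ → ℂ) (c : ℂ) (k : ℤ × ℤ) :
    ccoeff (fun x => c * f x) k = c * ccoeff f k := by
  simp only [ccoeff, mul_left_comm _ c]
  rw [integral_const_mul]; ring

lemma coeff_add {f g : Torus L₁ L₂ → ℝ} (hf : Integrable f volume) (hg : Integrable g volume)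
    (k : ℤ × ℤ) : coeff (fun x => f x + g x) k = coeff f k + coeff g k := by
  simp only [coeff_eq_ccoeff, Complex.ofReal_add]
  exact ccoeff_add hf.ofReal hg.ofReal k

lemma coeff_const_mul (f : Torus L₁ L₂ → ℝ) (c : ℝ) (k : ℤ × ℤ) :
    coeff (fun x => c * f x) k = c * coeff f k := by
  simp only [coeff_eq_ccoeff, Complex.ofReal_mul]
  exact ccoeff_const_mul _ _ k

/-- Valid for every function, since both integrals are zero when `f` is not integrable. This is what
lets the semigroup act on `L¹` data without side conditions. -/
lemma norm_coeff_le (f : Torus L₁ L₂ → ℝ) (k : ℤ × ℤ) :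
    ‖coeff f k‖ ≤ (area L₁ L₂)⁻¹ * ∫ x, |f x| := by
  rw [coeff_eq_ccoeff, ccoeff, norm_mul, norm_inv, Complex.norm_real, Real.norm_of_nonneg area_pos.le]
  refine mul_le_mul_of_nonneg_left ?_ (inv_nonneg.2 area_pos.le)
  refine (norm_integral_le_integral_norm _).trans (le_of_eq ?_)
  simp [norm_expo]

lemma ccoeff_conj (f : Torus L₁ L₂ → ℂ) (k : ℤ × ℤ) :
    ccoeff (fun x => conj (f x)) k = conj (ccoeff f (-k)) := by
  simp only [ccoeff, map_mul, map_inv₀, Complex.conj_ofReal]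
  rw [← integral_conj]
  simp [expo_neg]

lemma coeff_neg (f : Torus L₁ L₂ → ℝ) (k : ℤ × ℤ) : coeff f (-k) = conj (coeff f k) := by
  have := ccoeff_conj (fun x => (f x : ℂ)) (-k)
  simp only [Complex.conj_ofReal, neg_neg] at this
  exact this

/-- The Fourier coefficient as a continuous linear map on `L²`. -/
def coeffCLM (k : ℤ × ℤ) : L2 L₁ L₂ →L[ℝ] ℂ :=
  LinearMap.mkContinuous
    { toFun := fun f => coeff f k
      map_add' := fun f g => by
        rw [coeff_congr_ae (Lp.coeFn_add f g)]
        exact coeff_add ((Lp.memLp f).integrable (by norm_num))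
          ((Lp.memLp g).integrable (by norm_num)) k
      map_smul' := fun c f => by
        rw [coeff_congr_ae (Lp.coeFn_smul c f)]
        exact (coeff_const_mul f c k).trans (Complex.real_smul).symm } (√((area L₁ L₂)⁻¹)) (fun f => by
      have h := (hasSum_norm_coeff_sq f)
      have h1 := h.summable.le_tsum k (fun _ _ => by positivity)
      rw [h.tsum_eq] at h1
      refine abs_le_of_sq_le_sq' ?_ (by positivity) |>.2
      rw [mul_pow, Real.sq_sqrt (inv_nonneg.2 area_pos.le)]
      exact h1)

lemma coeffCLM_apply (k : ℤ × ℤ) (f : L2 L₁ L₂) : coeffCLM k f = coeff f k := rfl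

lemma coeff_sub_L2 (f g : L2 L₁ L₂) (k : ℤ × ℤ) :
    coeff (f - g : L2 L₁ L₂) k = coeff f k - coeff g k := map_sub (coeffCLM k) f g

lemma coeff_smul_L2 (c : ℝ) (f : L2 L₁ L₂) (k : ℤ × ℤ) :
    coeff (c • f : L2 L₁ L₂) k = c * coeff f k := by
  exact (map_smul (coeffCLM k) c f).trans Complex.real_smul

lemma L2_ext {f g : L2 L₁ L₂} (h : ∀ k, coeff f k = coeff g k) : f = g := by
  have h1 := norm_sq_eq_tsum (f - g)
  simp only [coeff_sub_L2, h, sub_self, norm_zero] at h1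
  simpa [sub_eq_zero] using h1

lemma exists_repr_eq (c : lp (fun _ : ℤ × ℤ => ℂ) 2) :
    ∃ F : Lp ℂ 2 (volume : Measure (Torus L₁ L₂)), expoBasis.repr F = c :=
  ⟨_, expoBasis.repr.apply_symm_apply c⟩

lemma exists_ccoeff_eq (c : ℤ × ℤ → ℂ) (hc : Summable fun k => ‖c k‖ ^ 2) :
    ∃ F : Lp ℂ 2 (volume : Measure (Torus L₁ L₂)), ∀ k, ccoeff F k = c k := by
  have hA := area_pos (L₁ := L₁) (L₂ := L₂)
  have h1 : ((√(area L₁ L₂) : ℝ) : ℂ) ≠ 0 := by simpa using (Real.sqrt_pos.2 hA).ne'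
  generalize hr : ((√(area L₁ L₂) : ℝ) : ℂ) = r at h1
  have hmem : Memℓp (fun k => r * c k) 2 := by
    rw [memℓp_gen_iff (by norm_num)]
    have := hc.mul_left (‖r‖ ^ 2)
    simpa [mul_pow] using this
  obtain ⟨F, hF⟩ := exists_repr_eq (L₁ := L₁) (L₂ := L₂) ⟨_, hmem⟩
  refine ⟨F, fun k => mul_left_cancel₀ h1 ?_⟩
  rw [← hr, ← expoBasis_repr, hF, hr]

/-- The theorem of Riesz and Fischer, for real functions. -/
lemma exists_L2_coeff_eq (c : ℤ × ℤ → ℂ) (hc : Summable fun k => ‖c k‖ ^ 2)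
    (hsymm : ∀ k, c (-k) = conj (c k)) : ∃ g : L2 L₁ L₂, ∀ k, coeff g k = c k := by
  obtain ⟨F, hF⟩ := exists_ccoeff_eq (L₁ := L₁) (L₂ := L₂) c hc
  have hFi : Integrable F volume := (Lp.memLp F).integrable (by norm_num)
  -- Because of the symmetry of `c`, passing to the real part leaves the coefficients unchanged:
  -- they become (c k + conj (c (-k))) / 2.
  have hre : MemLp (fun x => (F x).re) 2 volume := (Lp.memLp F).re
  refine ⟨hre.toLp _, fun k => ?_⟩
  rw [coeff_congr_ae hre.coeFn_toLp, coeff_eq_ccoeff]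
  have e : (fun x => (((F x).re : ℝ) : ℂ)) = fun x => (1 / 2 : ℂ) * (F x + conj (F x)) := by
    ext x
    rw [Complex.add_conj, Complex.ofReal_mul, Complex.ofReal_ofNat]; ring
  have hconj : Integrable (fun x => conj (F x)) volume :=
    Complex.conjCLE.toContinuousLinearMap.integrable_comp hFi
  rw [e, ccoeff_const_mul, ccoeff_add hFi hconj, ccoeff_conj, hF, hF, hsymm,
    Complex.conj_conj]
  ring

/-- The Fourier coefficients of a product are given by a convolution. -/
lemma hasSum_coeff_mul_fun {h g : Torus L₁ L₂ → ℝ} (hh : MemLp h 2 volume)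
    (hg : MemLp g 2 volume) (k : ℤ × ℤ) :
    HasSum (fun j => coeff h (k - j) * coeff g j) (coeff (fun x => h x * g x) k) := by
  -- The coefficient of the product is the inner product of `expo k * h` with `g`, so Parseval's
  -- identity gives the convolution.
  have hm : MemLp (fun x => expo k x * (h x : ℂ)) 2 (volume : Measure (Torus L₁ L₂)) := by
    refine (memLp_ofReal hh).of_le ?_ ?_
    · exact (expo k).continuous.aestronglyMeasurable.mul (memLp_ofReal hh).aestronglyMeasurable
    · exact Filter.Eventually.of_forall fun x => by rw [norm_mul, norm_expo, one_mul]
  have := hasSum_ccoeff_mul hm (memLp_ofReal hg)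
  convert this using 1
  · ext j
    change _ = _ * coeff g j
    congr 1
    rw [coeff_eq_ccoeff]
    simp only [ccoeff, map_mul, map_inv₀, Complex.conj_ofReal]
    rw [← integral_conj]
    congr 2; ext x
    rw [map_mul, map_mul, Complex.conj_ofReal, ← mul_assoc, ← map_mul, ← expo_add, ← expo_neg]
    congr 3; abel
  · rw [coeff_eq_ccoeff, ccoeff]
    congr 2; ext x
    rw [map_mul, Complex.conj_ofReal, expo_neg, Complex.ofReal_mul, mul_assoc]

/-! ### Sums over the lattice -/

/-- The inequality of Cauchy and Schwarz for series. -/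
lemma cauchySchwarz_tsum {ι : Type*} {f g : ι → ℝ} (hf0 : ∀ i, 0 ≤ f i) (hg0 : ∀ i, 0 ≤ g i)
    (hf : Summable fun i => f i ^ 2) (hg : Summable fun i => g i ^ 2) :
    (Summable fun i => f i * g i) ∧
      (∑' i, f i * g i) ^ 2 ≤ (∑' i, f i ^ 2) * ∑' i, g i ^ 2 := by
  have h0 : ∀ i, 0 ≤ f i * g i := fun i => mul_nonneg (hf0 i) (hg0 i)
  have hfn : 0 ≤ ∑' i, f i ^ 2 := tsum_nonneg fun i => sq_nonneg _
  have hgn : 0 ≤ ∑' i, g i ^ 2 := tsum_nonneg fun i => sq_nonneg _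
  have hb : ∀ S : Finset ι, ∑ i ∈ S, f i * g i ≤ √((∑' i, f i ^ 2) * ∑' i, g i ^ 2) := by
    intro S
    refine Real.le_sqrt_of_sq_le ((Finset.sum_mul_sq_le_sq_mul_sq S f g).trans ?_)
    exact mul_le_mul (hf.sum_le_tsum S fun i _ => sq_nonneg _)
      (hg.sum_le_tsum S fun i _ => sq_nonneg _) (Finset.sum_nonneg fun i _ => sq_nonneg _) hfn
  have hs : Summable fun i => f i * g i := summable_of_sum_le h0 hb
  refine ⟨hs, ?_⟩
  have := Real.tsum_le_of_sum_le h0 hb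
  calc (∑' i, f i * g i) ^ 2 ≤ √((∑' i, f i ^ 2) * ∑' i, g i ^ 2) ^ 2 :=
        pow_le_pow_left₀ (tsum_nonneg h0) this 2
    _ = _ := Real.sq_sqrt (mul_nonneg hfn hgn)

/-- A discrete substitute for the integral of R / (R² + c² x²): the right side is built from N / (R
+ c N), whose increments R / ((R + c (N + 1)) (R + c N)) dominate half of each new term. -/
lemma sum_Icc_lorentz_le {R c : ℝ} (hR : 0 < R) (hc : 0 < c) (N : ℕ) :
    ∑ n ∈ Finset.Icc (-(N : ℤ)) N, R / (R ^ 2 + c ^ 2 * (n : ℝ) ^ 2)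
      ≤ 1 / R + 4 * (N / (R + c * N)) := by
  induction N with
  | zero => simp [sq]
  | succ N ih =>
    have e : Finset.Icc (-((N + 1 : ℕ) : ℤ)) ((N + 1 : ℕ) : ℤ) =
        insert (-((N + 1 : ℕ) : ℤ)) (insert ((N + 1 : ℕ) : ℤ) (Finset.Icc (-(N : ℤ)) N)) := by
      ext x; simp only [Finset.mem_Icc, Finset.mem_insert]; omega
    rw [e, Finset.sum_insert (by simp; omega), Finset.sum_insert (by simp)]
    have hN : (0 : ℝ) ≤ N := Nat.cast_nonneg N
    have key : R / (R ^ 2 + c ^ 2 * ((N : ℝ) + 1) ^ 2) ≤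
        2 * (((N : ℝ) + 1) / (R + c * (N + 1)) - N / (R + c * N)) := by
      have h1 : ((N : ℝ) + 1) / (R + c * (N + 1)) - N / (R + c * N) =
          R / ((R + c * (N + 1)) * (R + c * N)) := by
        field_simp; ring
      rw [h1, ← mul_div_assoc, div_le_div_iff₀ (by positivity) (by positivity)]
      have : (R + c * ((N : ℝ) + 1)) * (R + c * N) ≤ 2 * (R ^ 2 + c ^ 2 * ((N : ℝ) + 1) ^ 2) := by
        have hm : c * (N : ℝ) ≤ c * (N + 1) := by nlinarith
        have h2 : (R + c * ((N : ℝ) + 1)) * (R + c * N) ≤ (R + c * (N + 1)) * (R + c * (N + 1)) :=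
          mul_le_mul_of_nonneg_left (by linarith) (by positivity)
        nlinarith [sq_nonneg (R - c * ((N : ℝ) + 1))]
      nlinarith
    push_cast
    rw [neg_sq]
    linarith

lemma sum_Icc_lorentz_le' {R c : ℝ} (hR : 0 < R) (hc : 0 < c) (N : ℕ) :
    ∑ n ∈ Finset.Icc (-(N : ℤ)) N, R / (R ^ 2 + c ^ 2 * (n : ℝ) ^ 2) ≤ 1 / R + 4 / c := by
  refine (sum_Icc_lorentz_le hR hc N).trans ?_
  have : (N : ℝ) / (R + c * N) ≤ 1 / c := by
    rw [div_le_div_iff₀ (by positivity) hc]; nlinarith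
  have e : 4 / c = 4 * (1 / c) := by ring
  rw [e]; linarith

variable {L₁ L₂ : ℝ} [hL₁ : Fact (0 < L₁)] [hL₂ : Fact (0 < L₂)]

lemma kappaSq_nonneg (k : ℤ × ℤ) : 0 ≤ kappaSq L₁ L₂ k := by unfold kappaSq; positivity

lemma kappaSq_zero : kappaSq L₁ L₂ 0 = 0 := by simp [kappaSq, wave₁, wave₂]

lemma wave₁_neg (k : ℤ × ℤ) : wave₁ L₁ (-k) = -wave₁ L₁ k := by
  simp [wave₁, neg_div]

lemma wave₂_neg (k : ℤ × ℤ) : wave₂ L₂ (-k) = -wave₂ L₂ k := by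
  simp [wave₂, neg_div]

lemma kappaSq_neg (k : ℤ × ℤ) : kappaSq L₁ L₂ (-k) = kappaSq L₁ L₂ k := by
  simp [kappaSq, wave₁_neg, wave₂_neg]

variable (L₁ L₂) in
/-- A lower bound for the non-zero values of `κ²`. -/
def gap : ℝ := min ((2 * Real.pi / L₁) ^ 2) ((2 * Real.pi / L₂) ^ 2)

lemma gap_pos : 0 < gap L₁ L₂ := by
  have := hL₁.out; have := hL₂.out
  exact lt_min (by positivity) (by positivity)

lemma gap_le_kappaSq {k : ℤ × ℤ} (hk : k ≠ 0) : gap L₁ L₂ ≤ kappaSq L₁ L₂ k := by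
  have e : kappaSq L₁ L₂ k =
      (2 * Real.pi / L₁) ^ 2 * (k.1 : ℝ) ^ 2 + (2 * Real.pi / L₂) ^ 2 * (k.2 : ℝ) ^ 2 := by
    simp only [kappaSq, wave₁, wave₂]; ring
  have key : ∀ n : ℤ, n ≠ 0 → (1 : ℝ) ≤ (n : ℝ) ^ 2 := by
    intro n hn
    have h1 : (1 : ℤ) ≤ n ^ 2 := by
      have := sq_nonneg n
      have : n ^ 2 ≠ 0 := pow_ne_zero 2 hn
      omega
    exact_mod_cast h1
  rw [e]
  rcases not_and_or.1 (fun h => hk (Prod.ext_iff.2 h)) with h | h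
  · refine (min_le_left _ _).trans ?_
    nlinarith [key _ h, sq_nonneg (2 * Real.pi / L₁), mul_nonneg (sq_nonneg (2 * Real.pi / L₂))
      (sq_nonneg (k.2 : ℝ))]
  · refine (min_le_right _ _).trans ?_
    nlinarith [key _ h, sq_nonneg (2 * Real.pi / L₂), mul_nonneg (sq_nonneg (2 * Real.pi / L₁))
      (sq_nonneg (k.1 : ℝ))]

variable (L₁ L₂) in
/-- The constant in the bound for the lattice sums. -/
def latticeConst : ℝ :=
  2 * ((1 / √(gap L₁ L₂) + 4 / (2 * Real.pi / L₁)) * (1 / √(gap L₁ L₂) + 4 / (2 * Real.pi / L₂)))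

lemma latticeConst_pos : 0 < latticeConst L₁ L₂ := by
  have := hL₁.out; have := hL₂.out; have := gap_pos (L₁ := L₁) (L₂ := L₂)
  unfold latticeConst; positivity

/-- A bound for sums over the dual lattice that is uniform in the scale `ρ`. -/
lemma sum_lattice_le {ρ : ℝ} (hρ : gap L₁ L₂ ≤ ρ) (S : Finset (ℤ × ℤ)) :
    ∑ k ∈ S, ρ / (ρ ^ 2 + kappaSq L₁ L₂ k ^ 2) ≤ latticeConst L₁ L₂ := by
  have hg := gap_pos (L₁ := L₁) (L₂ := L₂)
  have hρ0 : 0 < ρ := hg.trans_le hρ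
  set R := √ρ with hR
  have hR0 : 0 < R := Real.sqrt_pos.2 hρ0
  have hR2 : R ^ 2 = ρ := Real.sq_sqrt hρ0.le
  set c₁ := 2 * Real.pi / L₁ with hc₁
  set c₂ := 2 * Real.pi / L₂ with hc₂
  have h1 := hL₁.out; have h2 := hL₂.out
  have hc₁0 : 0 < c₁ := by positivity
  have hc₂0 : 0 < c₂ := by positivity
  obtain ⟨N, hN⟩ : ∃ N : ℕ, S ⊆ Finset.Icc (-(N : ℤ)) N ×ˢ Finset.Icc (-(N : ℤ)) N := by
    refine ⟨∑ k ∈ S, (k.1.natAbs + k.2.natAbs), fun k hk => ?_⟩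
    have := Finset.single_le_sum (f := fun k : ℤ × ℤ => k.1.natAbs + k.2.natAbs)
      (fun _ _ => Nat.zero_le _) hk
    simp only [Finset.mem_product, Finset.mem_Icc]
    omega
  -- The two-dimensional summand is dominated by a product of one-dimensional ones at scale R = √ρ,
  -- so that the double sum factors.
  have hterm : ∀ k : ℤ × ℤ, ρ / (ρ ^ 2 + kappaSq L₁ L₂ k ^ 2) ≤
      2 * ((R / (R ^ 2 + c₁ ^ 2 * (k.1 : ℝ) ^ 2)) * (R / (R ^ 2 + c₂ ^ 2 * (k.2 : ℝ) ^ 2))) := by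
    intro k
    have e : kappaSq L₁ L₂ k = c₁ ^ 2 * (k.1 : ℝ) ^ 2 + c₂ ^ 2 * (k.2 : ℝ) ^ 2 := by
      simp only [kappaSq, wave₁, wave₂, hc₁, hc₂]; ring
    rw [e, div_mul_div_comm, ← sq, hR2, ← mul_div_assoc]
    set x := c₁ ^ 2 * (k.1 : ℝ) ^ 2
    set y := c₂ ^ 2 * (k.2 : ℝ) ^ 2
    have hx : 0 ≤ x := by positivity
    have hy : 0 ≤ y := by positivity
    rw [div_le_div_iff₀ (by positivity) (by positivity)]
    have : (ρ + x) * (ρ + y) ≤ 2 * (ρ ^ 2 + (x + y) ^ 2) := by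
      nlinarith [sq_nonneg (ρ - (x + y)), mul_nonneg hx hy, sq_nonneg (x - y), sq_nonneg (x + y)]
    nlinarith
  calc _ ≤ ∑ k ∈ S, 2 * ((R / (R ^ 2 + c₁ ^ 2 * (k.1 : ℝ) ^ 2)) *
          (R / (R ^ 2 + c₂ ^ 2 * (k.2 : ℝ) ^ 2))) := Finset.sum_le_sum fun k _ => hterm k
    _ ≤ ∑ k ∈ Finset.Icc (-(N : ℤ)) N ×ˢ Finset.Icc (-(N : ℤ)) N,
          2 * ((R / (R ^ 2 + c₁ ^ 2 * (k.1 : ℝ) ^ 2)) *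
          (R / (R ^ 2 + c₂ ^ 2 * (k.2 : ℝ) ^ 2))) :=
        Finset.sum_le_sum_of_subset_of_nonneg hN fun k _ _ => by positivity
    _ = 2 * ((∑ n ∈ Finset.Icc (-(N : ℤ)) N, R / (R ^ 2 + c₁ ^ 2 * (n : ℝ) ^ 2)) *
          ∑ n ∈ Finset.Icc (-(N : ℤ)) N, R / (R ^ 2 + c₂ ^ 2 * (n : ℝ) ^ 2)) := by
        rw [← Finset.mul_sum, Finset.sum_mul_sum, Finset.sum_product]
    _ ≤ 2 * ((1 / √(gap L₁ L₂) + 4 / c₁) * (1 / √(gap L₁ L₂) + 4 / c₂)) := by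
        have hgR : 1 / R ≤ 1 / √(gap L₁ L₂) :=
          one_div_le_one_div_of_le (Real.sqrt_pos.2 hg) (Real.sqrt_le_sqrt hρ)
        have a1 := (sum_Icc_lorentz_le' hR0 hc₁0 N).trans (add_le_add_left hgR _)
        have a2 := (sum_Icc_lorentz_le' hR0 hc₂0 N).trans (add_le_add_left hgR _)
        gcongr
    _ = latticeConst L₁ L₂ := rfl

lemma summable_inv_kappaSq_sq : Summable fun k => 1 / (1 + kappaSq L₁ L₂ k ^ 2) := by
  have hg := gap_pos (L₁ := L₁) (L₂ := L₂)
  set ρ := max (gap L₁ L₂) 1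
  have hρ : 1 ≤ ρ := le_max_right _ _
  have h1 : Summable fun k => ρ / (ρ ^ 2 + kappaSq L₁ L₂ k ^ 2) :=
    summable_of_sum_le (fun k => by positivity) (sum_lattice_le (le_max_left _ _))
  refine Summable.of_nonneg_of_le (fun k => by positivity) (fun k => ?_) (h1.mul_left ρ)
  rw [← mul_div_assoc, div_le_div_iff₀ (by positivity) (by positivity)]
  nlinarith [sq_nonneg (kappaSq L₁ L₂ k), mul_nonneg (sub_nonneg.2 hρ) (sq_nonneg (kappaSq L₁ L₂ k)),
    mul_nonneg (mul_nonneg (sub_nonneg.2 hρ) (sub_nonneg.2 hρ)) (sq_nonneg (kappaSq L₁ L₂ k))]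

/-! ### Sobolev seminorms of sequences, Poincaré's and Agmon's inequalities. -/

variable (L₁ L₂) in
/-- The square of a Sobolev seminorm of a function with Fourier coefficients `a`. -/
def wsum (n : ℕ) (a : ℤ × ℤ → ℂ) : ℝ := ∑' k, kappaSq L₁ L₂ k ^ n * ‖a k‖ ^ 2

variable (L₁ L₂) in
/-- The sequence `a` is in the Sobolev space `H²`. -/
def InH2 (a : ℤ × ℤ → ℂ) : Prop :=
  (Summable fun k => ‖a k‖ ^ 2) ∧ Summable fun k => kappaSq L₁ L₂ k ^ 2 * ‖a k‖ ^ 2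

lemma wsum_nonneg (n : ℕ) (a : ℤ × ℤ → ℂ) : 0 ≤ wsum L₁ L₂ n a :=
  tsum_nonneg fun k => mul_nonneg (pow_nonneg (kappaSq_nonneg k) n) (sq_nonneg _)

lemma wsum_zero (a : ℤ × ℤ → ℂ) : wsum L₁ L₂ 0 a = ∑' k, ‖a k‖ ^ 2 := by simp [wsum]

/-- Interpolation: κ² ‖a k‖² is the product of ‖a k‖ and κ² ‖a k‖, and Cauchy–Schwarz applies. -/
lemma InH2.summable_one {a : ℤ × ℤ → ℂ} (ha : InH2 L₁ L₂ a) :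
    (Summable fun k => kappaSq L₁ L₂ k ^ 1 * ‖a k‖ ^ 2) ∧
      wsum L₁ L₂ 1 a ^ 2 ≤ wsum L₁ L₂ 0 a * wsum L₁ L₂ 2 a := by
  have h := cauchySchwarz_tsum (f := fun k => ‖a k‖) (g := fun k => kappaSq L₁ L₂ k * ‖a k‖)
    (fun k => norm_nonneg _) (fun k => mul_nonneg (kappaSq_nonneg k) (norm_nonneg _)) ha.1
    (by simpa only [mul_pow] using ha.2)
  have e : ∀ k, ‖a k‖ * (kappaSq L₁ L₂ k * ‖a k‖) = kappaSq L₁ L₂ k ^ 1 * ‖a k‖ ^ 2 :=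
    fun k => by ring
  simp only [e, mul_pow] at h
  refine ⟨h.1, ?_⟩
  rw [wsum_zero]
  exact h.2

/-- Poincaré's inequality. -/
lemma InH2.gap_mul_le {a : ℤ × ℤ → ℂ} (ha : InH2 L₁ L₂ a) (h0 : a 0 = 0) :
    gap L₁ L₂ ^ 2 * wsum L₁ L₂ 0 a ≤ wsum L₁ L₂ 2 a ∧
    gap L₁ L₂ * wsum L₁ L₂ 1 a ≤ wsum L₁ L₂ 2 a := by
  have hg := gap_pos (L₁ := L₁) (L₂ := L₂)
  constructor
  · rw [wsum_zero, wsum, ← tsum_mul_left]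
    refine (ha.1.mul_left _).tsum_le_tsum (fun k => ?_) ha.2
    by_cases hk : k = 0
    · simp [hk, h0]
    · gcongr; exact gap_le_kappaSq hk
  · rw [wsum, wsum, ← tsum_mul_left]
    refine (ha.summable_one.1.mul_left _).tsum_le_tsum (fun k => ?_) ha.2
    by_cases hk : k = 0
    · simp [hk, h0]
    · rw [← mul_assoc, pow_one, sq (kappaSq L₁ L₂ k)]
      gcongr
      · exact kappaSq_nonneg k
      · exact gap_le_kappaSq hk

/-- Agmon's inequality. -/
lemma InH2.agmon {a : ℤ × ℤ → ℂ} (ha : InH2 L₁ L₂ a) (h0 : a 0 = 0) :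
    (Summable fun k => ‖a k‖) ∧ (∑' k, ‖a k‖) ^ 2 ≤
      2 * latticeConst L₁ L₂ * (√(wsum L₁ L₂ 0 a) * √(wsum L₁ L₂ 2 a)) := by
  have hg := gap_pos (L₁ := L₁) (L₂ := L₂)
  have hK := latticeConst_pos (L₁ := L₁) (L₂ := L₂)
  set X := wsum L₁ L₂ 0 a with hX
  set D := wsum L₁ L₂ 2 a with hD
  have hX0 : 0 ≤ X := wsum_nonneg 0 a
  have hD0 : 0 ≤ D := wsum_nonneg 2 a
  rcases hX0.eq_or_lt with hX1 | hX1
  · have hz : ∀ k, a k = 0 := by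
      intro k
      have h1 := ha.1.le_tsum k fun _ _ => sq_nonneg _
      rw [← wsum_zero (L₁ := L₁) (L₂ := L₂), ← hX, ← hX1] at h1
      simpa using le_antisymm h1 (sq_nonneg _)
    simp only [hz, norm_zero, tsum_zero]
    exact ⟨summable_zero, by simp only [ne_eq, OfNat.ofNat_ne_zero, not_false_eq_true, zero_pow]; positivity⟩
  · have hP := (ha.gap_mul_le h0).1
    -- The scale that balances the two parts ρ X and D / ρ of the weighted sum below. Poincaré's
    -- inequality gives ρ ≥ `gap`, as the uniform lattice bound requires.
    set ρ := √D / √X with hρ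
    have hsX : 0 < √X := Real.sqrt_pos.2 hX1
    have hρg : gap L₁ L₂ ≤ ρ := by
      rw [hρ, le_div_iff₀ hsX]
      refine Real.le_sqrt_of_sq_le ?_
      rw [mul_pow, Real.sq_sqrt hX0]
      exact hP
    have hρ0 : 0 < ρ := hg.trans_le hρg
    have hsD : 0 < √D := by
      have := mul_pos hρ0 hsX
      rwa [hρ, div_mul_cancel₀ _ hsX.ne'] at this
    have hb : ∀ S : Finset (ℤ × ℤ), ∑ k ∈ S, ‖a k‖ ≤
        √(2 * latticeConst L₁ L₂ * (√X * √D)) := by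
      intro S
      refine Real.le_sqrt_of_sq_le ?_
      -- Cauchy–Schwarz with the weight ρ + κ⁴ / ρ, whose reciprocal is the summand of the lattice
      -- sum.
      have h1 := Finset.sum_sq_le_sum_mul_sum_of_sq_le_mul S
        (r := fun k => ‖a k‖) (f := fun k => (ρ + kappaSq L₁ L₂ k ^ 2 / ρ) * ‖a k‖ ^ 2)
        (g := fun k => ρ / (ρ ^ 2 + kappaSq L₁ L₂ k ^ 2)) (fun k _ => by positivity)
        (fun k _ => by positivity) (fun k _ => by
          have : ρ ^ 2 + kappaSq L₁ L₂ k ^ 2 ≠ 0 := by positivity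
          refine le_of_eq ?_
          field_simp)
      refine h1.trans ?_
      have h2 : ∑ k ∈ S, (ρ + kappaSq L₁ L₂ k ^ 2 / ρ) * ‖a k‖ ^ 2 ≤ 2 * (√X * √D) := by
        have e : ∀ k, (ρ + kappaSq L₁ L₂ k ^ 2 / ρ) * ‖a k‖ ^ 2 =
            ρ * ‖a k‖ ^ 2 + ρ⁻¹ * (kappaSq L₁ L₂ k ^ 2 * ‖a k‖ ^ 2) := fun k => by ring
        simp only [e]
        rw [Finset.sum_add_distrib, ← Finset.mul_sum, ← Finset.mul_sum]
        have i1 := ha.1.sum_le_tsum S fun _ _ => sq_nonneg _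
        rw [← wsum_zero (L₁ := L₁) (L₂ := L₂), ← hX] at i1
        have i2 : ∑ k ∈ S, kappaSq L₁ L₂ k ^ 2 * ‖a k‖ ^ 2 ≤ D :=
          ha.2.sum_le_tsum S fun _ _ => by positivity
        have j1 : ρ * X = √X * √D := by
          rw [hρ]; field_simp; rw [Real.sq_sqrt hX0]
        have j2 : ρ⁻¹ * D = √X * √D := by
          rw [hρ]; field_simp; rw [Real.sq_sqrt hD0]
        calc _ ≤ ρ * X + ρ⁻¹ * D := by gcongr
          _ = _ := by rw [j1, j2]; ring
      calc _ ≤ (2 * (√X * √D)) * latticeConst L₁ L₂ :=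
            mul_le_mul h2 (sum_lattice_le hρg S) (Finset.sum_nonneg fun k _ => by positivity)
              (by positivity)
        _ = _ := by ring
    have hs := summable_of_sum_le (fun k => norm_nonneg (a k)) hb
    refine ⟨hs, ?_⟩
    have := Real.tsum_le_of_sum_le (fun k => norm_nonneg (a k)) hb
    calc _ ≤ √(2 * latticeConst L₁ L₂ * (√X * √D)) ^ 2 :=
          pow_le_pow_left₀ (tsum_nonneg fun k => norm_nonneg _) this 2
      _ = _ := Real.sq_sqrt (by positivity)

/-! ### Fourier multipliers -/

lemma coeff_multiplier {m : ℤ × ℤ → ℂ} {f : Torus L₁ L₂ → ℝ}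
    (h : ∃ g : L2 L₁ L₂, IsMultiplierImage m f g) (k : ℤ × ℤ) :
    coeff (multiplier m f) k = m k * coeff f k := by
  rw [multiplier, dif_pos h]
  exact h.choose_spec k

lemma exists_isMultiplierImage {m : ℤ × ℤ → ℂ} {f : Torus L₁ L₂ → ℝ}
    (hm : ∀ k, m (-k) = conj (m k)) (hs : Summable fun k => ‖m k * coeff f k‖ ^ 2) :
    ∃ g : L2 L₁ L₂, IsMultiplierImage m f g :=
  exists_L2_coeff_eq (fun k => m k * coeff f k) hs fun k => by rw [hm, coeff_neg, map_mul]

lemma symb₁_neg (k : ℤ × ℤ) : symb₁ L₁ (-k) = conj (symb₁ L₁ k) := by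
  simp [symb₁, wave₁_neg]

lemma symb₂_neg (k : ℤ × ℤ) : symb₂ L₂ (-k) = conj (symb₂ L₂ k) := by
  simp [symb₂, wave₂_neg]

lemma norm_symb_sq (k : ℤ × ℤ) :
    ‖symb₁ L₁ k‖ ^ 2 + ‖symb₂ L₂ k‖ ^ 2 = kappaSq L₁ L₂ k := by
  simp [symb₁, symb₂, kappaSq]

/-- Parseval's identity with |symb₁|² + |symb₂|² = κ². From here on, membership in H¹ is a
summability condition. -/
lemma memH1_iff (f : L2 L₁ L₂) :
    MemH1 f ↔ Summable fun k => kappaSq L₁ L₂ k ^ 1 * ‖coeff f k‖ ^ 2 := by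
  constructor
  · rintro ⟨⟨g₁, h₁⟩, g₂, h₂⟩
    refine ((hasSum_norm_coeff_sq g₁).summable.add (hasSum_norm_coeff_sq g₂).summable).congr ?_
    intro k
    rw [h₁, h₂, norm_mul, norm_mul, mul_pow, mul_pow, ← add_mul, norm_symb_sq, pow_one]
  · intro h
    constructor
    · refine exists_isMultiplierImage symb₁_neg (h.of_nonneg_of_le (fun k => sq_nonneg _) fun k => ?_)
      rw [norm_mul, mul_pow, ← norm_symb_sq, pow_one]
      gcongr; exact le_add_of_nonneg_right (sq_nonneg _)
    · refine exists_isMultiplierImage symb₂_neg (h.of_nonneg_of_le (fun k => sq_nonneg _) fun k => ?_)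
      rw [norm_mul, mul_pow, ← norm_symb_sq, pow_one]
      gcongr; exact le_add_of_nonneg_left (sq_nonneg _)

lemma InH2.memH1 {f : L2 L₁ L₂} (h : InH2 L₁ L₂ (coeff f)) : MemH1 f :=
  (memH1_iff f).2 h.summable_one.1

lemma MemH1.coeff_partial₁ {f : L2 L₁ L₂} (h : MemH1 f) (k : ℤ × ℤ) :
    coeff (partial₁ f) k = symb₁ L₁ k * coeff f k := coeff_multiplier h.1 k

lemma MemH1.coeff_partial₂ {f : L2 L₁ L₂} (h : MemH1 f) (k : ℤ × ℤ) :
    coeff (partial₂ f) k = symb₂ L₂ k * coeff f k := coeff_multiplier h.2 k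

lemma MemH1.norm_sq_partial {f : L2 L₁ L₂} (h : MemH1 f) :
    ‖partial₁ f‖ ^ 2 + ‖partial₂ f‖ ^ 2 = area L₁ L₂ * wsum L₁ L₂ 1 (coeff f) := by
  have h1 := hasSum_norm_coeff_sq (partial₁ f)
  have h2 := hasSum_norm_coeff_sq (partial₂ f)
  have h3 := (h1.add h2).tsum_eq
  rw [← mul_add] at h3
  rw [wsum]
  have e : ∀ k, ‖coeff (partial₁ f) k‖ ^ 2 + ‖coeff (partial₂ f) k‖ ^ 2 =
      kappaSq L₁ L₂ k ^ 1 * ‖coeff f k‖ ^ 2 := by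
    intro k
    rw [h.coeff_partial₁, h.coeff_partial₂, norm_mul, norm_mul, mul_pow, mul_pow, ← add_mul,
      norm_symb_sq, pow_one]
  simp only [e] at h3
  rw [h3, mul_inv_cancel_left₀ area_pos.ne']

lemma MemH1.gradNorm_sq {f : L2 L₁ L₂} (h : MemH1 f) :
    gradNorm f ^ 2 = area L₁ L₂ * wsum L₁ L₂ 1 (coeff f) := by
  rw [gradNorm, Real.sq_sqrt (by positivity), h.norm_sq_partial]

lemma integrable_gradSq (f : L2 L₁ L₂) : Integrable (gradSq f) volume :=
  ((Lp.memLp (partial₁ f)).integrable_sq).add ((Lp.memLp (partial₂ f)).integrable_sq)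

lemma integral_gradSq (f : L2 L₁ L₂) :
    ∫ x, gradSq f x = ‖partial₁ f‖ ^ 2 + ‖partial₂ f‖ ^ 2 := by
  rw [norm_sq_eq_integral, norm_sq_eq_integral, ← integral_add
    ((Lp.memLp (partial₁ f)).integrable_sq) ((Lp.memLp (partial₂ f)).integrable_sq)]
  rfl

/-- The function |∇f|² is only in `L¹`, so its coefficients are bounded but need not be square
summable. In the energy estimates this bound is paired with ∑ ‖a k‖, which Agmon's inequality
controls. -/
lemma MemH1.norm_coeff_gradSq_le {f : L2 L₁ L₂} (h : MemH1 f) (k : ℤ × ℤ) :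
    ‖coeff (fun x => 1 / 2 * gradSq f x) k‖ ≤ 1 / 2 * wsum L₁ L₂ 1 (coeff f) := by
  rw [coeff_const_mul, norm_mul]
  have h1 := norm_coeff_le (gradSq f) k
  have h2 : ∫ x, |gradSq f x| = ∫ x, gradSq f x :=
    integral_congr_ae (Filter.Eventually.of_forall fun x =>
      abs_of_nonneg (by unfold gradSq; positivity))
  rw [h2, integral_gradSq, h.norm_sq_partial, inv_mul_cancel_left₀ area_pos.ne'] at h1
  have h3 : ‖((1 / 2 : ℝ) : ℂ)‖ = 1 / 2 := by
    rw [Complex.norm_real]; norm_num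
  rw [h3]
  linarith

/-! ### Transport -/

/-- `w` is a measurable vector field that is bounded by `K` and has divergence zero. -/
structure IsBoundedDivFree (K : ℝ) (w : Torus L₁ L₂ → ℝ × ℝ) : Prop where
  measurable : Measurable w
  bound : ∀ x, ‖w x‖ ≤ K
  divFree : ∀ k, symb₁ L₁ k * coeff (fun x => (w x).1) k +
    symb₂ L₂ k * coeff (fun x => (w x).2) k = 0

variable {K : ℝ} {w : Torus L₁ L₂ → ℝ × ℝ}

lemma IsBoundedDivFree.memLp_fst (hw : IsBoundedDivFree K w) {p : ENNReal} :
    MemLp (fun x => (w x).1) p volume :=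
  MemLp.of_bound hw.measurable.fst.aestronglyMeasurable K
    (Filter.Eventually.of_forall fun x => (norm_fst_le _).trans (hw.bound x))

lemma IsBoundedDivFree.memLp_snd (hw : IsBoundedDivFree K w) {p : ENNReal} :
    MemLp (fun x => (w x).2) p volume :=
  MemLp.of_bound hw.measurable.snd.aestronglyMeasurable K
    (Filter.Eventually.of_forall fun x => (norm_snd_le _).trans (hw.bound x))

lemma IsBoundedDivFree.memLp_fst_mul (hw : IsBoundedDivFree K w) (f : L2 L₁ L₂) :
    MemLp (fun x => (w x).1 * f x) 2 volume :=
  (Lp.memLp f).of_le_mul (c := K)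
    (hw.measurable.fst.aestronglyMeasurable.mul (Lp.memLp f).aestronglyMeasurable)
    (Filter.Eventually.of_forall fun x => by
      rw [norm_mul]
      exact mul_le_mul_of_nonneg_right ((norm_fst_le _).trans (hw.bound x)) (norm_nonneg _))

lemma IsBoundedDivFree.memLp_snd_mul (hw : IsBoundedDivFree K w) (f : L2 L₁ L₂) :
    MemLp (fun x => (w x).2 * f x) 2 volume :=
  (Lp.memLp f).of_le_mul (c := K)
    (hw.measurable.snd.aestronglyMeasurable.mul (Lp.memLp f).aestronglyMeasurable)
    (Filter.Eventually.of_forall fun x => by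
      rw [norm_mul]
      exact mul_le_mul_of_nonneg_right ((norm_snd_le _).trans (hw.bound x)) (norm_nonneg _))

lemma IsBoundedDivFree.memLp_advect (hw : IsBoundedDivFree K w) (f : L2 L₁ L₂) :
    MemLp (advect w f) 2 volume :=
  (hw.memLp_fst_mul (partial₁ f)).add (hw.memLp_snd_mul (partial₂ f))

lemma IsBoundedDivFree.integrable_advect (hw : IsBoundedDivFree K w) (f : L2 L₁ L₂) :
    Integrable (advect w f) volume := (hw.memLp_advect f).integrable (by norm_num)

lemma IsBoundedDivFree.coeff_advect (hw : IsBoundedDivFree K w) (f : L2 L₁ L₂) (k : ℤ × ℤ) :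
    coeff (advect w f) k = coeff (fun x => (w x).1 * partial₁ f x) k +
      coeff (fun x => (w x).2 * partial₂ f x) k :=
  coeff_add ((hw.memLp_fst_mul _).integrable (by norm_num))
    ((hw.memLp_snd_mul _).integrable (by norm_num)) k

/-- The Fourier coefficients of `w · ∇f`, as a series in those of `f`. -/
lemma IsBoundedDivFree.hasSum_coeff_advect (hw : IsBoundedDivFree K w) {f : L2 L₁ L₂}
    (h : MemH1 f) (k : ℤ × ℤ) :
    HasSum (fun j => (coeff (fun x => (w x).1) (k - j) * symb₁ L₁ j +
      coeff (fun x => (w x).2) (k - j) * symb₂ L₂ j) * coeff f j) (coeff (advect w f) k) := by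
  rw [hw.coeff_advect]
  refine ((hasSum_coeff_mul_fun hw.memLp_fst (Lp.memLp (partial₁ f)) k).add
    (hasSum_coeff_mul_fun hw.memLp_snd (Lp.memLp (partial₂ f)) k)).congr_fun fun j => ?_
  rw [h.coeff_partial₁, h.coeff_partial₂]; ring

/-- The identity `w · ∇f = div (f w)`. -/
lemma IsBoundedDivFree.coeff_advect_eq_div (hw : IsBoundedDivFree K w) {f : L2 L₁ L₂}
    (h : MemH1 f) (k : ℤ × ℤ) :
    coeff (advect w f) k = symb₁ L₁ k * coeff (fun x => (w x).1 * f x) k +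
      symb₂ L₂ k * coeff (fun x => (w x).2 * f x) k := by
  refine (hw.hasSum_coeff_advect h k).unique ?_
  refine (((hasSum_coeff_mul_fun hw.memLp_fst (Lp.memLp f) k).mul_left (symb₁ L₁ k)).add
    ((hasSum_coeff_mul_fun hw.memLp_snd (Lp.memLp f) k).mul_left (symb₂ L₂ k))).congr_fun
    fun j => ?_
  -- Splitting k = (k - j) + j is the product rule on the Fourier side; the k - j part is the
  -- divergence of `w` and drops out.
  have e1 : symb₁ L₁ k = symb₁ L₁ (k - j) + symb₁ L₁ j := by
    simp only [symb₁, wave₁, Prod.fst_sub, Int.cast_sub]; push_cast; ring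
  have e2 : symb₂ L₂ k = symb₂ L₂ (k - j) + symb₂ L₂ j := by
    simp only [symb₂, wave₂, Prod.snd_sub, Int.cast_sub]; push_cast; ring
  rw [e1, e2]
  linear_combination (-coeff f j) * hw.divFree (k - j)

lemma IsBoundedDivFree.coeff_advect_zero (hw : IsBoundedDivFree K w) {f : L2 L₁ L₂}
    (h : MemH1 f) : coeff (advect w f) 0 = 0 := by
  rw [hw.coeff_advect_eq_div h]; simp [symb₁, symb₂, wave₁, wave₂]

/-- Transport by a divergence free field does not change the energy. -/
lemma IsBoundedDivFree.hasSum_advect_eq_zero (hw : IsBoundedDivFree K w) {f : L2 L₁ L₂}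
    (h : MemH1 f) :
    HasSum (fun k => conj (coeff f k) * coeff (advect w f) k) 0 := by
  have h1 := hasSum_coeff_mul (Lp.memLp f) (hw.memLp_advect f)
  have h2 := hasSum_coeff_mul (Lp.memLp (partial₁ f)) (hw.memLp_fst_mul f)
  have h3 := hasSum_coeff_mul (Lp.memLp (partial₂ f)) (hw.memLp_snd_mul f)
  have h4 := (h2.add h3).neg
  have h5 : HasSum (fun k => conj (coeff f k) * coeff (advect w f) k) _ :=
    h4.congr_fun fun k => by
      rw [hw.coeff_advect_eq_div h, h.coeff_partial₁, h.coeff_partial₂, map_mul, map_mul]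
      -- The symbols are purely imaginary, which is integration by parts: it shows that the integral
      -- of f (w · ∇f) equals its own negative.
      have e1 : conj (symb₁ L₁ k) = -symb₁ L₁ k := by simp [symb₁]
      have e2 : conj (symb₂ L₂ k) = -symb₂ L₂ k := by simp [symb₂]
      rw [e1, e2]; ring
  have e := h1.unique h5
  have i1 : Integrable (fun x => partial₁ f x * ((w x).1 * f x)) volume :=
    (Lp.memLp (partial₁ f)).integrable_mul (hw.memLp_fst_mul f)
  have i2 : Integrable (fun x => partial₂ f x * ((w x).2 * f x)) volume :=
    (Lp.memLp (partial₂ f)).integrable_mul (hw.memLp_snd_mul f)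
  have e' : ∫ x, f x * advect w f x =
      (∫ x, partial₁ f x * ((w x).1 * f x)) + ∫ x, partial₂ f x * ((w x).2 * f x) := by
    rw [← integral_add i1 i2]
    congr 1; ext x; simp only [advect]; ring
  rw [← Complex.ofReal_add, ← Complex.ofReal_neg, Complex.ofReal_inj, ← mul_add, ← e'] at e
  have : (area L₁ L₂)⁻¹ * ∫ x, f x * advect w f x = 0 := by linarith
  rw [this] at h1
  simpa using h1

/-- The `L²` bound for the transport term. -/
lemma IsBoundedDivFree.tsum_advect_le (hw : IsBoundedDivFree K w) {f : L2 L₁ L₂} (h : MemH1 f) :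
    (Summable fun k => ‖coeff (advect w f) k‖ ^ 2) ∧
      ∑' k, ‖coeff (advect w f) k‖ ^ 2 ≤ 2 * K ^ 2 * wsum L₁ L₂ 1 (coeff f) := by
  have h1 := hasSum_norm_coeff_sq' (hw.memLp_advect f)
  refine ⟨h1.summable, ?_⟩
  rw [h1.tsum_eq, inv_mul_le_iff₀ area_pos]
  calc ∫ x, advect w f x ^ 2 ≤ ∫ x, 2 * K ^ 2 * gradSq f x := by
        refine integral_mono (hw.memLp_advect f).integrable_sq ((integrable_gradSq f).const_mul _) ?_
        intro x
        have b1 : (w x).1 ^ 2 ≤ K ^ 2 :=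
          sq_le_sq' (abs_le.1 ((norm_fst_le (w x)).trans (hw.bound x))).1
            (abs_le.1 ((norm_fst_le (w x)).trans (hw.bound x))).2
        have b2 : (w x).2 ^ 2 ≤ K ^ 2 :=
          sq_le_sq' (abs_le.1 ((norm_snd_le (w x)).trans (hw.bound x))).1
            (abs_le.1 ((norm_snd_le (w x)).trans (hw.bound x))).2
        simp only [advect, gradSq]
        set p := (w x).1
        set q := (w x).2
        set a := partial₁ f x
        set b := partial₂ f x
        nlinarith [sq_nonneg (p * a - q * b), mul_le_mul_of_nonneg_right b1 (sq_nonneg a),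
          mul_le_mul_of_nonneg_right b2 (sq_nonneg b)]
    _ = area L₁ L₂ * (2 * K ^ 2 * wsum L₁ L₂ 1 (coeff f)) := by
        rw [integral_const_mul, integral_gradSq, h.norm_sq_partial]; ring

/-- The derivatives are elements selected by choice, so their homogeneity in the function has to be
recovered from the uniqueness of Fourier coefficients. -/
lemma advect_smul (w : Torus L₁ L₂ → ℝ × ℝ) {f g : L2 L₁ L₂} (hf : MemH1 f) (hg : MemH1 g)
    (c : ℝ) (h : f = c • g) : advect w f =ᵐ[volume] fun x => c * advect w g x := by
  have e1 : partial₁ f = c • partial₁ g := L2_ext fun k => by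
    rw [hf.coeff_partial₁, coeff_smul_L2, hg.coeff_partial₁, h, coeff_smul_L2]; ring
  have e2 : partial₂ f = c • partial₂ g := L2_ext fun k => by
    rw [hf.coeff_partial₂, coeff_smul_L2, hg.coeff_partial₂, h, coeff_smul_L2]; ring
  filter_upwards [Lp.coeFn_smul c (partial₁ g), Lp.coeFn_smul c (partial₂ g)] with x h1 h2
  simp only [advect, e1, e2, h1, h2, Pi.smul_apply, smul_eq_mul]; ring

/-! ### Means -/

lemma coeff_zero_eq_mean (f : L2 L₁ L₂) : coeff f 0 = (mean f : ℂ) := by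
  rw [coeff_eq_ccoeff, ccoeff, mean, Complex.ofReal_mul, ← integral_complex_ofReal]
  simp only [neg_zero, expo_zero, one_mul, area, Complex.ofReal_inv]

lemma coeff_const (c : ℝ) (k : ℤ × ℤ) :
    coeff (Lp.const 2 volume c : L2 L₁ L₂) k = if k = 0 then (c : ℂ) else 0 := by
  rw [coeff_congr_ae (Lp.coeFn_const _ _ _), coeff_eq_ccoeff, ccoeff]
  simp only [Function.const_apply]
  rw [integral_mul_const, integral_expo]
  have := area_pos (L₁ := L₁) (L₂ := L₂)
  by_cases h : k = 0
  · subst h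
    have h0 : ((area L₁ L₂ : ℝ) : ℂ) ≠ 0 := by exact_mod_cast this.ne'
    simp [h0]
  · simp [h]

lemma coeff_meanFreePart (f : L2 L₁ L₂) (k : ℤ × ℤ) :
    coeff (meanFreePart f) k = if k = 0 then 0 else coeff f k := by
  rw [meanFreePart, coeff_sub_L2, coeff_const]
  split_ifs with h
  · rw [h, coeff_zero_eq_mean, sub_self]
  · rw [sub_zero]

lemma norm_sq_eq_mean (f : L2 L₁ L₂) :
    ‖f‖ ^ 2 = area L₁ L₂ * mean f ^ 2 + ‖meanFreePart f‖ ^ 2 := by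
  have hs := (hasSum_norm_coeff_sq f).summable
  rw [norm_sq_eq_tsum, norm_sq_eq_tsum, ← mul_add, hs.tsum_eq_add_tsum_ite 0]
  congr 2
  · rw [coeff_zero_eq_mean, Complex.norm_real, Real.norm_eq_abs, sq_abs]
  · congr 1; ext k
    rw [coeff_meanFreePart]; split_ifs <;> simp

/-! ### Absolutely continuous functions of time -/

lemma absolutelyContinuousOnInterval_primitive {q P : ℝ → ℝ} {s t c : ℝ}
    (hq : IntervalIntegrable q volume s t) (hP : ∀ r, P r = c + ∫ x in s..r, q x) :
    AbsolutelyContinuousOnInterval P s t := by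
  have h1 : AbsolutelyContinuousOnInterval (fun _ : ℝ => c) s t :=
    contDiffOn_const.absolutelyContinuousOnInterval
  have h2 := h1.fun_add (hq.absolutelyContinuousOnInterval_intervalIntegral (c := s) (by simp))
  rwa [show P = fun r => c + ∫ x in s..r, q x from funext hP]

/-- The product rule for primitives of integrable functions. -/
lemma integral_mul_primitive {q₁ q₂ P₁ P₂ : ℝ → ℝ} {s t c₁ c₂ : ℝ} (hst : s ≤ t)
    (h₁ : IntervalIntegrable q₁ volume s t) (h₂ : IntervalIntegrable q₂ volume s t)
    (hP₁ : ∀ r ∈ Icc s t, P₁ r = c₁ + ∫ x in s..r, q₁ x)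
    (hP₂ : ∀ r ∈ Icc s t, P₂ r = c₂ + ∫ x in s..r, q₂ x) :
    ∫ r in s..t, (q₁ r * P₂ r + P₁ r * q₂ r) = P₁ t * P₂ t - P₁ s * P₂ s := by
  have a1 := absolutelyContinuousOnInterval_primitive h₁ (P := fun r => c₁ + ∫ x in s..r, q₁ x)
    fun _ => rfl
  have a2 := absolutelyContinuousOnInterval_primitive h₂ (P := fun r => c₂ + ∫ x in s..r, q₂ x)
    fun _ => rfl
  have h := a1.integral_deriv_mul_eq_sub a2
  rw [hP₁ t (right_mem_Icc.2 hst), hP₂ t (right_mem_Icc.2 hst), hP₁ s (left_mem_Icc.2 hst),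
    hP₂ s (left_mem_Icc.2 hst), ← h]
  refine intervalIntegral.integral_congr_ae ?_
  filter_upwards [h₁.ae_hasDerivAt_integral, h₂.ae_hasDerivAt_integral] with x hx1 hx2 hx
  have hx' := uIoc_subset_uIcc hx
  have hxI : x ∈ Icc s t := by rwa [uIcc_of_le hst] at hx'
  rw [((hx1 hx' s (by simp)).const_add c₁).deriv, ((hx2 hx' s (by simp)).const_add c₂).deriv,
    hP₁ x hxI, hP₂ x hxI]

lemma intervalIntegrable_re {g : ℝ → ℂ} {s t : ℝ} (hg : IntervalIntegrable g volume s t) :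
    IntervalIntegrable (fun r => (g r).re) volume s t := ⟨hg.1.re, hg.2.re⟩

lemma intervalIntegrable_im {g : ℝ → ℂ} {s t : ℝ} (hg : IntervalIntegrable g volume s t) :
    IntervalIntegrable (fun r => (g r).im) volume s t := ⟨hg.1.im, hg.2.im⟩

lemma re_intervalIntegral {g : ℝ → ℂ} {s t : ℝ} (hg : IntervalIntegrable g volume s t) :
    (∫ r in s..t, g r).re = ∫ r in s..t, (g r).re :=
  (Complex.reCLM.intervalIntegral_comp_comm hg).symm

lemma im_intervalIntegral {g : ℝ → ℂ} {s t : ℝ} (hg : IntervalIntegrable g volume s t) :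
    (∫ r in s..t, g r).im = ∫ r in s..t, (g r).im :=
  (Complex.imCLM.intervalIntegral_comp_comm hg).symm

lemma intervalIntegrable_of_Icc_subset {E : Type*} [NormedAddCommGroup E] {g : ℝ → E}
    {s t a b : ℝ} (hg : IntervalIntegrable g volume s t) (ha : a ∈ Icc s t) (hb : b ∈ Icc s t) :
    IntervalIntegrable g volume a b :=
  hg.mono_set (by
    rw [uIcc_of_le (ha.1.trans ha.2)]
    exact uIcc_subset_Icc ha hb)

/-- The energy identity for one mode. -/
lemma norm_sq_sub_norm_sq {a g : ℝ → ℂ} {s t : ℝ} (hst : s ≤ t)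
    (hg : IntervalIntegrable g volume s t)
    (ha : ∀ r ∈ Icc s t, a r = a s - ∫ x in s..r, g x) :
    ‖a t‖ ^ 2 - ‖a s‖ ^ 2 = ∫ r in s..t, -2 * (conj (a r) * g r).re := by
  have hsub : ∀ r ∈ Icc s t, IntervalIntegrable g volume s r := fun r hr =>
    intervalIntegrable_of_Icc_subset hg (left_mem_Icc.2 hst) hr
  have hre : ∀ r ∈ Icc s t, (a r).re = (a s).re + ∫ x in s..r, -(g x).re := by
    intro r hr
    rw [ha r hr, Complex.sub_re, re_intervalIntegral (hsub r hr), intervalIntegral.integral_neg]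
    ring
  have him : ∀ r ∈ Icc s t, (a r).im = (a s).im + ∫ x in s..r, -(g x).im := by
    intro r hr
    rw [ha r hr, Complex.sub_im, im_intervalIntegral (hsub r hr), intervalIntegral.integral_neg]
    ring
  have ir := (intervalIntegrable_re hg).neg
  have ii := (intervalIntegrable_im hg).neg
  have e1 := integral_mul_primitive hst ir ir hre hre
  have e2 := integral_mul_primitive hst ii ii him him
  have hac : ContinuousOn a (uIcc s t) := by
    have := intervalIntegral.continuousOn_primitive_interval' hg (left_mem_uIcc)
    refine ((continuousOn_const (c := a s)).sub this).congr fun r hr => ?_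
    rw [uIcc_of_le hst] at hr
    exact ha r hr
  have cr : ContinuousOn (fun r => (a r).re) (uIcc s t) := Complex.continuous_re.comp_continuousOn hac
  have ci : ContinuousOn (fun r => (a r).im) (uIcc s t) := Complex.continuous_im.comp_continuousOn hac
  have hn : ∀ z : ℂ, ‖z‖ ^ 2 = z.re * z.re + z.im * z.im := fun z => by
    rw [← Complex.normSq_eq_norm_sq, Complex.normSq_apply]
  have : ‖a t‖ ^ 2 - ‖a s‖ ^ 2 = (∫ r in s..t, (-(g r).re * (a r).re + (a r).re * -(g r).re)) +
      ∫ r in s..t, (-(g r).im * (a r).im + (a r).im * -(g r).im) := by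
    rw [hn, hn]
    simp only [Pi.neg_apply] at e1 e2
    rw [e1, e2]; ring
  rw [this, ← intervalIntegral.integral_add]
  · congr 1; ext r
    simp only [Complex.mul_re, Complex.conj_re, Complex.conj_im]; ring
  · exact (ir.mul_continuousOn cr).add (ir.continuousOn_mul cr)
  · exact (ii.mul_continuousOn ci).add (ii.continuousOn_mul ci)

lemma aestronglyMeasurable_tsum {ι α E : Type*} [Countable ι] [MeasurableSpace α]
    {μ : Measure α} [NormedAddCommGroup E] {F : ι → α → E}
    (hF : ∀ i, AEStronglyMeasurable (F i) μ) (hs : ∀ᵐ x ∂μ, Summable fun i => F i x) :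
    AEStronglyMeasurable (fun x => ∑' i, F i x) μ := by
  refine aestronglyMeasurable_of_tendsto_ae Filter.atTop
    (f := fun (S : Finset ι) x => ∑ i ∈ S, F i x) (fun S => ?_) ?_
  · exact Finset.aestronglyMeasurable_fun_sum S fun i _ => hF i
  · filter_upwards [hs] with x hx
    exact hx.hasSum

lemma intervalIntegrable_of_bound {E : Type*} [NormedAddCommGroup E] {f : ℝ → E} {s t C : ℝ}
    (hst : s ≤ t) (hf : AEStronglyMeasurable f (volume.restrict (Ioc s t)))
    (hb : ∀ᵐ r ∂(volume.restrict (Ioc s t)), ‖f r‖ ≤ C) : IntervalIntegrable f volume s t := by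
  rw [intervalIntegrable_iff_integrableOn_Ioc_of_le hst]
  exact (integrable_const C).mono' hf hb

/-- The energy inequality for a system of modes. -/
lemma tsum_norm_sq_le {ι : Type*} [Countable ι] {a g : ι → ℝ → ℂ} {s t M : ℝ} {q : ℝ → ℝ}
    (hst : s ≤ t) (hg : ∀ k, IntervalIntegrable (g k) volume s t)
    (ha : ∀ k, ∀ r ∈ Icc s t, a k r = a k s - ∫ x in s..r, g k x)
    (hs : Summable fun k => ‖a k s‖ ^ 2) (ht : Summable fun k => ‖a k t‖ ^ 2)
    (hM : ∀ᵐ r ∂(volume.restrict (Ioc s t)), (Summable fun k => ‖a k r‖ * ‖g k r‖) ∧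
      ∑' k, ‖a k r‖ * ‖g k r‖ ≤ M)
    (hq : IntervalIntegrable q volume s t)
    (hle : ∀ᵐ r ∂(volume.restrict (Ioc s t)), -2 * ∑' k, (conj (a k r) * g k r).re ≤ q r) :
    ∑' k, ‖a k t‖ ^ 2 ≤ ∑' k, ‖a k s‖ ^ 2 + ∫ r in s..t, q r := by
  have hgm : ∀ k, AEStronglyMeasurable (g k) (volume.restrict (Ioc s t)) := fun k => (hg k).1.1
  have hac : ∀ k, AEStronglyMeasurable (a k) (volume.restrict (Ioc s t)) := by
    intro k
    have hc : ContinuousOn (a k) (Icc s t) := by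
      have := intervalIntegral.continuousOn_primitive_interval' (hg k) (left_mem_uIcc)
      rw [uIcc_of_le hst] at this
      exact ((continuousOn_const (c := a k s)).sub this).congr fun r hr => ha k r hr
    exact (hc.mono Ioc_subset_Icc_self).aestronglyMeasurable measurableSet_Ioc
  have hb : ∀ k r, ‖-2 * (conj (a k r) * g k r).re‖ ≤ 2 * (‖a k r‖ * ‖g k r‖) := by
    intro k r
    rw [norm_mul]
    have := Complex.abs_re_le_norm (conj (a k r) * g k r)
    rw [norm_mul, RCLike.norm_conj] at this
    simpa using this
  -- The energy identities of the single modes are summed under the time integral; the a.e. bound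
  -- `M` supplies the dominating function.
  have hsum := intervalIntegral.hasSum_integral_of_dominated_convergence (a := s) (b := t)
    (μ := volume) (F := fun k r => -2 * (conj (a k r) * g k r).re)
    (f := fun r => ∑' k, -2 * (conj (a k r) * g k r).re)
    (fun k r => 2 * (‖a k r‖ * ‖g k r‖)) ?_ ?_ ?_ ?_ ?_
  · have e : ∀ k, ∫ r in s..t, -2 * (conj (a k r) * g k r).re = ‖a k t‖ ^ 2 - ‖a k s‖ ^ 2 :=
      fun k => (norm_sq_sub_norm_sq hst (hg k) (ha k)).symm
    simp only [e] at hsum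
    have e2 := hsum.unique (ht.hasSum.sub hs.hasSum)
    have h3 : ∫ r in s..t, ∑' k, -2 * (conj (a k r) * g k r).re ≤ ∫ r in s..t, q r := by
      refine intervalIntegral.integral_mono_ae_restrict hst ?_ hq ?_
      · refine intervalIntegrable_of_bound (C := 2 * M) hst ?_ ?_
        · refine aestronglyMeasurable_tsum (fun k => ?_) ?_
          · have := ((Complex.continuous_conj.comp_aestronglyMeasurable (hac k)).mul (hgm k))
            exact (Complex.continuous_re.comp_aestronglyMeasurable this).const_mul _
          · filter_upwards [hM] with r hr
            exact Summable.of_norm_bounded (hr.1.mul_left 2) fun k => hb k r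
        · filter_upwards [hM] with r hr
          refine (tsum_of_norm_bounded (hr.1.mul_left 2).hasSum fun k => hb k r).trans ?_
          rw [tsum_mul_left]
          linarith [hr.2]
      · rw [restrict_Ioc_eq_restrict_Icc] at hle
        filter_upwards [hle] with r hr
        rw [tsum_mul_left]; exact hr
    linarith
  · intro k
    rw [uIoc_of_le hst]
    have := ((Complex.continuous_conj.comp_aestronglyMeasurable (hac k)).mul (hgm k))
    exact (Complex.continuous_re.comp_aestronglyMeasurable this).const_mul _
  · exact fun k => Filter.Eventually.of_forall fun r _ => hb k r
  · rw [uIoc_of_le hst, ← ae_restrict_iff' measurableSet_Ioc]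
    filter_upwards [hM] with r hr
    exact hr.1.mul_left 2
  · refine intervalIntegrable_of_bound (C := 2 * M) hst ?_ ?_
    · refine aestronglyMeasurable_tsum (fun k => ?_) ?_
      · exact ((hac k).norm.mul (hgm k).norm).const_mul _
      · filter_upwards [hM] with r hr
        exact hr.1.mul_left 2
    · filter_upwards [hM] with r hr
      rw [tsum_mul_left, Real.norm_of_nonneg]
      · linarith [hr.2]
      · exact mul_nonneg zero_le_two (tsum_nonneg fun k => by positivity)
  · rw [uIoc_of_le hst, ← ae_restrict_iff' measurableSet_Ioc]
    filter_upwards [hM] with r hr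
    exact (Summable.of_norm_bounded (hr.1.mul_left 2) fun k => hb k r).hasSum

/-! ### Duhamel's formula for one mode -/

/-- A function given by Duhamel's formula satisfies the differential equation. -/
lemma eq_sub_integral_of_duhamel {a G : ℝ → ℂ} {σ s T : ℝ} {c : ℂ}
    (hG : IntervalIntegrable G volume s T)
    (ha : ∀ t ∈ Icc s T, a t = (Real.exp (-(t - s) * σ) : ℝ) * c -
      ∫ r in s..t, (Real.exp (-(t - r) * σ) : ℝ) * G r)
    {t₀ t : ℝ} (ht₀ : t₀ ∈ Icc s T) (ht : t ∈ Icc t₀ T) :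
    a t = a t₀ - ∫ r in t₀..t, (σ * a r + G r) := by
  have hsT : s ≤ T := ht₀.1.trans ht₀.2
  -- Integrating factor: `a` is exp (-(r - s) σ) times `Q`, and both factors are primitives, so the
  -- product rule applies to real and imaginary parts.
  set Q : ℝ → ℂ := fun r => c - ∫ x in s..r, (Real.exp ((x - s) * σ) : ℝ) * G x with hQ
  have hGe : IntervalIntegrable (fun x => ((Real.exp ((x - s) * σ) : ℝ) : ℂ) * G x) volume s T :=
    hG.continuousOn_mul (by fun_prop)
  have haQ : ∀ r ∈ Icc s T, a r = (Real.exp (-(r - s) * σ) : ℝ) * Q r := by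
    intro r hr
    rw [ha r hr, hQ, mul_sub, ← intervalIntegral.integral_const_mul]
    congr 2; ext x
    rw [← mul_assoc, ← Complex.ofReal_mul, ← Real.exp_add]
    congr 3; ring_nf
  have hQc : ContinuousOn Q (Icc s T) := by
    have := intervalIntegral.continuousOn_primitive_interval' hGe (left_mem_uIcc)
    rw [uIcc_of_le hsT] at this
    exact continuousOn_const.sub this
  have hac : ContinuousOn a (Icc s T) := by
    refine ContinuousOn.congr ?_ haQ
    exact ContinuousOn.mul (by fun_prop) hQc
  have key : ∀ r ∈ Icc s T, a r = a s - ∫ x in s..r, (σ * a x + G x) := by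
    intro t ht
    have hst := ht.1
    have hGt := intervalIntegrable_of_Icc_subset hGe (left_mem_Icc.2 hsT) ht
    have hGt' := intervalIntegrable_of_Icc_subset hG (left_mem_Icc.2 hsT) ht
    have hact : IntervalIntegrable a volume s t := by
      refine ContinuousOn.intervalIntegrable ?_
      rw [uIcc_of_le hst]
      exact hac.mono (Icc_subset_Icc_right ht.2)
    have hE : ∀ r, Real.exp (-(r - s) * σ) =
        1 + ∫ x in s..r, -σ * Real.exp (-(x - s) * σ) := by
      intro r
      have hd : ∀ x ∈ uIcc s r, HasDerivAt (fun x => Real.exp (-(x - s) * σ))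
          (-σ * Real.exp (-(x - s) * σ)) x := by
        intro x _
        have h1 : HasDerivAt (fun x : ℝ => -(x - s) * σ) (-1 * σ) x :=
          (((hasDerivAt_id x).sub_const s).neg).mul_const σ
        convert h1.exp using 1; ring
      rw [intervalIntegral.integral_eq_sub_of_hasDerivAt hd
        (Continuous.intervalIntegrable (by fun_prop) _ _)]
      simp
    have hEi : IntervalIntegrable (fun x => -σ * Real.exp (-(x - s) * σ)) volume s t :=
      Continuous.intervalIntegrable (by fun_prop) _ _
    have hsub : ∀ r ∈ Icc s t, IntervalIntegrable
        (fun x => ((Real.exp ((x - s) * σ) : ℝ) : ℂ) * G x) volume s r := fun r hr =>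
      intervalIntegrable_of_Icc_subset hGt (left_mem_Icc.2 hst) hr
    have hre : ∀ r ∈ Icc s t, (Q r).re = c.re +
        ∫ x in s..r, -(((Real.exp ((x - s) * σ) : ℝ) : ℂ) * G x).re := by
      intro r hr
      rw [hQ, Complex.sub_re, re_intervalIntegral (hsub r hr), intervalIntegral.integral_neg]
      ring
    have him : ∀ r ∈ Icc s t, (Q r).im = c.im +
        ∫ x in s..r, -(((Real.exp ((x - s) * σ) : ℝ) : ℂ) * G x).im := by
      intro r hr
      rw [hQ, Complex.sub_im, im_intervalIntegral (hsub r hr), intervalIntegral.integral_neg]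
      ring
    have e1 := integral_mul_primitive hst hEi (intervalIntegrable_re hGt).neg
      (fun r _ => hE r) hre
    have e2 := integral_mul_primitive hst hEi (intervalIntegrable_im hGt).neg
      (fun r _ => hE r) him
    have hss : s ∈ Icc s T := left_mem_Icc.2 hsT
    have hI : IntervalIntegrable (fun x => σ * a x + G x) volume s t :=
      (hact.const_mul _).add hGt'
    have hmul : ∀ (e : ℝ) (z : ℂ), ((e : ℂ) * z).re = e * z.re ∧ ((e : ℂ) * z).im = e * z.im :=
      fun e z => by simp
    have hexp : ∀ x, Real.exp (-(x - s) * σ) * Real.exp ((x - s) * σ) = 1 := fun x => by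
      rw [← Real.exp_add, ← add_mul, neg_add_cancel, zero_mul, Real.exp_zero]
    apply Complex.ext
    · rw [Complex.sub_re, re_intervalIntegral hI, haQ t ht, haQ s hss, (hmul _ _).1, (hmul _ _).1]
      have : ∫ x in s..t, (σ * a x + G x).re = -∫ r in s..t,
          (-σ * Real.exp (-(r - s) * σ) * (Q r).re + Real.exp (-(r - s) * σ) *
            (-fun x => (((Real.exp ((x - s) * σ) : ℝ) : ℂ) * G x).re) r) := by
        rw [← intervalIntegral.integral_neg]
        refine intervalIntegral.integral_congr fun x hx => ?_
        rw [uIcc_of_le hst] at hx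
        simp only [Pi.neg_apply]
        rw [Complex.add_re, (hmul _ _).1, (hmul _ _).1, haQ x ⟨hx.1, hx.2.trans ht.2⟩, (hmul _ _).1]
        linear_combination (-(G x).re) * hexp x
      rw [this, e1]; ring
    · rw [Complex.sub_im, im_intervalIntegral hI, haQ t ht, haQ s hss, (hmul _ _).2, (hmul _ _).2]
      have : ∫ x in s..t, (σ * a x + G x).im = -∫ r in s..t,
          (-σ * Real.exp (-(r - s) * σ) * (Q r).im + Real.exp (-(r - s) * σ) *
            (-fun x => (((Real.exp ((x - s) * σ) : ℝ) : ℂ) * G x).im) r) := by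
        rw [← intervalIntegral.integral_neg]
        refine intervalIntegral.integral_congr fun x hx => ?_
        rw [uIcc_of_le hst] at hx
        simp only [Pi.neg_apply]
        rw [Complex.add_im, (hmul _ _).2, (hmul _ _).2, haQ x ⟨hx.1, hx.2.trans ht.2⟩, (hmul _ _).2]
        linear_combination (-(G x).im) * hexp x
      rw [this, e2]; ring
  have htI : t ∈ Icc s T := ⟨ht₀.1.trans ht.1, ht.2⟩
  have hint : IntervalIntegrable (fun x => σ * a x + G x) volume s T := by
    refine IntervalIntegrable.add (IntervalIntegrable.const_mul ?_ _) hG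
    refine ContinuousOn.intervalIntegrable ?_
    rwa [uIcc_of_le hsT]
  rw [key t htI, key t₀ ht₀, sub_sub, intervalIntegral.integral_add_adjacent_intervals
    (intervalIntegrable_of_Icc_subset hint (left_mem_Icc.2 hsT) ht₀)
    (intervalIntegrable_of_Icc_subset hint ht₀ htI)]

/-- Duhamel's formula can be restarted. -/
lemma duhamel_restart {a G : ℝ → ℂ} {σ s T : ℝ} {c : ℂ}
    (hG : IntervalIntegrable G volume s T)
    (ha : ∀ t ∈ Icc s T, a t = (Real.exp (-(t - s) * σ) : ℝ) * c -
      ∫ r in s..t, (Real.exp (-(t - r) * σ) : ℝ) * G r)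
    {t₀ t : ℝ} (ht₀ : t₀ ∈ Icc s T) (ht : t ∈ Icc t₀ T) :
    a t = (Real.exp (-(t - t₀) * σ) : ℝ) * a t₀ -
      ∫ r in t₀..t, (Real.exp (-(t - r) * σ) : ℝ) * G r := by
  have hsT : s ≤ T := ht₀.1.trans ht₀.2
  have htI : t ∈ Icc s T := ⟨ht₀.1.trans ht.1, ht.2⟩
  have hGe : IntervalIntegrable (fun r => ((Real.exp (-(t - r) * σ) : ℝ) : ℂ) * G r) volume s T :=
    hG.continuousOn_mul (by fun_prop)
  rw [ha t htI, ha t₀ ht₀, mul_sub, ← intervalIntegral.integral_const_mul,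
    ← intervalIntegral.integral_add_adjacent_intervals
    (intervalIntegrable_of_Icc_subset hGe (left_mem_Icc.2 hsT) ht₀)
    (intervalIntegrable_of_Icc_subset hGe ht₀ htI), ← sub_sub]
  congr 2
  · rw [← mul_assoc, ← Complex.ofReal_mul, ← Real.exp_add]
    congr 3; ring_nf
  · congr 1; ext x
    rw [← mul_assoc, ← Complex.ofReal_mul, ← Real.exp_add]
    congr 3; ring_nf

/-! ### The semigroup and mild solutions on the Fourier side -/

variable (L₁ L₂) in
/-- Real symbols of fourth order with leading part at least `κ⁴ / 2`. -/
structure IsParabolicSymbol (σ : ℤ × ℤ → ℝ) : Prop where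
  even : ∀ k, σ (-k) = σ k
  lower : ∀ k, kappaSq L₁ L₂ k ^ 2 / 2 - 1 / 2 ≤ σ k

lemma isParabolicSymbol_bilaplacian :
    IsParabolicSymbol L₁ L₂ fun k => kappaSq L₁ L₂ k ^ 2 where
  even k := by rw [kappaSq_neg]
  lower k := by nlinarith [sq_nonneg (kappaSq L₁ L₂ k)]

/-- With x = κ², the lower bound reads (x - 1)² ≥ 0. -/
lemma isParabolicSymbol_kuramotoSivashinsky :
    IsParabolicSymbol L₁ L₂ fun k => kappaSq L₁ L₂ k ^ 2 - kappaSq L₁ L₂ k where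
  even k := by rw [kappaSq_neg]
  lower k := by nlinarith [sq_nonneg (kappaSq L₁ L₂ k - 1)]

/-- Up to the factor e^ρ, the terms are at most exp (-ρ κ⁴) ≤ (1 + 1/ρ) / (1 + κ⁴), and the latter
is summable over the lattice. -/
lemma IsParabolicSymbol.summable_exp {σ : ℤ × ℤ → ℝ} (hσ : IsParabolicSymbol L₁ L₂ σ) {ρ : ℝ}
    (hρ : 0 < ρ) : Summable fun k => Real.exp (-ρ * σ k) ^ 2 := by
  refine Summable.of_nonneg_of_le (fun k => sq_nonneg _) (fun k => ?_)
    ((summable_inv_kappaSq_sq (L₁ := L₁) (L₂ := L₂)).mul_left (Real.exp ρ * (1 + 1 / ρ)))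
  have h1 : Real.exp (-ρ * σ k) ^ 2 ≤ Real.exp ρ * Real.exp (-(ρ * kappaSq L₁ L₂ k ^ 2)) := by
    rw [sq, ← Real.exp_add, ← Real.exp_add]
    refine Real.exp_le_exp.2 ?_
    nlinarith [hσ.lower k]
  have h2 : Real.exp (-(ρ * kappaSq L₁ L₂ k ^ 2)) ≤ (1 + 1 / ρ) * (1 / (1 + kappaSq L₁ L₂ k ^ 2)) := by
    rw [Real.exp_neg, mul_one_div, inv_le_comm₀ (Real.exp_pos _) (by positivity), inv_div]
    refine le_trans ?_ (Real.add_one_le_exp _)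
    rw [div_le_iff₀ (by positivity)]
    have : ρ * (1 / ρ) = 1 := mul_one_div_cancel hρ.ne'
    have h3 : 0 ≤ kappaSq L₁ L₂ k ^ 2 := sq_nonneg _
    have h4 : 0 < 1 / ρ := by positivity
    nlinarith [mul_nonneg hρ.le h3, this, mul_nonneg h3 h4.le]
  calc _ ≤ Real.exp ρ * Real.exp (-(ρ * kappaSq L₁ L₂ k ^ 2)) := h1
    _ ≤ Real.exp ρ * ((1 + 1 / ρ) * (1 / (1 + kappaSq L₁ L₂ k ^ 2))) := by gcongr
    _ = _ := by ring

/-- For positive time the exponential factors are square summable, so bounded coefficients are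
enough for the multiplier to have an image in `L²`. -/
lemma IsParabolicSymbol.coeff_semigroup {σ : ℤ × ℤ → ℝ} (hσ : IsParabolicSymbol L₁ L₂ σ) {ρ : ℝ}
    (hρ : 0 < ρ) (f : Torus L₁ L₂ → ℝ) (k : ℤ × ℤ) :
    coeff (semigroup σ ρ f) k = (Real.exp (-ρ * σ k) : ℝ) * coeff f k := by
  refine coeff_multiplier (m := fun k => ((Real.exp (-ρ * σ k) : ℝ) : ℂ)) ?_ k
  refine exists_isMultiplierImage (fun k => by rw [hσ.even, Complex.conj_ofReal]) ?_
  set C := (area L₁ L₂)⁻¹ * ∫ x, |f x| with hC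
  refine Summable.of_nonneg_of_le (fun k => sq_nonneg _) (fun k => ?_)
    ((hσ.summable_exp hρ).mul_right (C ^ 2))
  rw [norm_mul, mul_pow, Complex.norm_real, Real.norm_eq_abs, sq_abs]
  have := norm_coeff_le f k
  gcongr

lemma IsParabolicSymbol.coeff_semigroup_L2 {σ : ℤ × ℤ → ℝ} (hσ : IsParabolicSymbol L₁ L₂ σ)
    {ρ : ℝ} (hρ : 0 ≤ ρ) (f : L2 L₁ L₂) (k : ℤ × ℤ) :
    coeff (semigroup σ ρ f) k = (Real.exp (-ρ * σ k) : ℝ) * coeff f k := by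
  rcases hρ.eq_or_lt with h | h
  · subst h
    exact coeff_multiplier (m := fun k => ((Real.exp (-0 * σ k) : ℝ) : ℂ)) ⟨f, fun k => by simp⟩ k
  · exact hσ.coeff_semigroup h f k

section Mild

variable {σ : ℤ × ℤ → ℝ} {F : ℝ → L2 L₁ L₂ → Torus L₁ L₂ → ℝ} {s T : ℝ}
  {u₀ : L2 L₁ L₂} {u : ℝ → L2 L₁ L₂}

lemma IsMildSolution.initial (h : IsMildSolution σ F s T u₀ u)
    (hσ : IsParabolicSymbol L₁ L₂ σ) (hsT : s ≤ T) : u s = u₀ := by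
  have := h.duhamel s (left_mem_Icc.2 hsT)
  rw [intervalIntegral.integral_same, sub_zero, sub_self] at this
  rw [this]
  exact L2_ext fun k => by rw [hσ.coeff_semigroup_L2 le_rfl]; simp

/-- Integrability is known only for the smoothed forcing. In a single mode the smoothing is a
nonvanishing continuous factor, which can be divided out. -/
lemma IsMildSolution.intervalIntegrable_coeff (h : IsMildSolution σ F s T u₀ u)
    (hσ : IsParabolicSymbol L₁ L₂ σ) (hsT : s ≤ T) (k : ℤ × ℤ) :
    IntervalIntegrable (fun r => coeff (F r (u r)) k) volume s T := by
  have h1 := h.integrable T (right_mem_Icc.2 hsT)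
  have h2 : IntervalIntegrable (fun r => coeffCLM k (semigroup σ (T - r) (F r (u r)))) volume s T :=
    ⟨(coeffCLM k).integrable_comp h1.1, (coeffCLM k).integrable_comp h1.2⟩
  have h3 : IntervalIntegrable (fun r => ((Real.exp ((T - r) * σ k) : ℝ) : ℂ) *
      coeffCLM k (semigroup σ (T - r) (F r (u r)))) volume s T :=
    h2.continuousOn_mul (by fun_prop)
  refine h3.congr_ae ?_
  rw [uIoc_of_le hsT, Filter.EventuallyEq, ae_restrict_iff' measurableSet_Ioc]
  -- At r = T the semigroup has time zero, where the coefficient formula is not available for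
  -- general forcing; one point is negligible.
  filter_upwards [Measure.ae_ne volume T] with r hr hrI
  rw [coeffCLM_apply, hσ.coeff_semigroup (sub_pos.2 (lt_of_le_of_ne hrI.2 hr)), ← mul_assoc,
    ← Complex.ofReal_mul, ← Real.exp_add, neg_mul, add_neg_cancel, Real.exp_zero,
    Complex.ofReal_one, one_mul]

lemma IsMildSolution.coeff_eq (h : IsMildSolution σ F s T u₀ u)
    (hσ : IsParabolicSymbol L₁ L₂ σ) (k : ℤ × ℤ) :
    ∀ t ∈ Icc s T, coeff (u t) k = (Real.exp (-(t - s) * σ k) : ℝ) * coeff u₀ k -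
      ∫ r in s..t, (Real.exp (-(t - r) * σ k) : ℝ) * coeff (F r (u r)) k := by
  intro t ht
  have h1 := congrArg (coeffCLM k) (h.duhamel t ht)
  rw [map_sub, ← ContinuousLinearMap.intervalIntegral_comp_comm _ (h.integrable t ht)] at h1
  simp only [coeffCLM_apply] at h1
  rw [h1, hσ.coeff_semigroup_L2 (sub_nonneg.2 ht.1)]
  congr 1
  refine intervalIntegral.integral_congr_ae ?_
  filter_upwards [Measure.ae_ne volume t] with r hr hrI
  rw [uIoc_of_le ht.1] at hrI
  exact hσ.coeff_semigroup (sub_pos.2 (lt_of_le_of_ne hrI.2 hr)) _ k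

/-- The differential equation, in integral form, for one mode of a mild solution. -/
lemma IsMildSolution.coeff_sub (h : IsMildSolution σ F s T u₀ u)
    (hσ : IsParabolicSymbol L₁ L₂ σ) (k : ℤ × ℤ) {t₀ t : ℝ} (ht₀ : t₀ ∈ Icc s T)
    (ht : t ∈ Icc t₀ T) :
    coeff (u t) k = coeff (u t₀) k - ∫ r in t₀..t, (σ k * coeff (u r) k + coeff (F r (u r)) k) :=
  eq_sub_integral_of_duhamel (a := fun r => coeff (u r) k)
    (h.intervalIntegrable_coeff hσ (ht₀.1.trans ht₀.2) k) (h.coeff_eq hσ k) ht₀ ht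

lemma continuousOn_coeff {I : Set ℝ} (h : ContinuousOn u I) (k : ℤ × ℤ) :
    ContinuousOn (fun r => coeff (u r) k) I :=
  (coeffCLM k).continuous.comp_continuousOn h

end Mild

/-! ### Admissible velocities -/

lemma IsAdmissibleVelocity.exists_bound {v : ℝ → Torus L₁ L₂ → ℝ × ℝ}
    (hv : IsAdmissibleVelocity v) :
    ∃ K : ℝ, 0 ≤ K ∧ ∀ᵐ t ∂(volume.restrict (Ici (0 : ℝ))), IsBoundedDivFree K (v t) := by
  obtain ⟨K, hK⟩ := hv.lipschitz
  refine ⟨K, K.2, ?_⟩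
  filter_upwards [hK, hv.divFree] with t h1 h2
  exact ⟨hv.measurable.of_uncurry_left, h1.2, h2⟩

/-! ### The energy balance at a fixed time -/

lemma summable_norm_mul {a b : ℤ × ℤ → ℂ} (ha : Summable fun k => ‖a k‖ ^ 2)
    (hb : Summable fun k => ‖b k‖ ^ 2) : (Summable fun k => ‖a k‖ * ‖b k‖) ∧
      ∑' k, ‖a k‖ * ‖b k‖ ≤ √(∑' k, ‖a k‖ ^ 2) * √(∑' k, ‖b k‖ ^ 2) := by
  have h := cauchySchwarz_tsum (fun k => norm_nonneg (a k)) (fun k => norm_nonneg (b k)) ha hb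
  refine ⟨h.1, ?_⟩
  rw [← Real.sqrt_mul (tsum_nonneg fun k => sq_nonneg _)]
  exact Real.le_sqrt_of_sq_le h.2

/-- The rate of change of the energy for the modes `a' = - (κ⁴ a + b + N)`, where `b` is square
summable and `N` is bounded. -/
lemma energy_balance {a b N : ℤ × ℤ → ℂ} {n M : ℝ} (ha : InH2 L₁ L₂ a) (h0 : a 0 = 0)
    (hb : Summable fun k => ‖b k‖ ^ 2) (hbM : ∑' k, ‖b k‖ ^ 2 ≤ M) (hN : ∀ k, ‖N k‖ ≤ n) :
    ((Summable fun k => ‖a k‖ * ‖(kappaSq L₁ L₂ k ^ 2 : ℝ) * a k + b k + N k‖) ∧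
      ∑' k, ‖a k‖ * ‖(kappaSq L₁ L₂ k ^ 2 : ℝ) * a k + b k + N k‖ ≤
        wsum L₁ L₂ 2 a + wsum L₁ L₂ 0 a + M + n * ∑' k, ‖a k‖) ∧
    -2 * ∑' k, (conj (a k) * ((kappaSq L₁ L₂ k ^ 2 : ℝ) * a k + b k + N k)).re ≤
      -2 * wsum L₁ L₂ 2 a - 2 * ∑' k, (conj (a k) * b k).re + 2 * n * ∑' k, ‖a k‖ := by
  have hA := (ha.agmon h0).1
  have hab := summable_norm_mul ha.1 hb
  have hn : 0 ≤ n := (norm_nonneg _).trans (hN 0)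
  -- The bounded part N is paired with the absolutely summable sequence a; the square summable part
  -- b is treated with 2 ‖a‖ ‖b‖ ≤ ‖a‖² + ‖b‖².
  have hbd : ∀ k, ‖a k‖ * ‖(kappaSq L₁ L₂ k ^ 2 : ℝ) * a k + b k + N k‖ ≤
      kappaSq L₁ L₂ k ^ 2 * ‖a k‖ ^ 2 + ‖a k‖ ^ 2 + ‖b k‖ ^ 2 + n * ‖a k‖ := by
    intro k
    have h1 : ‖(kappaSq L₁ L₂ k ^ 2 : ℝ) * a k + b k + N k‖ ≤
        kappaSq L₁ L₂ k ^ 2 * ‖a k‖ + ‖b k‖ + n := by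
      refine (norm_add₃_le).trans ?_
      rw [norm_mul, Complex.norm_real, Real.norm_of_nonneg (sq_nonneg _)]
      linarith [hN k]
    have h2 := mul_le_mul_of_nonneg_left h1 (norm_nonneg (a k))
    nlinarith [sq_nonneg (‖a k‖ - ‖b k‖), sq_nonneg (‖a k‖), sq_nonneg (‖b k‖)]
  have hs := ((ha.2.add ha.1).add hb).add (hA.mul_left n)
  have hsum := hs.of_nonneg_of_le (fun k => by positivity) hbd
  refine ⟨⟨hsum, ?_⟩, ?_⟩
  · refine (hsum.tsum_le_tsum hbd hs).trans ?_
    rw [((ha.2.add ha.1).add hb).tsum_add (hA.mul_left n), (ha.2.add ha.1).tsum_add hb,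
      ha.2.tsum_add ha.1, tsum_mul_left, wsum_zero, wsum]
    linarith
  · have sab : Summable fun k => (conj (a k) * b k).re :=
      Summable.of_norm_bounded hab.1 fun k => by
        refine (Complex.abs_re_le_norm _).trans ?_
        rw [norm_mul, RCLike.norm_conj]
    have hNb : ∀ k, ‖(conj (a k) * N k).re‖ ≤ n * ‖a k‖ := fun k => by
      refine (Complex.abs_re_le_norm _).trans ?_
      rw [norm_mul, RCLike.norm_conj, mul_comm]
      exact mul_le_mul_of_nonneg_right (hN k) (norm_nonneg _)
    have saN : Summable fun k => (conj (a k) * N k).re :=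
      Summable.of_norm_bounded (hA.mul_left n) hNb
    have e : ∀ k, (conj (a k) * ((kappaSq L₁ L₂ k ^ 2 : ℝ) * a k + b k + N k)).re =
        kappaSq L₁ L₂ k ^ 2 * ‖a k‖ ^ 2 + (conj (a k) * b k).re + (conj (a k) * N k).re := by
      intro k
      have : conj (a k) * ((kappaSq L₁ L₂ k ^ 2 : ℝ) * a k + b k + N k) =
          (kappaSq L₁ L₂ k ^ 2 : ℝ) * (a k * conj (a k)) + conj (a k) * b k + conj (a k) * N k := by
        ring
      rw [this, Complex.mul_conj, ← Complex.ofReal_mul, Complex.add_re, Complex.add_re,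
        Complex.ofReal_re, Complex.normSq_eq_norm_sq]
    simp only [e]
    rw [(ha.2.add sab).tsum_add saN, ha.2.tsum_add sab]
    have h3 : ‖∑' k, (conj (a k) * N k).re‖ ≤ n * ∑' k, ‖a k‖ := by
      rw [← tsum_mul_left]
      exact tsum_of_norm_bounded (hA.mul_left n).hasSum hNb
    have h4 := (abs_le.1 h3).1
    rw [wsum]
    linarith

/-! ### Paths in `H²` -/

/-- `u` is continuous in `L²` and bounded in `H²` on `[s, t]`. -/
structure IsH2Path (u : ℝ → L2 L₁ L₂) (s t M : ℝ) : Prop where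
  continuousOn : ContinuousOn u (Icc s t)
  inH2 : ∀ r ∈ Icc s t, InH2 L₁ L₂ (coeff (u r))
  wsum_zero_le : ∀ r ∈ Icc s t, wsum L₁ L₂ 0 (coeff (u r)) ≤ M
  wsum_two_le : ∀ r ∈ Icc s t, wsum L₁ L₂ 2 (coeff (u r)) ≤ M

lemma wsum_zero_coeff (f : L2 L₁ L₂) : wsum L₁ L₂ 0 (coeff f) = (area L₁ L₂)⁻¹ * ‖f‖ ^ 2 := by
  rw [wsum_zero, (hasSum_norm_coeff_sq f).tsum_eq]

lemma norm_sq_eq_wsum (f : L2 L₁ L₂) : ‖f‖ ^ 2 = area L₁ L₂ * wsum L₁ L₂ 0 (coeff f) := by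
  rw [wsum_zero_coeff, mul_inv_cancel_left₀ area_pos.ne']

section Path

variable {u : ℝ → L2 L₁ L₂} {s t M : ℝ}

lemma IsH2Path.mono (h : IsH2Path u s t M) {s' t' : ℝ} (hs : s ≤ s') (ht : t' ≤ t) :
    IsH2Path u s' t' M :=
  have hsub : Icc s' t' ⊆ Icc s t := Icc_subset_Icc hs ht
  ⟨h.continuousOn.mono hsub, fun r hr => h.inH2 r (hsub hr), fun r hr => h.wsum_zero_le r (hsub hr),
    fun r hr => h.wsum_two_le r (hsub hr)⟩

lemma IsH2Path.continuousOn_wsum_zero (h : IsH2Path u s t M) :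
    ContinuousOn (fun r => wsum L₁ L₂ 0 (coeff (u r))) (Icc s t) := by
  simp only [wsum_zero_coeff]
  exact continuousOn_const.mul (h.continuousOn.norm.pow 2)

lemma IsH2Path.intervalIntegrable_wsum_two (h : IsH2Path u s t M) (hst : s ≤ t) :
    IntervalIntegrable (fun r => wsum L₁ L₂ 2 (coeff (u r))) volume s t := by
  refine intervalIntegrable_of_bound (C := M) hst ?_ ?_
  · refine aestronglyMeasurable_tsum (fun k => ?_) ?_
    · exact ((((continuousOn_coeff h.continuousOn k).norm.pow 2).const_mul _).mono
        Ioc_subset_Icc_self).aestronglyMeasurable measurableSet_Ioc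
    · filter_upwards [ae_restrict_mem measurableSet_Ioc] with r hr
      exact (h.inH2 r (Ioc_subset_Icc_self hr)).2
  · filter_upwards [ae_restrict_mem measurableSet_Ioc] with r hr
    rw [Real.norm_of_nonneg (wsum_nonneg _ _)]
    exact h.wsum_two_le r (Ioc_subset_Icc_self hr)

/-- Agmon's inequality bounds the square of the sum, and S ≤ 1 + S² turns this into a crude bound.
It serves only to justify exchanging sum and integral. -/
lemma IsH2Path.tsum_norm_le (h : IsH2Path u s t M) {r : ℝ} (hr : r ∈ Icc s t)
    (h0 : coeff (u r) 0 = 0) : ∑' k, ‖coeff (u r) k‖ ≤ 1 + 2 * latticeConst L₁ L₂ * M := by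
  have hK := latticeConst_pos (L₁ := L₁) (L₂ := L₂)
  have hM : 0 ≤ M := (wsum_nonneg _ _).trans (h.wsum_zero_le r hr)
  have h1 := ((h.inH2 r hr).agmon h0).2
  have h2 : √(wsum L₁ L₂ 0 (coeff (u r))) * √(wsum L₁ L₂ 2 (coeff (u r))) ≤ M := by
    calc _ ≤ √M * √M := by
          gcongr
          · exact h.wsum_zero_le r hr
          · exact h.wsum_two_le r hr
      _ = M := Real.mul_self_sqrt hM
  have h3 : 2 * latticeConst L₁ L₂ * (√(wsum L₁ L₂ 0 (coeff (u r))) *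
      √(wsum L₁ L₂ 2 (coeff (u r)))) ≤ 2 * latticeConst L₁ L₂ * M := by gcongr
  nlinarith [sq_nonneg (∑' k, ‖coeff (u r) k‖ - 1)]

/-- The energy inequality for a path in `H²` that solves `u' = - (Δ² u + b + N)`, where `b` is in
`L²` and `N` has bounded Fourier coefficients. -/
lemma IsH2Path.energy_le (h : IsH2Path u s t M) (hst : s ≤ t)
    (h0 : ∀ r ∈ Icc s t, coeff (u r) 0 = 0) {g : ℤ × ℤ → ℝ → ℂ}
    (hg : ∀ k, IntervalIntegrable (g k) volume s t)
    (hu : ∀ k, ∀ r ∈ Icc s t, coeff (u r) k = coeff (u s) k - ∫ x in s..r, g k x)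
    {b N : ℝ → ℤ × ℤ → ℂ} {n q : ℝ → ℝ} {M' : ℝ} (hq : IntervalIntegrable q volume s t)
    (hall : ∀ᵐ r ∂(volume.restrict (Ioc s t)),
      (∀ k, g k r = (kappaSq L₁ L₂ k ^ 2 : ℝ) * coeff (u r) k + b r k + N r k) ∧
      (Summable fun k => ‖b r k‖ ^ 2) ∧ ∑' k, ‖b r k‖ ^ 2 ≤ M' ∧ (∀ k, ‖N r k‖ ≤ n r) ∧ n r ≤ M' ∧
      -2 * wsum L₁ L₂ 2 (coeff (u r)) - 2 * ∑' k, (conj (coeff (u r) k) * b r k).re +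
        2 * n r * ∑' k, ‖coeff (u r) k‖ ≤ q r) :
    wsum L₁ L₂ 0 (coeff (u t)) ≤ wsum L₁ L₂ 0 (coeff (u s)) + ∫ r in s..t, q r := by
  rw [wsum_zero, wsum_zero]
  refine tsum_norm_sq_le (M := M + M + M' + M' * (1 + 2 * latticeConst L₁ L₂ * M)) hst hg hu
    (h.inH2 s (left_mem_Icc.2 hst)).1 (h.inH2 t (right_mem_Icc.2 hst)).1 ?_ hq ?_
  · filter_upwards [hall, ae_restrict_mem measurableSet_Ioc] with r hr hrI
    have hrI' := Ioc_subset_Icc_self hrI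
    obtain ⟨e, hb, hbM, hN, hn, -⟩ := hr
    simp only [e]
    obtain ⟨⟨h1, h2⟩, -⟩ := energy_balance (h.inH2 r hrI') (h0 r hrI') hb hbM hN
    refine ⟨h1, h2.trans ?_⟩
    have hn0 : 0 ≤ n r := (norm_nonneg _).trans (hN 0)
    have := h.wsum_two_le r hrI'
    have := h.wsum_zero_le r hrI'
    have h3 : n r * ∑' k, ‖coeff (u r) k‖ ≤ M' * (1 + 2 * latticeConst L₁ L₂ * M) :=
      mul_le_mul hn (h.tsum_norm_le hrI' (h0 r hrI')) (tsum_nonneg fun k => norm_nonneg _)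
        (hn0.trans hn)
    linarith
  · filter_upwards [hall, ae_restrict_mem measurableSet_Ioc] with r hr hrI
    have hrI' := Ioc_subset_Icc_self hrI
    obtain ⟨e, hb, hbM, hN, hn, hqr⟩ := hr
    simp only [e]
    exact (energy_balance (h.inH2 r hrI') (h0 r hrI') hb hbM hN).2.trans hqr

end Path

/-! ### Operations on paths: mean-free parts and differences. -/

lemma meanFreePart_sub (f g : L2 L₁ L₂) :
    meanFreePart (f - g) = meanFreePart f - meanFreePart g := L2_ext fun k => by
  simp only [coeff_meanFreePart, coeff_sub_L2]; split_ifs <;> simp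

lemma norm_meanFreePart_le (f : L2 L₁ L₂) : ‖meanFreePart f‖ ≤ ‖f‖ := by
  refine abs_le_of_sq_le_sq' ?_ (norm_nonneg _) |>.2
  rw [norm_sq_eq_mean f]
  have := area_pos (L₁ := L₁) (L₂ := L₂)
  nlinarith [mul_nonneg this.le (sq_nonneg (mean f))]

lemma continuous_meanFreePart : Continuous (meanFreePart : L2 L₁ L₂ → L2 L₁ L₂) := by
  refine (LipschitzWith.of_dist_le_mul (K := 1) fun f g => ?_).continuous
  rw [dist_eq_norm, dist_eq_norm, ← meanFreePart_sub, NNReal.coe_one, one_mul]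
  exact norm_meanFreePart_le _

lemma norm_coeff_meanFreePart_le (f : L2 L₁ L₂) (k : ℤ × ℤ) :
    ‖coeff (meanFreePart f) k‖ ≤ ‖coeff f k‖ := by
  rw [coeff_meanFreePart]; split_ifs <;> simp

lemma wsum_le_wsum {n : ℕ} {a b : ℤ × ℤ → ℂ} (h : ∀ k, ‖a k‖ ≤ ‖b k‖)
    (hb : Summable fun k => kappaSq L₁ L₂ k ^ n * ‖b k‖ ^ 2) :
    (Summable fun k => kappaSq L₁ L₂ k ^ n * ‖a k‖ ^ 2) ∧ wsum L₁ L₂ n a ≤ wsum L₁ L₂ n b := by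
  have hle : ∀ k, kappaSq L₁ L₂ k ^ n * ‖a k‖ ^ 2 ≤ kappaSq L₁ L₂ k ^ n * ‖b k‖ ^ 2 := fun k =>
    mul_le_mul_of_nonneg_left (pow_le_pow_left₀ (norm_nonneg _) (h k) 2)
      (pow_nonneg (kappaSq_nonneg k) n)
  have hs := hb.of_nonneg_of_le
    (fun k => mul_nonneg (pow_nonneg (kappaSq_nonneg k) n) (sq_nonneg _)) hle
  exact ⟨hs, hs.tsum_le_tsum hle hb⟩

lemma IsH2Path.meanFreePart {u : ℝ → L2 L₁ L₂} {s t M : ℝ} (h : IsH2Path u s t M) :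
    IsH2Path (fun r => meanFreePart (u r)) s t M where
  continuousOn := continuous_meanFreePart.comp_continuousOn h.continuousOn
  inH2 r hr := ⟨(hasSum_norm_coeff_sq _).summable,
    (wsum_le_wsum (norm_coeff_meanFreePart_le (u r)) (h.inH2 r hr).2).1⟩
  wsum_zero_le r hr := (wsum_le_wsum (norm_coeff_meanFreePart_le (u r))
    (by simpa using (h.inH2 r hr).1)).2.trans (h.wsum_zero_le r hr)
  wsum_two_le r hr := (wsum_le_wsum (norm_coeff_meanFreePart_le (u r))
    (h.inH2 r hr).2).2.trans (h.wsum_two_le r hr)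

lemma IsH2Path.sub {u w : ℝ → L2 L₁ L₂} {s t M M' : ℝ} (hu : IsH2Path u s t M)
    (hw : IsH2Path w s t M') : IsH2Path (fun r => u r - w r) s t (2 * M + 2 * M') := by
  have key : ∀ n : ℕ, ∀ a b : ℤ × ℤ → ℂ, (Summable fun k => kappaSq L₁ L₂ k ^ n * ‖a k‖ ^ 2) →
      (Summable fun k => kappaSq L₁ L₂ k ^ n * ‖b k‖ ^ 2) →
      (Summable fun k => kappaSq L₁ L₂ k ^ n * ‖a k - b k‖ ^ 2) ∧
        wsum L₁ L₂ n (fun k => a k - b k) ≤ 2 * wsum L₁ L₂ n a + 2 * wsum L₁ L₂ n b := by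
    intro n a b ha hb
    have hle : ∀ k, kappaSq L₁ L₂ k ^ n * ‖a k - b k‖ ^ 2 ≤
        2 * (kappaSq L₁ L₂ k ^ n * ‖a k‖ ^ 2) + 2 * (kappaSq L₁ L₂ k ^ n * ‖b k‖ ^ 2) := by
      intro k
      have h1 : ‖a k - b k‖ ^ 2 ≤ 2 * ‖a k‖ ^ 2 + 2 * ‖b k‖ ^ 2 := by
        have := pow_le_pow_left₀ (norm_nonneg _) (norm_sub_le (a k) (b k)) 2
        nlinarith [sq_nonneg (‖a k‖ - ‖b k‖)]
      nlinarith [mul_le_mul_of_nonneg_left h1 (pow_nonneg (kappaSq_nonneg (L₁ := L₁) (L₂ := L₂) k) n)]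
    have hs2 := (ha.mul_left 2).add (hb.mul_left 2)
    have hs := hs2.of_nonneg_of_le
      (fun k => mul_nonneg (pow_nonneg (kappaSq_nonneg k) n) (sq_nonneg _)) hle
    refine ⟨hs, (hs.tsum_le_tsum hle hs2).trans ?_⟩
    rw [(ha.mul_left 2).tsum_add (hb.mul_left 2), tsum_mul_left, tsum_mul_left]
    exact le_rfl
  have e : ∀ r, coeff (u r - w r : L2 L₁ L₂) = fun k => coeff (u r) k - coeff (w r) k :=
    fun r => funext fun k => coeff_sub_L2 _ _ _
  refine ⟨hu.continuousOn.sub hw.continuousOn, fun r hr => ⟨(hasSum_norm_coeff_sq _).summable, ?_⟩,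
    fun r hr => ?_, fun r hr => ?_⟩
  · simp only [e]
    exact (key 2 _ _ (hu.inH2 r hr).2 (hw.inH2 r hr).2).1
  · rw [e]
    have := (key 0 (coeff (u r)) (coeff (w r)) (by simpa using (hu.inH2 r hr).1)
      (by simpa using (hw.inH2 r hr).1)).2
    linarith [hu.wsum_zero_le r hr, hw.wsum_zero_le r hr]
  · rw [e]
    have := (key 2 (coeff (u r)) (coeff (w r)) (hu.inH2 r hr).2 (hw.inH2 r hr).2).2
    linarith [hu.wsum_two_le r hr, hw.wsum_two_le r hr]

/-! ### Regularity of solutions of the Kuramoto-Sivashinsky equation -/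

lemma integral_exp_le {σ s t : ℝ} (hσ : 0 < σ) :
    ∫ r in s..t, Real.exp (-(t - r) * σ) ≤ 1 / σ := by
  have hd : ∀ x ∈ uIcc s t, HasDerivAt (fun x => Real.exp (-(t - x) * σ) / σ)
      (Real.exp (-(t - x) * σ)) x := by
    intro x _
    have h1 : HasDerivAt (fun x : ℝ => -(t - x) * σ) (-(-1) * σ) x :=
      (((hasDerivAt_id x).const_sub t).neg).mul_const σ
    exact (h1.exp.div_const σ).congr_deriv (by
      rw [neg_neg, one_mul, mul_div_assoc, div_self hσ.ne', mul_one])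
  rw [intervalIntegral.integral_eq_sub_of_hasDerivAt hd
    (Continuous.intervalIntegrable (by fun_prop) _ _)]
  have : 0 ≤ Real.exp (-(t - s) * σ) / σ := by positivity
  simp only [sub_self, neg_zero, zero_mul, Real.exp_zero]
  linarith

/-- Here κ stands for the value of `kappaSq`. From κ ≥ 2 on, the symbol is at least κ²/2, so the
free part gains κ² e^{-sκ²} ≤ 1/s, and the forcing part gains 1/σ, which leaves a multiple of the
summable 1 / (1 + κ²). -/
lemma high_mode_le {κ s d A A₀ M : ℝ} (hk : 2 ≤ κ) (hs : 0 < s) (hd : s ≤ d) (hA : 0 ≤ A)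
    (hn : A ≤ Real.exp (-d * (κ ^ 2 - κ)) * A₀ + M * (1 / (κ ^ 2 - κ))) :
    κ ^ 2 * A ^ 2 ≤ 2 / s * A₀ ^ 2 + 16 * M ^ 2 * (1 / (1 + κ ^ 2)) := by
  have hσk : κ ^ 2 / 2 ≤ κ ^ 2 - κ := by nlinarith
  have hσ0 : 0 < κ ^ 2 - κ := by nlinarith
  generalize κ ^ 2 - κ = σ at *
  set E := Real.exp (-d * σ) with hE
  have hE0 : 0 < E := Real.exp_pos _
  have hE2 : κ ^ 2 * E ^ 2 ≤ 1 / s := by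
    have h1 : E ^ 2 ≤ Real.exp (-(s * κ ^ 2)) := by
      rw [hE, sq, ← Real.exp_add]
      refine Real.exp_le_exp.2 ?_
      have := mul_le_mul hd hσk (by positivity) (by linarith)
      linarith
    have h2 : Real.exp (-(s * κ ^ 2)) * (s * κ ^ 2) ≤ 1 := by
      have := Real.add_one_le_exp (s * κ ^ 2)
      calc _ ≤ Real.exp (-(s * κ ^ 2)) * Real.exp (s * κ ^ 2) := by
            gcongr; linarith
        _ = 1 := by rw [← Real.exp_add]; simp
    rw [le_div_iff₀ hs]
    have := mul_le_mul_of_nonneg_left h1 (mul_nonneg hs.le (sq_nonneg κ))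
    linarith
  have hinv : κ ^ 2 * (1 / σ) ^ 2 ≤ 8 * (1 / (1 + κ ^ 2)) := by
    have h1 : 1 / σ ≤ 2 / κ ^ 2 := by
      rw [div_le_div_iff₀ hσ0 (by positivity)]; linarith
    calc _ ≤ κ ^ 2 * (2 / κ ^ 2) ^ 2 := by gcongr
      _ = 4 / κ ^ 2 := by field_simp; norm_num
      _ ≤ 8 * (1 / (1 + κ ^ 2)) := by
        rw [mul_one_div, div_le_div_iff₀ (by positivity) (by positivity)]; nlinarith
  have hsq := pow_le_pow_left₀ hA hn 2
  have h1 : A ^ 2 ≤ 2 * (E ^ 2 * A₀ ^ 2) + 2 * (M ^ 2 * (1 / σ) ^ 2) := by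
    linarith [sq_nonneg (E * A₀ - M * (1 / σ)), hsq]
  calc κ ^ 2 * A ^ 2 ≤ κ ^ 2 * (2 * (E ^ 2 * A₀ ^ 2) + 2 * (M ^ 2 * (1 / σ) ^ 2)) := by gcongr
    _ = 2 * ((κ ^ 2 * E ^ 2) * A₀ ^ 2) + 2 * M ^ 2 * (κ ^ 2 * (1 / σ) ^ 2) := by ring
    _ ≤ 2 * ((1 / s) * A₀ ^ 2) + 2 * M ^ 2 * (8 * (1 / (1 + κ ^ 2))) := by gcongr
    _ = _ := by ring

lemma partial_meanFreePart {f : L2 L₁ L₂} (h : MemH1 f) (h' : MemH1 (meanFreePart f)) :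
    partial₁ (meanFreePart f) = partial₁ f ∧ partial₂ (meanFreePart f) = partial₂ f := by
  constructor <;> refine L2_ext fun k => ?_
  · rw [h'.coeff_partial₁, h.coeff_partial₁, coeff_meanFreePart]
    split_ifs with hk
    · simp [hk, symb₁, wave₁]
    · rfl
  · rw [h'.coeff_partial₂, h.coeff_partial₂, coeff_meanFreePart]
    split_ifs with hk
    · simp [hk, symb₂, wave₂]
    · rfl

section KS

variable {v : ℝ → Torus L₁ L₂ → ℝ × ℝ} {T : ℝ} {φ₀ : L2 L₁ L₂} {φ : ℝ → L2 L₁ L₂}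

lemma IsBoundedDivFree.coeff_ks {K : ℝ} {w : Torus L₁ L₂ → ℝ × ℝ} (hw : IsBoundedDivFree K w)
    (f : L2 L₁ L₂) (k : ℤ × ℤ) : coeff (fun x => 1 / 2 * gradSq f x + advect w f x) k =
      coeff (fun x => 1 / 2 * gradSq f x) k + coeff (advect w f) k :=
  coeff_add ((integrable_gradSq f).const_mul _) (hw.integrable_advect f) k

lemma ae_restrict_Ioc_of_Ici {p : ℝ → Prop} {s t : ℝ} (hs : 0 ≤ s)
    (h : ∀ᵐ r ∂(volume.restrict (Ici (0 : ℝ))), p r) :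
    ∀ᵐ r ∂(volume.restrict (Ioc s t)), p r :=
  ae_restrict_of_ae_restrict_of_subset (fun _ hr => hs.trans hr.1.le) h

/-- Mild solutions of the Kuramoto-Sivashinsky equation are bounded in `H²` away from the initial
time. -/
lemma IsAKSSolution.exists_isH2Path (hv : IsAdmissibleVelocity v) (h : IsAKSSolution v T φ₀ φ)
    {ε : ℝ} (hε : 0 < ε) (hεT : ε ≤ T) : ∃ M, IsH2Path φ ε T M := by
  obtain ⟨K, hK0, hK⟩ := hv.exists_bound
  have hσ := isParabolicSymbol_kuramotoSivashinsky (L₁ := L₁) (L₂ := L₂)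
  have hT : 0 ≤ T := hε.le.trans hεT
  obtain ⟨Mg, hMg⟩ := h.gradBound
  -- The gradient bound of a mild solution degenerates at time 0. On [ε/2, T] it is uniform, and the
  -- remaining time ε/2 is available for smoothing.
  set s := ε / 2 with hs
  have hs0 : 0 < s := by positivity
  have hsT : s ≤ T := by linarith
  have hsI : s ∈ Icc 0 T := ⟨hs0.le, hsT⟩
  set W := (area L₁ L₂)⁻¹ * (Mg / s ^ (1 / 4 : ℝ)) ^ 2 with hW
  have hW0 : 0 ≤ W := by have := area_pos (L₁ := L₁) (L₂ := L₂); positivity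
  have hH1 : ∀ r ∈ Icc s T, MemH1 (φ r) := fun r hr => h.memH1 r ⟨hs0.trans_le hr.1, hr.2⟩
  have hgrad : ∀ r ∈ Icc s T, wsum L₁ L₂ 1 (coeff (φ r)) ≤ W := by
    intro r hr
    have hr0 : 0 < r := hs0.trans_le hr.1
    have h1 := hMg r ⟨hr0, hr.2⟩
    rw [sub_zero] at h1
    have h2 : s ^ (1 / 4 : ℝ) ≤ r ^ (1 / 4 : ℝ) := Real.rpow_le_rpow hs0.le hr.1 (by norm_num)
    have h3 : 0 < s ^ (1 / 4 : ℝ) := Real.rpow_pos_of_pos hs0 _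
    have h4 : 0 ≤ gradNorm (φ r) := Real.sqrt_nonneg _
    have h5 : gradNorm (φ r) ≤ Mg / s ^ (1 / 4 : ℝ) := by
      rw [le_div_iff₀ h3, mul_comm]
      exact (mul_le_mul_of_nonneg_right h2 h4).trans h1
    have h6 := pow_le_pow_left₀ h4 h5 2
    rw [(hH1 r hr).gradNorm_sq] at h6
    rw [hW, ← div_eq_inv_mul, le_div_iff₀ area_pos, mul_comm]
    exact h6
  set M₂ := 1 / 2 * W + √(2 * K ^ 2 * W) with hM₂
  have hM₂0 : 0 ≤ M₂ := by positivity
  set G : ℝ → ℤ × ℤ → ℂ := fun r k =>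
    coeff (fun x => 1 / 2 * gradSq (φ r) x + advect (v r) (φ r) x) k with hG
  have hGb : ∀ᵐ r ∂(volume.restrict (Ioc s T)), ∀ k, ‖G r k‖ ≤ M₂ := by
    filter_upwards [ae_restrict_Ioc_of_Ici hs0.le hK, ae_restrict_mem measurableSet_Ioc]
      with r hr hrI k
    have hrI' := Ioc_subset_Icc_self hrI
    simp only [hG]
    rw [hr.coeff_ks]
    refine (norm_add_le _ _).trans (add_le_add ?_ ?_)
    · exact ((hH1 r hrI').norm_coeff_gradSq_le k).trans (by linarith [hgrad r hrI'])
    · have h1 := hr.tsum_advect_le (hH1 r hrI')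
      refine Real.le_sqrt_of_sq_le ?_
      refine (h1.1.le_tsum k fun _ _ => sq_nonneg _).trans (h1.2.trans ?_)
      exact mul_le_mul_of_nonneg_left (hgrad r hrI') (by positivity)
  -- Continuity on a compact interval bounds the `L²` norm; the weight of the low modes is bounded,
  -- so they need nothing more.
  obtain ⟨M₀, hM₀⟩ := (isCompact_Icc (a := (0 : ℝ)) (b := T)).exists_bound_of_continuousOn
    h.continuousOn
  have hM₀' : ∀ r ∈ Icc 0 T, wsum L₁ L₂ 0 (coeff (φ r)) ≤ (area L₁ L₂)⁻¹ * M₀ ^ 2 := by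
    intro r hr
    rw [wsum_zero_coeff]
    have := hM₀ r hr
    have := area_pos (L₁ := L₁) (L₂ := L₂)
    gcongr
  set X₀ := (area L₁ L₂)⁻¹ * M₀ ^ 2
  have hmode : ∀ t ∈ Icc ε T, ∀ k, kappaSq L₁ L₂ k ^ 2 * ‖coeff (φ t) k‖ ^ 2 ≤
      4 * ‖coeff (φ t) k‖ ^ 2 + 2 / s * ‖coeff (φ s) k‖ ^ 2 +
        16 * M₂ ^ 2 * (1 / (1 + kappaSq L₁ L₂ k ^ 2)) := by
    intro t ht k
    have hst : s ≤ t := by linarith [ht.1]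
    set κ := kappaSq L₁ L₂ k with hκ
    have hκ0 : 0 ≤ κ := kappaSq_nonneg k
    rcases lt_or_ge κ 2 with hk | hk
    · have h1 : κ ^ 2 ≤ 4 := by nlinarith
      have h2 : 0 ≤ 2 / s * ‖coeff (φ s) k‖ ^ 2 := by positivity
      have h3 : 0 ≤ 16 * M₂ ^ 2 * (1 / (1 + κ ^ 2)) := by positivity
      nlinarith [mul_le_mul_of_nonneg_right h1 (sq_nonneg ‖coeff (φ t) k‖)]
    · have hσk : κ ^ 2 / 2 ≤ κ ^ 2 - κ := by nlinarith
      have hσ0 : 0 < κ ^ 2 - κ := by nlinarith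
      -- Duhamel's formula is restarted at s, because the forcing is uniformly bounded only after
      -- that time.
      have hd := duhamel_restart (a := fun r => coeff (φ r) k)
        (h.intervalIntegrable_coeff hσ hT k) (h.coeff_eq hσ k) hsI ⟨hst, ht.2⟩
      have hint : ‖∫ r in s..t, (Real.exp (-(t - r) * (κ ^ 2 - κ)) : ℝ) * G r k‖ ≤
          M₂ * (1 / (κ ^ 2 - κ)) := by
        have h1 : ‖∫ r in s..t, (Real.exp (-(t - r) * (κ ^ 2 - κ)) : ℝ) * G r k‖ ≤
            ∫ r in s..t, M₂ * Real.exp (-(t - r) * (κ ^ 2 - κ)) := by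
          refine intervalIntegral.norm_integral_le_of_norm_le hst ?_
            (Continuous.intervalIntegrable (by fun_prop) _ _)
          rw [← ae_restrict_iff' measurableSet_Ioc]
          filter_upwards [ae_restrict_of_ae_restrict_of_subset (Ioc_subset_Ioc_right ht.2) hGb]
            with r hr
          rw [norm_mul, Complex.norm_real, Real.norm_of_nonneg (Real.exp_pos _).le, mul_comm]
          exact mul_le_mul_of_nonneg_right (hr k) (Real.exp_pos _).le
        refine h1.trans ?_
        rw [intervalIntegral.integral_const_mul]
        exact mul_le_mul_of_nonneg_left (integral_exp_le hσ0) hM₂0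
      have hn : ‖coeff (φ t) k‖ ≤ Real.exp (-(t - s) * (κ ^ 2 - κ)) * ‖coeff (φ s) k‖ +
          M₂ * (1 / (κ ^ 2 - κ)) := by
        have e : coeff (φ t) k = _ := hd
        rw [e]
        refine (norm_sub_le _ _).trans (add_le_add (le_of_eq ?_) hint)
        rw [norm_mul, Complex.norm_real, Real.norm_of_nonneg (Real.exp_pos _).le]
      have := high_mode_le hk hs0 (show s ≤ t - s by linarith [ht.1]) (norm_nonneg _) hn
      have : 0 ≤ 4 * ‖coeff (φ t) k‖ ^ 2 := by positivity
      linarith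
  have hsb : ∀ t, Summable fun k => 4 * ‖coeff (φ t) k‖ ^ 2 + 2 / s * ‖coeff (φ s) k‖ ^ 2 +
        16 * M₂ ^ 2 * (1 / (1 + kappaSq L₁ L₂ k ^ 2)) := fun t =>
    (((hasSum_norm_coeff_sq (φ t)).summable.mul_left 4).add
      ((hasSum_norm_coeff_sq (φ s)).summable.mul_left (2 / s))).add
      (summable_inv_kappaSq_sq.mul_left (16 * M₂ ^ 2))
  have hs2 : ∀ t ∈ Icc ε T, Summable fun k => kappaSq L₁ L₂ k ^ 2 * ‖coeff (φ t) k‖ ^ 2 :=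
    fun t ht => (hsb t).of_nonneg_of_le (fun k => by positivity) (hmode t ht)
  set Z := ∑' k, 1 / (1 + kappaSq L₁ L₂ k ^ 2)
  have hX₀ : 0 ≤ X₀ := (wsum_nonneg _ _).trans (hM₀' s hsI)
  have hZ : 0 ≤ Z := tsum_nonneg fun k => by positivity
  refine ⟨X₀ + (4 * X₀ + 2 / s * X₀ + 16 * M₂ ^ 2 * Z), h.continuousOn.mono
    (Icc_subset_Icc_left hε.le), fun t ht => ⟨(hasSum_norm_coeff_sq _).summable, hs2 t ht⟩,
    fun t ht => ?_, fun t ht => ?_⟩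
  · refine (hM₀' t ⟨hε.le.trans ht.1, ht.2⟩).trans (le_add_of_nonneg_right ?_)
    positivity
  · have h1 := (hs2 t ht).tsum_le_tsum (hmode t ht) (hsb t)
    rw [(((hasSum_norm_coeff_sq (φ t)).summable.mul_left 4).add
      ((hasSum_norm_coeff_sq (φ s)).summable.mul_left (2 / s))).tsum_add
      (summable_inv_kappaSq_sq.mul_left (16 * M₂ ^ 2)),
      ((hasSum_norm_coeff_sq (φ t)).summable.mul_left 4).tsum_add
      ((hasSum_norm_coeff_sq (φ s)).summable.mul_left (2 / s)), tsum_mul_left, tsum_mul_left,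
      tsum_mul_left, ← wsum_zero (L₁ := L₁) (L₂ := L₂), ← wsum_zero (L₁ := L₁) (L₂ := L₂)] at h1
    have a1 := hM₀' t ⟨hε.le.trans ht.1, ht.2⟩
    have a2 := mul_le_mul_of_nonneg_left (hM₀' s hsI) (show 0 ≤ 2 / s by positivity)
    change wsum L₁ L₂ 2 _ ≤ _ at h1
    linarith

end KS

/-! ### Measurability -/

variable (L₁ L₂) in
/-- The real part, as a map from complex `L²` to real `L²`. -/
def reLp : Lp ℂ 2 (volume : Measure (Torus L₁ L₂)) →L[ℝ] L2 L₁ L₂ :=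
  Complex.reCLM.compLpL 2 volume

lemma hasSum_reLp (f : L2 L₁ L₂) :
    HasSum (fun k => reLp L₁ L₂ (((√(area L₁ L₂) : ℂ) * coeff f k) • expoBasis k)) f := by
  have hf := memLp_ofReal (Lp.memLp f)
  have h1 := (reLp L₁ L₂).hasSum (expoBasis.hasSum_repr (hf.toLp _))
  have e : reLp L₁ L₂ (hf.toLp _) = f := by
    refine Lp.ext ?_
    filter_upwards [Complex.reCLM.coeFn_compLpL (hf.toLp _), hf.coeFn_toLp] with x h1 h2
    rw [reLp, h1, h2]; simp
  rw [e] at h1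
  refine h1.congr_fun fun k => ?_
  rw [expoBasis_repr, ccoeff_congr_ae hf.coeFn_toLp]
  rfl

/-- A function with measurable coefficients is the pointwise sum in `L²` of its Fourier series,
hence strongly measurable. -/
lemma aestronglyMeasurable_L2 {α : Type*} [MeasurableSpace α] {μ : Measure α} {U : α → L2 L₁ L₂}
    (h : ∀ k, AEStronglyMeasurable (fun r => coeff (U r) k) μ) : AEStronglyMeasurable U μ := by
  have e : U = fun r => ∑' k, reLp L₁ L₂ (((√(area L₁ L₂) : ℂ) * coeff (U r) k) • expoBasis k) :=
    funext fun r => (hasSum_reLp (U r)).tsum_eq.symm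
  rw [e]
  refine aestronglyMeasurable_tsum (fun k => ?_)
    (Filter.Eventually.of_forall fun r => (hasSum_reLp (U r)).summable)
  exact (reLp L₁ L₂).continuous.comp_aestronglyMeasurable (((h k).const_mul _).smul_const _)

lemma IsAdmissibleVelocity.measurable_coeff {v : ℝ → Torus L₁ L₂ → ℝ × ℝ}
    (hv : IsAdmissibleVelocity v) (k : ℤ × ℤ) :
    StronglyMeasurable (fun r => coeff (fun x => (v r x).1) k) ∧
    StronglyMeasurable (fun r => coeff (fun x => (v r x).2) k) := by
  have he : Measurable fun p : ℝ × Torus L₁ L₂ => expo (-k) p.2 :=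
    (expo (-k)).continuous.measurable.comp measurable_snd
  constructor
  · have h1 : Measurable (Function.uncurry fun r (x : Torus L₁ L₂) =>
        expo (-k) x * ((v r x).1 : ℂ)) :=
      he.mul (Complex.measurable_ofReal.comp hv.measurable.fst)
    exact (h1.stronglyMeasurable.integral_prod_right (ν := volume)).const_mul _
  · have h1 : Measurable (Function.uncurry fun r (x : Torus L₁ L₂) =>
        expo (-k) x * ((v r x).2 : ℂ)) :=
      he.mul (Complex.measurable_ofReal.comp hv.measurable.snd)
    exact (h1.stronglyMeasurable.integral_prod_right (ν := volume)).const_mul _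

/-- The representatives of ∂u(r) are chosen separately for each r, with no joint measurability in
(r, x). The convolution series expresses the coefficient through measurable scalar functions of
time. -/
lemma IsAdmissibleVelocity.aestronglyMeasurable_advect {v : ℝ → Torus L₁ L₂ → ℝ × ℝ}
    (hv : IsAdmissibleVelocity v) {u : ℝ → L2 L₁ L₂} {s t : ℝ} (hs : 0 ≤ s)
    (hu : ContinuousOn u (Icc s t)) (hH1 : ∀ r ∈ Icc s t, MemH1 (u r)) (k : ℤ × ℤ) :
    AEStronglyMeasurable (fun r => coeff (advect (v r) (u r)) k) (volume.restrict (Ioc s t)) := by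
  obtain ⟨K, hK0, hK⟩ := hv.exists_bound
  have hK' := ae_restrict_Ioc_of_Ici (t := t) hs hK
  have hc : ∀ j, AEStronglyMeasurable (fun r => coeff (u r) j) (volume.restrict (Ioc s t)) :=
    fun j => ((continuousOn_coeff hu j).mono Ioc_subset_Icc_self).aestronglyMeasurable
      measurableSet_Ioc
  refine (aestronglyMeasurable_tsum (F := fun j r =>
    (coeff (fun x => (v r x).1) (k - j) * symb₁ L₁ j +
      coeff (fun x => (v r x).2) (k - j) * symb₂ L₂ j) * coeff (u r) j) (fun j => ?_) ?_).congr ?_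
  · exact ((((hv.measurable_coeff (k - j)).1.aestronglyMeasurable).mul_const _).add
      (((hv.measurable_coeff (k - j)).2.aestronglyMeasurable).mul_const _)).mul (hc j)
  · filter_upwards [hK', ae_restrict_mem measurableSet_Ioc] with r hr hrI
    exact (hr.hasSum_coeff_advect (hH1 r (Ioc_subset_Icc_self hrI)) k).summable
  · filter_upwards [hK', ae_restrict_mem measurableSet_Ioc] with r hr hrI
    exact (hr.hasSum_coeff_advect (hH1 r (Ioc_subset_Icc_self hrI)) k).tsum_eq

lemma IsBoundedDivFree.coeff_advect_sub {K : ℝ} {w : Torus L₁ L₂ → ℝ × ℝ}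
    (hw : IsBoundedDivFree K w) {f g : L2 L₁ L₂} (hf : MemH1 f) (hg : MemH1 g)
    (hfg : MemH1 (f - g)) (k : ℤ × ℤ) :
    coeff (advect w (f - g)) k = coeff (advect w f) k - coeff (advect w g) k := by
  refine (hw.hasSum_coeff_advect hfg k).unique ?_
  refine ((hw.hasSum_coeff_advect hf k).sub (hw.hasSum_coeff_advect hg k)).congr_fun fun j => ?_
  rw [coeff_sub_L2]; ring

/-! ### A Volterra operator on the Fourier side -/

/-- Cauchy–Schwarz for the measure p dr, from the sign of the discriminant of c ↦ ∫ p (‖μ‖ - c)². -/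
lemma norm_integral_mul_sq_le {p : ℝ → ℝ} {μ : ℝ → ℂ} {s t : ℝ} (hst : s ≤ t) (hp : Continuous p)
    (hp0 : ∀ r, 0 ≤ p r) (hμ : IntervalIntegrable μ volume s t)
    (hμ2 : IntervalIntegrable (fun r => ‖μ r‖ ^ 2) volume s t) :
    ‖∫ r in s..t, (p r : ℂ) * μ r‖ ^ 2 ≤ (∫ r in s..t, p r) * ∫ r in s..t, p r * ‖μ r‖ ^ 2 := by
  have h1 : ‖∫ r in s..t, (p r : ℂ) * μ r‖ ≤ ∫ r in s..t, p r * ‖μ r‖ := by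
    refine (intervalIntegral.norm_integral_le_integral_norm hst).trans (le_of_eq ?_)
    congr 1; ext r
    rw [norm_mul, Complex.norm_real, Real.norm_of_nonneg (hp0 r)]
  have i0 : IntervalIntegrable p volume s t := hp.intervalIntegrable _ _
  have i1 : IntervalIntegrable (fun r => p r * ‖μ r‖) volume s t :=
    hμ.norm.continuousOn_mul hp.continuousOn
  have i2 : IntervalIntegrable (fun r => p r * ‖μ r‖ ^ 2) volume s t :=
    hμ2.continuousOn_mul hp.continuousOn
  have hd : ∀ c : ℝ, 0 ≤ (∫ r in s..t, p r) * (c * c) + (-2 * ∫ r in s..t, p r * ‖μ r‖) * c +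
      ∫ r in s..t, p r * ‖μ r‖ ^ 2 := by
    intro c
    have e : (∫ r in s..t, p r) * (c * c) + (-2 * ∫ r in s..t, p r * ‖μ r‖) * c +
        ∫ r in s..t, p r * ‖μ r‖ ^ 2 =
        ∫ r in s..t, (p r * (c * c) + (p r * ‖μ r‖) * (-2 * c) + p r * ‖μ r‖ ^ 2) := by
      rw [intervalIntegral.integral_add ((i0.mul_const _).add (i1.mul_const _)) i2,
        intervalIntegral.integral_add (i0.mul_const _) (i1.mul_const _),
        intervalIntegral.integral_mul_const, intervalIntegral.integral_mul_const]
      ring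
    rw [e]
    refine intervalIntegral.integral_nonneg hst fun r _ => ?_
    have := mul_nonneg (hp0 r) (sq_nonneg (‖μ r‖ - c))
    linarith
  have h2 := discrim_le_zero hd
  rw [discrim] at h2
  have h3 := pow_le_pow_left₀ (norm_nonneg _) h1 2
  linarith

variable (L₁ L₂) in
/-- The symbol of `(1 + Δ²)^{1/2}`. -/
def weight (k : ℤ × ℤ) : ℝ := √(1 + kappaSq L₁ L₂ k ^ 2)

lemma weight_pos (k : ℤ × ℤ) : 0 < weight L₁ L₂ k := Real.sqrt_pos.2 (by positivity)

lemma weight_sq (k : ℤ × ℤ) : weight L₁ L₂ k ^ 2 = 1 + kappaSq L₁ L₂ k ^ 2 :=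
  Real.sq_sqrt (by positivity)

lemma weight_neg (k : ℤ × ℤ) : weight L₁ L₂ (-k) = weight L₁ L₂ k := by
  rw [weight, kappaSq_neg, weight]

section Volterra

variable {μ : ℝ → ℤ × ℤ → ℂ} {s T B lam : ℝ}

/-- The values on `[s, T]` of `μ` are measurable in time and bounded in `ℓ²`. -/
structure IsBoundedForcing (μ : ℝ → ℤ × ℤ → ℂ) (s T B : ℝ) : Prop where
  measurable : ∀ k, AEStronglyMeasurable (fun r => μ r k) (volume.restrict (Ioc s T))
  bound : ∀ᵐ r ∂(volume.restrict (Ioc s T)), (Summable fun k => ‖μ r k‖ ^ 2) ∧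
    ∑' k, ‖μ r k‖ ^ 2 ≤ B

lemma IsBoundedForcing.mono (h : IsBoundedForcing μ s T B) {t : ℝ} (ht : t ≤ T) :
    IsBoundedForcing μ s t B :=
  ⟨fun k => (h.measurable k).mono_measure (Measure.restrict_mono_set _ (Ioc_subset_Ioc_right ht)),
    ae_restrict_of_ae_restrict_of_subset (Ioc_subset_Ioc_right ht) h.bound⟩

lemma IsBoundedForcing.ae_norm_sq_le (h : IsBoundedForcing μ s T B) (k : ℤ × ℤ) :
    ∀ᵐ r ∂(volume.restrict (Ioc s T)), ‖μ r k‖ ^ 2 ≤ B := by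
  filter_upwards [h.bound] with r hr
  exact (hr.1.le_tsum k fun _ _ => sq_nonneg _).trans hr.2

lemma IsBoundedForcing.intervalIntegrable (h : IsBoundedForcing μ s T B) (hsT : s ≤ T)
    (k : ℤ × ℤ) : IntervalIntegrable (fun r => μ r k) volume s T := by
  refine intervalIntegrable_of_bound (C := √B) hsT (h.measurable k) ?_
  filter_upwards [h.ae_norm_sq_le k] with r hr
  exact Real.le_sqrt_of_sq_le hr

lemma IsBoundedForcing.intervalIntegrable_sq (h : IsBoundedForcing μ s T B) (hsT : s ≤ T)
    (k : ℤ × ℤ) : IntervalIntegrable (fun r => ‖μ r k‖ ^ 2) volume s T := by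
  refine intervalIntegrable_of_bound (C := B) hsT ((h.measurable k).norm.pow 2) ?_
  filter_upwards [h.ae_norm_sq_le k] with r hr
  rwa [Real.norm_of_nonneg (sq_nonneg _)]

variable (L₁ L₂) in
/-- The solution of `y' + (Δ² + lam) y = μ`, `y(s) = 0`, in weighted Fourier coefficients. -/
def volterra (μ : ℝ → ℤ × ℤ → ℂ) (s lam t : ℝ) (k : ℤ × ℤ) : ℂ :=
  (weight L₁ L₂ k : ℂ) *
    ∫ r in s..t, (Real.exp (-(t - r) * (kappaSq L₁ L₂ k ^ 2 + lam)) : ℝ) * μ r k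

/-- Cauchy–Schwarz leaves one factor ∫ exp ≤ 1 / (κ⁴ + lam), which absorbs the squared weight 1 + κ⁴
since lam ≥ 1. The other kernel is bounded by exp (-(t - r) lam), which does not depend on the mode
and therefore permits summation. -/
lemma IsBoundedForcing.norm_volterra_sq_le (h : IsBoundedForcing μ s T B) (hlam : 1 ≤ lam)
    {t : ℝ} (ht : t ∈ Icc s T) (k : ℤ × ℤ) :
    ‖volterra L₁ L₂ μ s lam t k‖ ^ 2 ≤ ∫ r in s..t, Real.exp (-(t - r) * lam) * ‖μ r k‖ ^ 2 := by
  have h' := h.mono ht.2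
  set σ := kappaSq L₁ L₂ k ^ 2 + lam with hσ
  have hσ0 : 0 < σ := by positivity
  have h1 := norm_integral_mul_sq_le (p := fun r => Real.exp (-(t - r) * σ)) ht.1 (by fun_prop)
    (fun r => (Real.exp_pos _).le) (h'.intervalIntegrable ht.1 k) (h'.intervalIntegrable_sq ht.1 k)
  have i2 := h'.intervalIntegrable_sq ht.1 k
  have h2 : ∫ r in s..t, Real.exp (-(t - r) * σ) * ‖μ r k‖ ^ 2 ≤
      ∫ r in s..t, Real.exp (-(t - r) * lam) * ‖μ r k‖ ^ 2 := by
    refine intervalIntegral.integral_mono_on ht.1 (i2.continuousOn_mul (by fun_prop))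
      (i2.continuousOn_mul (by fun_prop)) fun r hr => ?_
    refine mul_le_mul_of_nonneg_right (Real.exp_le_exp.2 ?_) (sq_nonneg _)
    have : lam ≤ σ := by rw [hσ]; nlinarith [sq_nonneg (kappaSq L₁ L₂ k)]
    nlinarith [hr.2]
  have h3 : 0 ≤ ∫ r in s..t, Real.exp (-(t - r) * lam) * ‖μ r k‖ ^ 2 :=
    intervalIntegral.integral_nonneg ht.1 fun r _ => by positivity
  have h4 : 0 ≤ ∫ r in s..t, Real.exp (-(t - r) * σ) * ‖μ r k‖ ^ 2 :=
    intervalIntegral.integral_nonneg ht.1 fun r _ => by positivity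
  rw [volterra, norm_mul, mul_pow, Complex.norm_real, Real.norm_of_nonneg (weight_pos k).le,
    weight_sq]
  calc _ ≤ (1 + kappaSq L₁ L₂ k ^ 2) * ((1 / σ) *
          ∫ r in s..t, Real.exp (-(t - r) * lam) * ‖μ r k‖ ^ 2) := by
        refine mul_le_mul_of_nonneg_left (h1.trans ?_) (by positivity)
        exact mul_le_mul (integral_exp_le hσ0) h2 h4 (by positivity)
    _ = ((1 + kappaSq L₁ L₂ k ^ 2) / σ) *
          ∫ r in s..t, Real.exp (-(t - r) * lam) * ‖μ r k‖ ^ 2 := by ring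
    _ ≤ 1 * ∫ r in s..t, Real.exp (-(t - r) * lam) * ‖μ r k‖ ^ 2 := by
        refine mul_le_mul_of_nonneg_right ?_ h3
        rw [div_le_one hσ0, hσ]; linarith
    _ = _ := one_mul _

lemma IsBoundedForcing.sum_norm_sq_le (h : IsBoundedForcing μ s T B)
    {p : ℝ → ℝ} (hp : Continuous p) (hp0 : ∀ r, 0 ≤ p r) (hsT : s ≤ T) (S : Finset (ℤ × ℤ)) :
    ∑ k ∈ S, ∫ r in s..T, p r * ‖μ r k‖ ^ 2 ≤ B * ∫ r in s..T, p r := by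
  have hi : ∀ k ∈ S, IntervalIntegrable (fun r => p r * ‖μ r k‖ ^ 2) volume s T :=
    fun k _ => (h.intervalIntegrable_sq hsT k).continuousOn_mul hp.continuousOn
  rw [← intervalIntegral.integral_finsetSum hi, ← intervalIntegral.integral_const_mul]
  refine intervalIntegral.integral_mono_ae_restrict hsT ?_ ?_ ?_
  · have := IntervalIntegrable.sum S hi
    rwa [Finset.sum_fn] at this
  · exact Continuous.intervalIntegrable (by fun_prop) _ _
  · rw [← restrict_Ioc_eq_restrict_Icc]
    filter_upwards [h.bound] with r hr
    simp only [← Finset.mul_sum]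
    rw [mul_comm B]
    exact mul_le_mul_of_nonneg_left ((hr.1.sum_le_tsum S fun _ _ => sq_nonneg _).trans hr.2) (hp0 r)

/-- The factor 1 / lam is the mass of the damping kernel; for large lam it makes the fixed point map
a contraction. -/
lemma IsBoundedForcing.tsum_volterra_le (h : IsBoundedForcing μ s T B) (hB : 0 ≤ B)
    (hlam : 1 ≤ lam) {t : ℝ} (ht : t ∈ Icc s T) :
    (Summable fun k => ‖volterra L₁ L₂ μ s lam t k‖ ^ 2) ∧
      ∑' k, ‖volterra L₁ L₂ μ s lam t k‖ ^ 2 ≤ B / lam := by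
  have hb : ∀ S : Finset (ℤ × ℤ), ∑ k ∈ S, ‖volterra L₁ L₂ μ s lam t k‖ ^ 2 ≤ B / lam := by
    intro S
    refine (Finset.sum_le_sum fun k _ => h.norm_volterra_sq_le hlam ht k).trans ?_
    refine ((h.mono ht.2).sum_norm_sq_le (p := fun r => Real.exp (-(t - r) * lam))
      (by fun_prop) (fun r => (Real.exp_pos _).le) ht.1 S).trans ?_
    rw [div_eq_mul_one_div]
    exact mul_le_mul_of_nonneg_left (integral_exp_le (by linarith)) hB
  exact ⟨summable_of_sum_le (fun k => sq_nonneg _) hb,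
    Real.tsum_le_of_sum_le (fun k => sq_nonneg _) hb⟩

/-- A bound for the solution that is uniform in time. -/
lemma IsBoundedForcing.exists_summable_bound (h : IsBoundedForcing μ s T B)
    (hlam : 1 ≤ lam) (hsT : s ≤ T) : ∃ d : ℤ × ℤ → ℝ, Summable d ∧ ∀ t ∈ Icc s T, ∀ k,
      ‖volterra L₁ L₂ μ s lam t k‖ ^ 2 ≤ d k := by
  refine ⟨fun k => ∫ r in s..T, (1 : ℝ) * ‖μ r k‖ ^ 2, summable_of_sum_le (fun k => ?_)
    (h.sum_norm_sq_le continuous_const (fun _ => zero_le_one) hsT), fun t ht k => ?_⟩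
  · exact intervalIntegral.integral_nonneg hsT fun r _ => by positivity
  · refine (h.norm_volterra_sq_le hlam ht k).trans ?_
    have i2 := h.intervalIntegrable_sq hsT k
    have i2' := (h.mono ht.2).intervalIntegrable_sq ht.1 k
    have h1 : ∫ r in s..t, Real.exp (-(t - r) * lam) * ‖μ r k‖ ^ 2 ≤
        ∫ r in s..t, (1 : ℝ) * ‖μ r k‖ ^ 2 := by
      refine intervalIntegral.integral_mono_on ht.1 (i2'.continuousOn_mul (by fun_prop))
        (i2'.const_mul 1) fun r hr => ?_
      refine mul_le_mul_of_nonneg_right ?_ (sq_nonneg _)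
      rw [Real.exp_le_one_iff]
      nlinarith [hr.2]
    refine h1.trans ?_
    refine intervalIntegral.integral_mono_interval le_rfl ht.1 ht.2 ?_ (i2.const_mul 1)
    exact Filter.Eventually.of_forall fun r => by simp only [Pi.zero_apply]; positivity

lemma IsBoundedForcing.continuousOn_volterra (h : IsBoundedForcing μ s T B) (hsT : s ≤ T)
    (k : ℤ × ℤ) : ContinuousOn (fun t => volterra L₁ L₂ μ s lam t k) (Icc s T) := by
  set σ := kappaSq L₁ L₂ k ^ 2 + lam with hσ
  have hi : IntervalIntegrable (fun r => ((Real.exp ((r - s) * σ) : ℝ) : ℂ) * μ r k) volume s T :=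
    (h.intervalIntegrable hsT k).continuousOn_mul (by fun_prop)
  have hc := intervalIntegral.continuousOn_primitive_interval' hi left_mem_uIcc
  rw [uIcc_of_le hsT] at hc
  have h1 : ContinuousOn (fun t => (weight L₁ L₂ k : ℂ) * (((Real.exp (-(t - s) * σ) : ℝ) : ℂ) *
      ∫ r in s..t, ((Real.exp ((r - s) * σ) : ℝ) : ℂ) * μ r k)) (Icc s T) :=
    continuousOn_const.mul (ContinuousOn.mul (by fun_prop) hc)
  refine h1.congr fun t ht => ?_
  simp only [volterra]
  congr 1
  rw [← intervalIntegral.integral_const_mul]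
  refine intervalIntegral.integral_congr fun r _ => ?_
  rw [← mul_assoc, ← Complex.ofReal_mul, ← Real.exp_add]
  congr 3; rw [hσ]; ring

lemma volterra_neg (hμ : ∀ r k, μ r (-k) = conj (μ r k)) {t : ℝ} (hst : s ≤ t) (k : ℤ × ℤ) :
    volterra L₁ L₂ μ s lam t (-k) = conj (volterra L₁ L₂ μ s lam t k) := by
  rw [volterra, volterra, map_mul, Complex.conj_ofReal, weight_neg,
    intervalIntegral.integral_of_le hst, intervalIntegral.integral_of_le hst, ← integral_conj]
  simp only [hμ, map_mul, Complex.conj_ofReal, kappaSq_neg]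

lemma volterra_sub {ν : ℝ → ℤ × ℤ → ℂ} {B' : ℝ} (hμ : IsBoundedForcing μ s T B)
    (hν : IsBoundedForcing ν s T B') {t : ℝ} (ht : t ∈ Icc s T) (k : ℤ × ℤ) :
    volterra L₁ L₂ (fun r k => μ r k - ν r k) s lam t k =
      volterra L₁ L₂ μ s lam t k - volterra L₁ L₂ ν s lam t k := by
  simp only [volterra, mul_sub]
  rw [intervalIntegral.integral_sub, mul_sub]
  · exact ((hμ.mono ht.2).intervalIntegrable ht.1 k).continuousOn_mul (by fun_prop)
  · exact ((hν.mono ht.2).intervalIntegrable ht.1 k).continuousOn_mul (by fun_prop)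

end Volterra

/-! ### Existence for the linear equation -/

/-- The operator `(1 + Δ²)^{-1/2}`. -/
def smoothing (g : L2 L₁ L₂) : L2 L₁ L₂ := multiplier (fun k => ((weight L₁ L₂ k)⁻¹ : ℝ)) g

lemma one_le_weight (k : ℤ × ℤ) : 1 ≤ weight L₁ L₂ k :=
  Real.one_le_sqrt.2 (le_add_of_nonneg_right (sq_nonneg _))

lemma coeff_smoothing (g : L2 L₁ L₂) (k : ℤ × ℤ) :
    coeff (smoothing g) k = ((weight L₁ L₂ k)⁻¹ : ℝ) * coeff g k := by
  refine coeff_multiplier (m := fun k => (((weight L₁ L₂ k)⁻¹ : ℝ) : ℂ))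
    (exists_isMultiplierImage (fun k => by rw [weight_neg, Complex.conj_ofReal]) ?_) k
  refine (hasSum_norm_coeff_sq g).summable.of_nonneg_of_le (fun k => sq_nonneg _) fun k => ?_
  rw [norm_mul, mul_pow, Complex.norm_real, Real.norm_of_nonneg (inv_nonneg.2 (weight_pos k).le)]
  refine mul_le_of_le_one_left (sq_nonneg _) (pow_le_one₀ (inv_nonneg.2 (weight_pos k).le) ?_)
  exact inv_le_one_of_one_le₀ (one_le_weight k)

/-- All of 1, κ², κ⁴ are at most 1 + κ⁴ = `weight`², so `smoothing` maps `L²` into H² with norm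
control. -/
lemma wsum_smoothing_le (g : L2 L₁ L₂) {n : ℕ} (hn : n ≤ 2) :
    (Summable fun k => kappaSq L₁ L₂ k ^ n * ‖coeff (smoothing g) k‖ ^ 2) ∧
      wsum L₁ L₂ n (coeff (smoothing g)) ≤ (area L₁ L₂)⁻¹ * ‖g‖ ^ 2 := by
  have hs := hasSum_norm_coeff_sq g
  have hle : ∀ k, kappaSq L₁ L₂ k ^ n * ‖coeff (smoothing g) k‖ ^ 2 ≤ ‖coeff g k‖ ^ 2 := by
    intro k
    rw [coeff_smoothing, norm_mul, mul_pow, Complex.norm_real,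
      Real.norm_of_nonneg (inv_nonneg.2 (weight_pos k).le), ← mul_assoc, inv_pow, weight_sq]
    refine mul_le_of_le_one_left (sq_nonneg _) ?_
    rw [← div_eq_mul_inv, div_le_one (by positivity)]
    have h0 := kappaSq_nonneg (L₁ := L₁) (L₂ := L₂) k
    interval_cases n
    · nlinarith
    · nlinarith [sq_nonneg (kappaSq L₁ L₂ k - 1)]
    · linarith
  have h1 := hs.summable.of_nonneg_of_le
    (fun k => mul_nonneg (pow_nonneg (kappaSq_nonneg k) n) (sq_nonneg _)) hle
  refine ⟨h1, ?_⟩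
  rw [← hs.tsum_eq]
  exact h1.tsum_le_tsum hle hs.summable

lemma inH2_smoothing (g : L2 L₁ L₂) : InH2 L₁ L₂ (coeff (smoothing g)) :=
  ⟨(hasSum_norm_coeff_sq _).summable, (wsum_smoothing_le g le_rfl).1⟩

lemma smoothing_sub (f g : L2 L₁ L₂) : smoothing (f - g) = smoothing f - smoothing g :=
  L2_ext fun k => by simp only [coeff_sub_L2, coeff_smoothing]; ring

lemma continuous_smoothing : Continuous (smoothing : L2 L₁ L₂ → L2 L₁ L₂) := by
  refine (LipschitzWith.of_dist_le_mul (K := 1) fun f g => ?_).continuous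
  rw [dist_eq_norm, dist_eq_norm, ← smoothing_sub, NNReal.coe_one, one_mul]
  refine abs_le_of_sq_le_sq' ?_ (norm_nonneg _) |>.2
  rw [norm_sq_eq_wsum]
  have h := (wsum_smoothing_le (f - g) (n := 0) (by norm_num)).2
  have := mul_le_mul_of_nonneg_left h (area_pos (L₁ := L₁) (L₂ := L₂)).le
  rwa [mul_inv_cancel_left₀ area_pos.ne'] at this

section Linear

variable {v : ℝ → Torus L₁ L₂ → ℝ × ℝ} {s T K : ℝ}

lemma isBoundedForcing_advect (hv : IsAdmissibleVelocity v)
    (hK : ∀ᵐ r ∂(volume.restrict (Ici (0 : ℝ))), IsBoundedDivFree K (v r)) (hs : 0 ≤ s)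
    {u : ℝ → L2 L₁ L₂} (hu : ContinuousOn u (Icc s T)) {W : ℝ}
    (hW : ∀ r ∈ Icc s T, MemH1 (u r) ∧ wsum L₁ L₂ 1 (coeff (u r)) ≤ W) :
    IsBoundedForcing (fun r k => coeff (advect (v r) (u r)) k) s T (2 * K ^ 2 * W) where
  measurable k := hv.aestronglyMeasurable_advect hs hu (fun r hr => (hW r hr).1) k
  bound := by
    filter_upwards [ae_restrict_Ioc_of_Ici hs hK, ae_restrict_mem measurableSet_Ioc] with r hr hrI
    have h := hW r (Ioc_subset_Icc_self hrI)
    have h1 := hr.tsum_advect_le h.1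
    exact ⟨h1.1, h1.2.trans (mul_le_mul_of_nonneg_left h.2 (by positivity))⟩

/-- A path with prescribed Fourier coefficients, which are the sum of those of the free evolution
and of a solution of the inhomogeneous equation. -/
lemma exists_path_of_forcing {μ : ℝ → ℤ × ℤ → ℂ} {B lam : ℝ} (hμ : IsBoundedForcing μ s T B)
    (hconj : ∀ r k, μ r (-k) = conj (μ r k)) (hlam : 1 ≤ lam) (hsT : s ≤ T)
    {f₀ : L2 L₁ L₂} (hf₀ : InH2 L₁ L₂ (coeff f₀)) :
    ∃ G : ℝ →ᵇ L2 L₁ L₂, ∀ t k, coeff (G t) k =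
      (Real.exp (-(max s (min t T) - s) * (kappaSq L₁ L₂ k ^ 2 + lam)) : ℝ) *
        (weight L₁ L₂ k * coeff f₀ k) - volterra L₁ L₂ μ s lam (max s (min t T)) k := by
  set y : ℝ → ℤ × ℤ → ℂ := fun t k =>
    (Real.exp (-(t - s) * (kappaSq L₁ L₂ k ^ 2 + lam)) : ℝ) *
        (weight L₁ L₂ k * coeff f₀ k) - volterra L₁ L₂ μ s lam t k with hy
  obtain ⟨d, hd, hdle⟩ := hμ.exists_summable_bound (L₁ := L₁) (L₂ := L₂) hlam hsT
  -- A summable majorant of the squared coefficients that is uniform in time; it gives existence,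
  -- the bound, and continuity by dominated convergence.
  set D : ℤ × ℤ → ℝ := fun k => 2 * (‖coeff f₀ k‖ ^ 2 +
    kappaSq L₁ L₂ k ^ 2 * ‖coeff f₀ k‖ ^ 2) + 2 * d k with hD
  have hDs : Summable D := ((hf₀.1.add hf₀.2).mul_left 2).add (hd.mul_left 2)
  have hyD : ∀ t ∈ Icc s T, ∀ k, ‖y t k‖ ^ 2 ≤ D k := by
    intro t ht k
    have h1 : ‖((Real.exp (-(t - s) * (kappaSq L₁ L₂ k ^ 2 + lam)) : ℝ) : ℂ) *
        (weight L₁ L₂ k * coeff f₀ k)‖ ^ 2 ≤ ‖coeff f₀ k‖ ^ 2 +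
          kappaSq L₁ L₂ k ^ 2 * ‖coeff f₀ k‖ ^ 2 := by
      rw [norm_mul, norm_mul, Complex.norm_real, Complex.norm_real, mul_pow, mul_pow,
        Real.norm_of_nonneg (weight_pos k).le, weight_sq, Real.norm_of_nonneg (Real.exp_pos _).le]
      have h2 : Real.exp (-(t - s) * (kappaSq L₁ L₂ k ^ 2 + lam)) ^ 2 ≤ 1 := by
        refine pow_le_one₀ (Real.exp_pos _).le ?_
        rw [Real.exp_le_one_iff]
        have : 0 ≤ kappaSq L₁ L₂ k ^ 2 + lam := by positivity
        nlinarith [ht.1]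
      calc _ ≤ 1 * ((1 + kappaSq L₁ L₂ k ^ 2) * ‖coeff f₀ k‖ ^ 2) := by gcongr
        _ = _ := by ring
    have h3 := pow_le_pow_left₀ (norm_nonneg _) (norm_sub_le
      (((Real.exp (-(t - s) * (kappaSq L₁ L₂ k ^ 2 + lam)) : ℝ) : ℂ) *
        (weight L₁ L₂ k * coeff f₀ k)) (volterra L₁ L₂ μ s lam t k)) 2
    have h5 := hdle t ht k
    simp only [hD, hy]
    nlinarith [sq_nonneg (‖((Real.exp (-(t - s) * (kappaSq L₁ L₂ k ^ 2 + lam)) : ℝ) : ℂ) *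
        (weight L₁ L₂ k * coeff f₀ k)‖ - ‖volterra L₁ L₂ μ s lam t k‖)]
  -- Clamping time to [s, T] extends the path to the whole line by constants, so that the fixed
  -- point can be sought among bounded continuous functions on ℝ.
  have hcl : ∀ t, max s (min t T) ∈ Icc s T := fun t =>
    ⟨le_max_left _ _, max_le hsT (min_le_right _ _)⟩
  have hex : ∀ t, ∃ g : L2 L₁ L₂, ∀ k, coeff g k = y (max s (min t T)) k := by
    intro t
    refine exists_L2_coeff_eq _ (hDs.of_nonneg_of_le (fun k => sq_nonneg _) (hyD _ (hcl t))) ?_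
    intro k
    simp only [hy, volterra_neg hconj (hcl t).1, kappaSq_neg, weight_neg, coeff_neg, map_sub,
      map_mul, Complex.conj_ofReal]
  choose Ψ hΨ using hex
  have hyc : ∀ k, Continuous fun t => y (max s (min t T)) k := by
    intro k
    have h1 : ContinuousOn (fun t => y t k) (Icc s T) := by
      simp only [hy]
      exact ContinuousOn.sub (by fun_prop) (hμ.continuousOn_volterra hsT k)
    exact h1.comp_continuous (by fun_prop) hcl
  have hcont : Continuous Ψ := by
    rw [continuous_iff_continuousAt]
    intro t₀
    rw [ContinuousAt, tendsto_iff_norm_sub_tendsto_zero]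
    have h1 : Filter.Tendsto (fun t => ∑' k, ‖coeff (Ψ t - Ψ t₀ : L2 L₁ L₂) k‖ ^ 2) (nhds t₀)
        (nhds (∑' _ : ℤ × ℤ, (0 : ℝ))) := by
      refine tendsto_tsum_of_dominated_convergence (hDs.mul_left 4) (fun k => ?_) ?_
      · have h2 := ((hyc k).sub (continuous_const (y := y (max s (min t₀ T)) k))).norm.pow 2
        have h3 := h2.tendsto' t₀ 0 (by simp)
        refine h3.congr fun t => ?_
        rw [coeff_sub_L2, hΨ, hΨ]
        rfl
      · refine Filter.Eventually.of_forall fun t k => ?_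
        rw [Real.norm_of_nonneg (sq_nonneg _), coeff_sub_L2, hΨ, hΨ]
        have h2 := pow_le_pow_left₀ (norm_nonneg _) (norm_sub_le (y (max s (min t T)) k)
          (y (max s (min t₀ T)) k)) 2
        nlinarith [hyD _ (hcl t) k, hyD _ (hcl t₀) k,
          sq_nonneg (‖y (max s (min t T)) k‖ - ‖y (max s (min t₀ T)) k‖)]
    rw [tsum_zero] at h1
    have h2 := (h1.const_mul (area L₁ L₂)).sqrt
    rw [mul_zero, Real.sqrt_zero] at h2
    refine h2.congr fun t => ?_
    rw [← norm_sq_eq_tsum, Real.sqrt_sq (norm_nonneg _)]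
  refine ⟨BoundedContinuousFunction.ofNormedAddCommGroup Ψ hcont (√(area L₁ L₂ * ∑' k, D k))
    fun t => ?_, fun t k => hΨ t k⟩
  refine Real.le_sqrt_of_sq_le ?_
  rw [norm_sq_eq_tsum]
  refine mul_le_mul_of_nonneg_left ?_ area_pos.le
  refine (hasSum_norm_coeff_sq (Ψ t)).summable.tsum_le_tsum (fun k => ?_) hDs
  rw [hΨ]
  exact hyD _ (hcl t) k

/-- The weighted and damped equation has a solution. -/
lemma exists_fixed_path (hv : IsAdmissibleVelocity v)
    (hK : ∀ᵐ r ∂(volume.restrict (Ici (0 : ℝ))), IsBoundedDivFree K (v r)) (hs : 0 ≤ s)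
    (hsT : s ≤ T) {f₀ : L2 L₁ L₂} (hf₀ : InH2 L₁ L₂ (coeff f₀)) {lam : ℝ}
    (hlam : 8 * K ^ 2 + 1 ≤ lam) :
    ∃ G : ℝ →ᵇ L2 L₁ L₂, ∀ t ∈ Icc s T, ∀ k, coeff (G t) k =
      (Real.exp (-(t - s) * (kappaSq L₁ L₂ k ^ 2 + lam)) : ℝ) *
        (weight L₁ L₂ k * coeff f₀ k) -
      volterra L₁ L₂ (fun r k => coeff (advect (v r) (smoothing (G r))) k) s lam t k := by
  have hlam1 : 1 ≤ lam := le_trans (le_add_of_nonneg_left (by positivity)) hlam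
  have hlam0 : 0 < lam := by linarith
  have hA := area_pos (L₁ := L₁) (L₂ := L₂)
  have hforce : ∀ g : ℝ →ᵇ L2 L₁ L₂, IsBoundedForcing
      (fun r k => coeff (advect (v r) (smoothing (g r))) k) s T
      (2 * K ^ 2 * ((area L₁ L₂)⁻¹ * ‖g‖ ^ 2)) := by
    intro g
    refine isBoundedForcing_advect hv hK hs (continuous_smoothing.comp g.continuous).continuousOn
      fun r _ => ⟨(inH2_smoothing _).memH1, (wsum_smoothing_le _ (by norm_num)).2.trans ?_⟩
    have := g.norm_coe_le_norm r
    gcongr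
  choose Φ hΦ using fun g => exists_path_of_forcing (hforce g) (fun r k => coeff_neg _ k) hlam1
    hsT hf₀
  have hdiff : ∀ g g' : ℝ →ᵇ L2 L₁ L₂, IsBoundedForcing
      (fun r k => coeff (advect (v r) (smoothing (g r))) k -
        coeff (advect (v r) (smoothing (g' r))) k) s T
      (2 * K ^ 2 * ((area L₁ L₂)⁻¹ * ‖g - g'‖ ^ 2)) := by
    intro g g'
    refine ⟨fun k => ((hforce g).measurable k).sub ((hforce g').measurable k), ?_⟩
    filter_upwards [(hforce (g - g')).bound, ae_restrict_Ioc_of_Ici hs hK] with r h1 h2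
    have e : ∀ k, coeff (advect (v r) (smoothing ((g - g') r))) k =
        coeff (advect (v r) (smoothing (g r))) k - coeff (advect (v r) (smoothing (g' r))) k := by
      intro k
      have h3 := (inH2_smoothing ((g - g') r)).memH1
      rw [BoundedContinuousFunction.sub_apply, smoothing_sub] at h3 ⊢
      exact h2.coeff_advect_sub (inH2_smoothing _).memH1 (inH2_smoothing _).memH1 h3 k
    simpa only [e] using h1
  -- Squared distances shrink by 2 K² / lam ≤ 1/4, thanks to lam ≥ 8 K² + 1.
  have hlip : ContractingWith (1 / 2) Φ := by
    refine ⟨by norm_num [← NNReal.coe_lt_coe], LipschitzWith.of_dist_le_mul fun g g' => ?_⟩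
    rw [BoundedContinuousFunction.dist_le (by positivity)]
    intro t
    have ht : max s (min t T) ∈ Icc s T := ⟨le_max_left _ _, max_le hsT (min_le_right _ _)⟩
    rw [dist_eq_norm, dist_eq_norm]
    refine abs_le_of_sq_le_sq' ?_ (by positivity) |>.2
    rw [norm_sq_eq_tsum]
    have e : ∀ k, ‖coeff (Φ g t - Φ g' t : L2 L₁ L₂) k‖ ^ 2 = ‖volterra L₁ L₂
        (fun r k => coeff (advect (v r) (smoothing (g r))) k -
        coeff (advect (v r) (smoothing (g' r))) k) s lam (max s (min t T)) k‖ ^ 2 := by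
      intro k
      rw [coeff_sub_L2, hΦ, hΦ, volterra_sub (hforce g) (hforce g') ht, ← norm_neg]
      congr 2; ring
    simp only [e]
    have h1 := ((hdiff g g').tsum_volterra_le (L₁ := L₁) (L₂ := L₂) (by positivity) hlam1 ht).2
    calc _ ≤ area L₁ L₂ * (2 * K ^ 2 * ((area L₁ L₂)⁻¹ * ‖g - g'‖ ^ 2) / lam) :=
          mul_le_mul_of_nonneg_left h1 hA.le
      _ = (2 * K ^ 2 / lam) * ‖g - g'‖ ^ 2 := by field_simp
      _ ≤ (1 / 4) * ‖g - g'‖ ^ 2 := by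
          refine mul_le_mul_of_nonneg_right ?_ (sq_nonneg _)
          rw [div_le_div_iff₀ hlam0 (by norm_num)]; linarith
      _ = (((1 / 2 : NNReal) : ℝ) * ‖g - g'‖) ^ 2 := by push_cast; ring
  refine ⟨hlip.fixedPoint Φ, fun t ht k => ?_⟩
  have h1 := hΦ (hlip.fixedPoint Φ) t k
  rw [hlip.fixedPoint_isFixedPt.eq] at h1
  rwa [min_eq_left ht.2, max_eq_right ht.1] at h1

/-- The linear equation has a solution for initial values in `H²`. -/
theorem exists_isAdvHypSolution (hv : IsAdmissibleVelocity v) (hs : 0 ≤ s) (hsT : s ≤ T)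
    {f₀ : L2 L₁ L₂} (hf₀ : InH2 L₁ L₂ (coeff f₀)) :
    ∃ f, IsAdvHypSolution v s T f₀ f ∧ ∃ M, IsH2Path f s T M := by
  obtain ⟨K, hK0, hK⟩ := hv.exists_bound
  set lam := 8 * K ^ 2 + 1 with hlam
  obtain ⟨G, hG⟩ := exists_fixed_path hv hK hs hsT hf₀ (lam := lam) le_rfl
  have hA := area_pos (L₁ := L₁) (L₂ := L₂)
  have hσ := isParabolicSymbol_bilaplacian (L₁ := L₁) (L₂ := L₂)
  -- Undoes both changes of variables: `smoothing` removes the weight, and the exponential removes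
  -- the damping.
  set f : ℝ → L2 L₁ L₂ := fun t => Real.exp (lam * (t - s)) • smoothing (G t) with hf
  have hfc : Continuous f := by
    have := continuous_smoothing.comp G.continuous
    have h1 : Continuous fun t => Real.exp (lam * (t - s)) := by fun_prop
    exact h1.smul this
  have hcoeff : ∀ t k, coeff (f t) k = (Real.exp (lam * (t - s)) : ℝ) * coeff (smoothing (G t)) k :=
    fun t k => coeff_smul_L2 _ _ _
  have hwsum : ∀ n ≤ 2, ∀ t, (Summable fun k => kappaSq L₁ L₂ k ^ n * ‖coeff (f t) k‖ ^ 2) ∧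
      wsum L₁ L₂ n (coeff (f t)) = Real.exp (lam * (t - s)) ^ 2 *
        wsum L₁ L₂ n (coeff (smoothing (G t))) := by
    intro n hn t
    have e : ∀ k, kappaSq L₁ L₂ k ^ n * ‖coeff (f t) k‖ ^ 2 = Real.exp (lam * (t - s)) ^ 2 *
        (kappaSq L₁ L₂ k ^ n * ‖coeff (smoothing (G t)) k‖ ^ 2) := by
      intro k
      rw [hcoeff, norm_mul, Complex.norm_real, Real.norm_of_nonneg (Real.exp_pos _).le]; ring
    simp only [wsum, e]
    exact ⟨(wsum_smoothing_le _ hn).1.mul_left _, tsum_mul_left⟩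
  set M := Real.exp (lam * (T - s)) ^ 2 * ((area L₁ L₂)⁻¹ * ‖G‖ ^ 2) with hM
  have hM0 : 0 ≤ M := by positivity
  have hlam0 : 0 ≤ lam := by positivity
  have hwM : ∀ n ≤ 2, ∀ t ∈ Icc s T, wsum L₁ L₂ n (coeff (f t)) ≤ M := by
    intro n hn t ht
    rw [(hwsum n hn t).2]
    have h1 := (wsum_smoothing_le (G t) hn).2
    have h2 := G.norm_coe_le_norm t
    have h3 := ht.2
    calc _ ≤ Real.exp (lam * (t - s)) ^ 2 * ((area L₁ L₂)⁻¹ * ‖G t‖ ^ 2) := by gcongr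
      _ ≤ M := by rw [hM]; gcongr
  have hInH2 : ∀ t, InH2 L₁ L₂ (coeff (f t)) := fun t =>
    ⟨(hasSum_norm_coeff_sq _).summable, (hwsum 2 le_rfl t).1⟩
  have hpath : IsH2Path f s T M := ⟨hfc.continuousOn, fun t _ => hInH2 t,
    hwM 0 (by norm_num), hwM 2 le_rfl⟩
  have hforce : IsBoundedForcing (fun r k => coeff (advect (v r) (f r)) k) s T (2 * K ^ 2 * M) :=
    isBoundedForcing_advect hv hK hs hfc.continuousOn fun r hr =>
      ⟨(hInH2 r).memH1, hwM 1 (by norm_num) r hr⟩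
  have hint : ∀ t ∈ Icc s T, IntervalIntegrable
      (fun r => semigroup (fun k => kappaSq L₁ L₂ k ^ 2) (t - r) (advect (v r) (f r)))
      volume s t := by
    intro t ht
    have hlt : ∀ᵐ r ∂(volume.restrict (Ioc s t)), r < t := by
      rw [ae_restrict_iff' measurableSet_Ioc]
      filter_upwards [Measure.ae_ne volume t] with r hr hrI
      exact lt_of_le_of_ne hrI.2 hr
    refine intervalIntegrable_of_bound (C := √(area L₁ L₂ * (2 * K ^ 2 * M))) ht.1 ?_ ?_
    · refine aestronglyMeasurable_L2 fun k => ?_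
      have h1 : AEStronglyMeasurable (fun r => ((Real.exp (-(t - r) * kappaSq L₁ L₂ k ^ 2) : ℝ) : ℂ)
          * coeff (advect (v r) (f r)) k) (volume.restrict (Ioc s t)) :=
        AEStronglyMeasurable.mul (Continuous.aestronglyMeasurable (by fun_prop))
          ((hforce.mono ht.2).measurable k)
      refine h1.congr ?_
      filter_upwards [hlt] with r hr
      exact (hσ.coeff_semigroup (sub_pos.2 hr) _ k).symm
    · filter_upwards [hlt, (hforce.mono ht.2).bound] with r hr h1
      refine Real.le_sqrt_of_sq_le ?_
      rw [norm_sq_eq_tsum]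
      refine mul_le_mul_of_nonneg_left (le_trans ?_ h1.2) hA.le
      refine (hasSum_norm_coeff_sq _).summable.tsum_le_tsum (fun k => ?_) h1.1
      rw [hσ.coeff_semigroup (sub_pos.2 hr), norm_mul, mul_pow, Complex.norm_real,
        Real.norm_of_nonneg (Real.exp_pos _).le]
      refine mul_le_of_le_one_left (sq_nonneg _) (pow_le_one₀ (Real.exp_pos _).le ?_)
      rw [Real.exp_le_one_iff]
      have : 0 ≤ kappaSq L₁ L₂ k ^ 2 := sq_nonneg _
      nlinarith [sub_pos.2 hr]
  refine ⟨f, ⟨hfc.continuousOn, fun t _ => (hInH2 t).memH1, ?_, hint, fun t ht => ?_⟩, M, hpath⟩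
  · refine ⟨(T - s) ^ (1 / 4 : ℝ) * √(area L₁ L₂ * M), fun t ht => ?_⟩
    have ht' := Ioc_subset_Icc_self ht
    have h1 : (t - s) ^ (1 / 4 : ℝ) ≤ (T - s) ^ (1 / 4 : ℝ) :=
      Real.rpow_le_rpow (sub_nonneg.2 ht'.1) (by linarith [ht.2]) (by norm_num)
    have h2 : gradNorm (f t) ≤ √(area L₁ L₂ * M) := by
      refine Real.le_sqrt_of_sq_le ?_
      rw [(hInH2 t).memH1.gradNorm_sq]
      exact mul_le_mul_of_nonneg_left (hwM 1 (by norm_num) t ht') hA.le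
    exact mul_le_mul h1 h2 (Real.sqrt_nonneg _)
      (Real.rpow_nonneg (sub_nonneg.2 (ht'.1.trans ht'.2)) _)
  · refine L2_ext fun k => ?_
    rw [coeff_sub_L2, hσ.coeff_semigroup_L2 (sub_nonneg.2 ht.1), ← coeffCLM_apply k (∫ r in s..t, _),
      ← ContinuousLinearMap.intervalIntegral_comp_comm _ (hint t ht)]
    have e1 : ∫ r in s..t, coeffCLM k (semigroup (fun k => kappaSq L₁ L₂ k ^ 2) (t - r)
        (advect (v r) (f r))) = ∫ r in s..t, (Real.exp (lam * (t - s)) : ℂ) *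
          ((Real.exp (-(t - r) * (kappaSq L₁ L₂ k ^ 2 + lam)) : ℝ) *
            coeff (advect (v r) (smoothing (G r))) k) := by
      refine intervalIntegral.integral_congr_ae ?_
      filter_upwards [Measure.ae_ne volume t] with r hr hrI
      rw [uIoc_of_le ht.1] at hrI
      rw [coeffCLM_apply, hσ.coeff_semigroup (sub_pos.2 (lt_of_le_of_ne hrI.2 hr)),
        coeff_congr_ae (advect_smul (v r) (hInH2 r).memH1 (inH2_smoothing (G r)).memH1 _ rfl),
        coeff_const_mul, ← mul_assoc, ← mul_assoc, ← Complex.ofReal_mul,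
        ← Complex.ofReal_mul, ← Real.exp_add, ← Real.exp_add]
      congr 3; ring
    have hw : (weight L₁ L₂ k : ℂ) ≠ 0 := by exact_mod_cast (weight_pos k).ne'
    have e2 : (Real.exp (lam * (t - s)) : ℂ) *
        (Real.exp (-(t - s) * (kappaSq L₁ L₂ k ^ 2 + lam)) : ℝ) =
        (Real.exp (-(t - s) * kappaSq L₁ L₂ k ^ 2) : ℝ) := by
      rw [← Complex.ofReal_mul, ← Real.exp_add]
      congr 2; ring
    rw [e1, intervalIntegral.integral_const_mul, hcoeff, coeff_smoothing, hG t ht, volterra,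
      ← e2, Complex.ofReal_inv]
    field_simp

end Linear

/-! ### The mean-free part of a solution -/

/-- X, E, D are the sums with weights 1, κ², κ⁴, and S = ∑ ‖a k‖. The term 2E comes from -Δψ, the
term E S from the nonlinearity; Young's inequality pays for both with one unit of D. -/
lemma dissipation_le {X D E S Λ : ℝ} (hX : 0 ≤ X) (hD : 0 ≤ D) (hE : E ^ 2 ≤ X * D) (hS : 0 ≤ S)
    (hS2 : S ^ 2 ≤ Λ * (√X * √D)) :
    -2 * D + 2 * E + E * S ≤ -D + (2 * X + Λ ^ 2 * X ^ 3) := by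
  obtain ⟨x, hx0, rfl⟩ : ∃ x, 0 ≤ x ∧ X = x ^ 2 := ⟨√X, Real.sqrt_nonneg _, (Real.sq_sqrt hX).symm⟩
  obtain ⟨d, hd0, rfl⟩ : ∃ d, 0 ≤ d ∧ D = d ^ 2 := ⟨√D, Real.sqrt_nonneg _, (Real.sq_sqrt hD).symm⟩
  rw [Real.sqrt_sq hx0, Real.sqrt_sq hd0] at hS2
  have hE' : E ≤ x * d := abs_le_of_sq_le_sq' (by linarith [mul_pow x d 2]) (by positivity) |>.2
  have h1 : E * S ≤ x * d * S := mul_le_mul_of_nonneg_right hE' hS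
  have h2 : x * d * S ≤ d ^ 2 / 4 + x ^ 2 * S ^ 2 := by linarith [sq_nonneg (d / 2 - x * S)]
  have h3 : x ^ 2 * S ^ 2 ≤ x ^ 2 * (Λ * (x * d)) := mul_le_mul_of_nonneg_left hS2 (sq_nonneg x)
  have h4 : x ^ 2 * (Λ * (x * d)) ≤ d ^ 2 / 4 + Λ ^ 2 * (x ^ 2) ^ 3 := by
    linarith [sq_nonneg (d / 2 - Λ * x ^ 3)]
  linarith [sq_nonneg (d - 2 * x)]

/-- Y and W are the sums with weights 1 and κ⁴ for the difference of the two solutions, X, E, D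
those of ψ. All of W is absorbed, and only D/64 is used: as ∫ D ≤ 2b over one step, this costs b/32.
-/
lemma dissipation_sub_le {X D E S Λ Y W : ℝ} (hX : 0 ≤ X) (hD : 0 ≤ D) (hE : E ^ 2 ≤ X * D)
    (hY : 0 ≤ Y) (hW : 0 ≤ W) (hS : 0 ≤ S) (hS2 : S ^ 2 ≤ Λ * (√Y * √W)) :
    -2 * W + 2 * (√W * √X) + E * S ≤ 1 / 64 * D + (X + 64 * Λ ^ 2 * X ^ 2 * Y) := by
  obtain ⟨x, hx0, rfl⟩ : ∃ x, 0 ≤ x ∧ X = x ^ 2 := ⟨√X, Real.sqrt_nonneg _, (Real.sq_sqrt hX).symm⟩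
  obtain ⟨d, hd0, rfl⟩ : ∃ d, 0 ≤ d ∧ D = d ^ 2 := ⟨√D, Real.sqrt_nonneg _, (Real.sq_sqrt hD).symm⟩
  obtain ⟨y, hy0, rfl⟩ : ∃ y, 0 ≤ y ∧ Y = y ^ 2 := ⟨√Y, Real.sqrt_nonneg _, (Real.sq_sqrt hY).symm⟩
  obtain ⟨e, he0, rfl⟩ : ∃ e, 0 ≤ e ∧ W = e ^ 2 := ⟨√W, Real.sqrt_nonneg _, (Real.sq_sqrt hW).symm⟩
  rw [Real.sqrt_sq hy0, Real.sqrt_sq he0] at hS2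
  rw [Real.sqrt_sq hx0, Real.sqrt_sq he0]
  have hE' : E ≤ x * d := abs_le_of_sq_le_sq' (by linarith [mul_pow x d 2]) (by positivity) |>.2
  have h1 : E * S ≤ x * d * S := mul_le_mul_of_nonneg_right hE' hS
  have h2 : x * d * S ≤ 1 / 64 * d ^ 2 + 16 * (x ^ 2 * S ^ 2) := by
    linarith [sq_nonneg (d / 8 - 4 * (x * S))]
  have h3 : x ^ 2 * S ^ 2 ≤ x ^ 2 * (Λ * (y * e)) := mul_le_mul_of_nonneg_left hS2 (sq_nonneg x)
  have h4 : 16 * (x ^ 2 * (Λ * (y * e))) ≤ e ^ 2 + 64 * Λ ^ 2 * (x ^ 2) ^ 2 * y ^ 2 := by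
    linarith [sq_nonneg (e - 8 * (Λ * x ^ 2 * y))]
  linarith [sq_nonneg (e - x)]

/-- The nonlinearity `½ |∇ f|²` without its average, on the Fourier side. -/
def nonlin (f : L2 L₁ L₂) (k : ℤ × ℤ) : ℂ :=
  if k = 0 then 0 else coeff (fun x => 1 / 2 * gradSq f x) k

lemma norm_nonlin_le {f : L2 L₁ L₂} (h : MemH1 f) (k : ℤ × ℤ) :
    ‖nonlin f k‖ ≤ 1 / 2 * wsum L₁ L₂ 1 (coeff f) := by
  rw [nonlin]
  split_ifs
  · rw [norm_zero]
    have := wsum_nonneg (L₁ := L₁) (L₂ := L₂) 1 (coeff f)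
    positivity
  · exact h.norm_coeff_gradSq_le k

/-- `ψ` is a path in `H²` of mean-free functions, and solves the equation for the mean-free part of
a solution of the Kuramoto-Sivashinsky equation with advection. -/
structure IsMeanFreeSolution (v : ℝ → Torus L₁ L₂ → ℝ × ℝ) (s T M : ℝ) (ψ : ℝ → L2 L₁ L₂) :
    Prop where
  path : IsH2Path ψ s T M
  coeff_zero : ∀ r ∈ Icc s T, coeff (ψ r) 0 = 0
  modes : ∃ g : ℤ × ℤ → ℝ → ℂ, (∀ k, IntervalIntegrable (g k) volume s T) ∧
    (∀ k, ∀ r ∈ Icc s T, coeff (ψ r) k = coeff (ψ s) k - ∫ x in s..r, g k x) ∧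
    ∀ᵐ r ∂(volume.restrict (Ioc s T)), ∀ k, g k r = (kappaSq L₁ L₂ k ^ 2 : ℝ) * coeff (ψ r) k +
      (coeff (advect (v r) (ψ r)) k - (kappaSq L₁ L₂ k : ℝ) * coeff (ψ r) k) + nonlin (ψ r) k

section

variable {v : ℝ → Torus L₁ L₂ → ℝ × ℝ} {s t T M K b τ : ℝ} {ψ : ℝ → L2 L₁ L₂}

lemma IsMeanFreeSolution.mono (h : IsMeanFreeSolution v s T M ψ) {s' T' : ℝ} (hs : s ≤ s')
    (hsT' : s' ≤ T') (hT : T' ≤ T) : IsMeanFreeSolution v s' T' M ψ := by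
  obtain ⟨g, hg, hψ, hgr⟩ := h.modes
  have hs' : s' ∈ Icc s T := ⟨hs, hsT'.trans hT⟩
  have hT' : T' ∈ Icc s T := ⟨hs.trans hsT', hT⟩
  have hsT : s ≤ T := hs.trans hs'.2
  refine ⟨h.path.mono hs hT, fun r hr => h.coeff_zero r ⟨hs.trans hr.1, hr.2.trans hT⟩, g,
    fun k => intervalIntegrable_of_Icc_subset (hg k) hs' hT', fun k r hr => ?_,
    ae_restrict_of_ae_restrict_of_subset (Ioc_subset_Ioc hs hT) hgr⟩
  have hr' : r ∈ Icc s T := ⟨hs.trans hr.1, hr.2.trans hT⟩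
  rw [hψ k r hr', hψ k s' hs', sub_sub, intervalIntegral.integral_add_adjacent_intervals
    (intervalIntegrable_of_Icc_subset (hg k) (left_mem_Icc.2 hsT) hs')
    (intervalIntegrable_of_Icc_subset (hg k) hs' hr')]

/-- Transport and nonlinearity see only the gradient, which is the same for φ and its mean-free
part; the equation is unchanged in every mode except 0, which is set to zero. -/
lemma IsAKSSolution.isMeanFreeSolution {φ₀ : L2 L₁ L₂} {φ : ℝ → L2 L₁ L₂}
    (hv : IsAdmissibleVelocity v) (h : IsAKSSolution v T φ₀ φ) (hs : 0 < s) (hsT : s ≤ T) :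
    ∃ M, IsMeanFreeSolution v s T M fun r => meanFreePart (φ r) := by
  obtain ⟨M, hM⟩ := h.exists_isH2Path hv hs hsT
  obtain ⟨K, hK0, hK⟩ := hv.exists_bound
  have hσ := isParabolicSymbol_kuramotoSivashinsky (L₁ := L₁) (L₂ := L₂)
  have hsI : s ∈ Icc 0 T := ⟨hs.le, hsT⟩
  have hT : T ∈ Icc 0 T := right_mem_Icc.2 (hs.le.trans hsT)
  refine ⟨M, hM.meanFreePart, fun r _ => by rw [coeff_meanFreePart, if_pos rfl],
    fun k r => if k = 0 then 0 else ((kappaSq L₁ L₂ k ^ 2 - kappaSq L₁ L₂ k : ℝ) : ℂ) *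
      coeff (φ r) k + coeff (fun x => 1 / 2 * gradSq (φ r) x + advect (v r) (φ r) x) k,
    fun k => ?_, fun k r hr => ?_, ?_⟩
  · by_cases hk : k = 0
    · simp only [hk, if_true]
      exact intervalIntegrable_const
    · simp only [hk, if_false]
      refine IntervalIntegrable.add (ContinuousOn.intervalIntegrable ?_)
        (intervalIntegrable_of_Icc_subset (h.intervalIntegrable_coeff hσ hT.1 k) hsI hT)
      rw [uIcc_of_le hsT]
      exact continuousOn_const.mul (continuousOn_coeff hM.continuousOn k)
  · rw [coeff_meanFreePart, coeff_meanFreePart]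
    by_cases hk : k = 0
    · simp only [hk, if_true, intervalIntegral.integral_zero, sub_zero]
    · simp only [hk, if_false]
      exact h.coeff_sub hσ k hsI hr
  · filter_upwards [ae_restrict_Ioc_of_Ici hs.le hK, ae_restrict_mem measurableSet_Ioc]
      with r hr hrI k
    have hrI' := Ioc_subset_Icc_self hrI
    have hp := partial_meanFreePart (hM.inH2 r hrI').memH1 (hM.meanFreePart.inH2 r hrI').memH1
    have e1 : advect (v r) (meanFreePart (φ r)) = advect (v r) (φ r) := by
      funext x; rw [advect, advect, hp.1, hp.2]
    have e2 : gradSq (meanFreePart (φ r)) = gradSq (φ r) := by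
      funext x; rw [gradSq, gradSq, hp.1, hp.2]
    rw [e1, coeff_meanFreePart, nonlin, e2]
    split_ifs with hk
    · rw [hk, hr.coeff_advect_zero (hM.inH2 r hrI').memH1]; simp
    · rw [hr.coeff_ks]; push_cast; ring

lemma IsH2Path.wsum_one_le (h : IsH2Path ψ s T M) {r : ℝ} (hr : r ∈ Icc s T) :
    wsum L₁ L₂ 1 (coeff (ψ r)) ≤ M := by
  have h0 := h.wsum_zero_le r hr
  have hM : 0 ≤ M := (wsum_nonneg _ _).trans h0
  refine abs_le_of_sq_le_sq' ((h.inH2 r hr).summable_one.2.trans ?_) hM |>.2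
  rw [sq]
  exact mul_le_mul h0 (h.wsum_two_le r hr) (wsum_nonneg _ _) hM

lemma tsum_norm_sub_sq_le {a c : ℤ × ℤ → ℂ} {A C : ℝ} (ha : Summable fun k => ‖a k‖ ^ 2)
    (hc : Summable fun k => ‖c k‖ ^ 2) (hA : ∑' k, ‖a k‖ ^ 2 ≤ A) (hC : ∑' k, ‖c k‖ ^ 2 ≤ C) :
    (Summable fun k => ‖a k - c k‖ ^ 2) ∧ ∑' k, ‖a k - c k‖ ^ 2 ≤ 2 * A + 2 * C := by
  have hle : ∀ k, ‖a k - c k‖ ^ 2 ≤ 2 * ‖a k‖ ^ 2 + 2 * ‖c k‖ ^ 2 := by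
    intro k
    have := pow_le_pow_left₀ (norm_nonneg _) (norm_sub_le (a k) (c k)) 2
    nlinarith [sq_nonneg (‖a k‖ - ‖c k‖)]
  have hs2 := (ha.mul_left 2).add (hc.mul_left 2)
  have hs := hs2.of_nonneg_of_le (fun k => sq_nonneg _) hle
  refine ⟨hs, (hs.tsum_le_tsum hle hs2).trans ?_⟩
  rw [(ha.mul_left 2).tsum_add (hc.mul_left 2), tsum_mul_left, tsum_mul_left]
  linarith

/-- Summability and size of `w · ∇ f + Δ ψ` on the Fourier side. -/
lemma IsBoundedDivFree.tsum_advect_sub_le {w : Torus L₁ L₂ → ℝ × ℝ} (hw : IsBoundedDivFree K w)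
    {f ψ : L2 L₁ L₂} {M' : ℝ} (hf : MemH1 f) (hψ : InH2 L₁ L₂ (coeff ψ))
    (hfM : wsum L₁ L₂ 1 (coeff f) ≤ M') (hψM : wsum L₁ L₂ 2 (coeff ψ) ≤ M) :
    (Summable fun k => ‖coeff (advect w f) k - (kappaSq L₁ L₂ k : ℝ) * coeff ψ k‖ ^ 2) ∧
      ∑' k, ‖coeff (advect w f) k - (kappaSq L₁ L₂ k : ℝ) * coeff ψ k‖ ^ 2 ≤
        2 * (2 * K ^ 2 * M') + 2 * M := by
  have h1 := hw.tsum_advect_le hf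
  have e : ∀ k, ‖((kappaSq L₁ L₂ k : ℝ) : ℂ) * coeff ψ k‖ ^ 2 =
      kappaSq L₁ L₂ k ^ 2 * ‖coeff ψ k‖ ^ 2 := fun k => by
    rw [norm_mul, mul_pow, Complex.norm_real, Real.norm_eq_abs, sq_abs]
  refine tsum_norm_sub_sq_le h1.1 (by simpa only [e] using hψ.2)
    (h1.2.trans (mul_le_mul_of_nonneg_left hfM (by positivity))) ?_
  simp only [e]
  exact hψM

/-- Transport does not contribute to the energy, so only the second order term is left. -/
lemma IsBoundedDivFree.tsum_re_advect_sub {w : Torus L₁ L₂ → ℝ × ℝ} (hw : IsBoundedDivFree K w)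
    {f ψ : L2 L₁ L₂} (hf : InH2 L₁ L₂ (coeff f)) (hψ : InH2 L₁ L₂ (coeff ψ)) :
    (Summable fun k => (conj (coeff f k) * ((kappaSq L₁ L₂ k : ℝ) * coeff ψ k)).re) ∧
    ∑' k, (conj (coeff f k) * (coeff (advect w f) k - (kappaSq L₁ L₂ k : ℝ) * coeff ψ k)).re =
      -∑' k, (conj (coeff f k) * ((kappaSq L₁ L₂ k : ℝ) * coeff ψ k)).re ∧
    ∑' k, (conj (coeff f k) * ((kappaSq L₁ L₂ k : ℝ) * coeff ψ k)).re ≤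
      √(wsum L₁ L₂ 2 (coeff f)) * √(wsum L₁ L₂ 0 (coeff ψ)) := by
  have e : ∀ k, ‖((kappaSq L₁ L₂ k : ℝ) : ℂ) * coeff f k‖ ^ 2 =
      kappaSq L₁ L₂ k ^ 2 * ‖coeff f k‖ ^ 2 := fun k => by
    rw [norm_mul, mul_pow, Complex.norm_real, Real.norm_eq_abs, sq_abs]
  have h1 := summable_norm_mul (a := fun k => ((kappaSq L₁ L₂ k : ℝ) : ℂ) * coeff f k)
    (by simpa only [e] using hf.2) hψ.1
  simp only [e] at h1
  have hle : ∀ k, ‖(conj (coeff f k) * ((kappaSq L₁ L₂ k : ℝ) * coeff ψ k)).re‖ ≤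
      ‖((kappaSq L₁ L₂ k : ℝ) : ℂ) * coeff f k‖ * ‖coeff ψ k‖ := fun k => by
    refine (Complex.abs_re_le_norm _).trans (le_of_eq ?_)
    rw [norm_mul, norm_mul, norm_mul, RCLike.norm_conj]; ring
  have hs := Summable.of_norm_bounded h1.1 hle
  refine ⟨hs, ?_, ?_⟩
  · have h2 := Complex.hasSum_re (hw.hasSum_advect_eq_zero hf.memH1)
    rw [Complex.zero_re] at h2
    have h3 := (h2.sub hs.hasSum).tsum_eq
    simp only [mul_sub, Complex.sub_re]
    rw [h3, zero_sub]
  · refine (hs.tsum_le_tsum (fun k => (le_abs_self _).trans (hle k)) h1.1).trans ?_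
    rw [wsum_zero, wsum]
    exact h1.2

lemma IsH2Path.intervalIntegrable_poly {f : ℝ → L2 L₁ L₂} {M' : ℝ} (h : IsH2Path ψ s t M)
    (hf : IsH2Path f s t M') (hst : s ≤ t) (c₀ c₁ c₂ c₃ : ℝ) :
    IntervalIntegrable (fun r => c₀ * wsum L₁ L₂ 2 (coeff (ψ r)) + (c₁ * wsum L₁ L₂ 0 (coeff (ψ r))
      + c₂ * wsum L₁ L₂ 0 (coeff (ψ r)) ^ 3 +
      c₃ * wsum L₁ L₂ 0 (coeff (ψ r)) ^ 2 * wsum L₁ L₂ 0 (coeff (f r)))) volume s t := by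
  refine ((h.intervalIntegrable_wsum_two hst).const_mul _).add (ContinuousOn.intervalIntegrable ?_)
  rw [uIcc_of_le hst]
  have h1 := h.continuousOn_wsum_zero
  have h2 := hf.continuousOn_wsum_zero
  fun_prop

/-! ### The energy inequality for the mean-free part. -/

/-- The energy inequality. -/
lemma IsMeanFreeSolution.energy_le (h : IsMeanFreeSolution v s t M ψ) (hst : s ≤ t)
    (hK : ∀ᵐ r ∂(volume.restrict (Ioc s t)), IsBoundedDivFree K (v r)) :
    wsum L₁ L₂ 0 (coeff (ψ t)) ≤ wsum L₁ L₂ 0 (coeff (ψ s)) +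
      ∫ r in s..t, (-wsum L₁ L₂ 2 (coeff (ψ r)) + (2 * wsum L₁ L₂ 0 (coeff (ψ r)) +
        (2 * latticeConst L₁ L₂) ^ 2 * wsum L₁ L₂ 0 (coeff (ψ r)) ^ 3)) := by
  obtain ⟨g, hg, hψ, hgr⟩ := h.modes
  have hM : 0 ≤ M := (wsum_nonneg _ _).trans (h.path.wsum_zero_le s (left_mem_Icc.2 hst))
  refine h.path.energy_le hst h.coeff_zero hg hψ (M' := 2 * (2 * K ^ 2 * M) + 2 * M)
    (b := fun r k => coeff (advect (v r) (ψ r)) k - (kappaSq L₁ L₂ k : ℝ) * coeff (ψ r) k)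
    (N := fun r => nonlin (ψ r)) (n := fun r => 1 / 2 * wsum L₁ L₂ 1 (coeff (ψ r))) ?_ ?_
  · simpa using h.path.intervalIntegrable_poly h.path hst (-1) 2 ((2 * latticeConst L₁ L₂) ^ 2) 0
  · filter_upwards [hgr, hK, ae_restrict_mem measurableSet_Ioc] with r h1 h2 hrI
    have hrI' := Ioc_subset_Icc_self hrI
    have hr := h.path.inH2 r hrI'
    have h3 := h2.tsum_advect_sub_le hr.memH1 hr (h.path.wsum_one_le hrI') (h.path.wsum_two_le r hrI')
    refine ⟨h1, h3.1, h3.2, norm_nonlin_le hr.memH1, ?_, ?_⟩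
    · have := h.path.wsum_one_le hrI'
      have : 0 ≤ 2 * (2 * K ^ 2 * M) := by positivity
      linarith
    · have h4 := (h2.tsum_re_advect_sub hr hr).2.1
      have e : ∀ k, (conj (coeff (ψ r) k) * ((kappaSq L₁ L₂ k : ℝ) * coeff (ψ r) k)).re =
          kappaSq L₁ L₂ k ^ 1 * ‖coeff (ψ r) k‖ ^ 2 := fun k => by
        rw [mul_left_comm, mul_comm (conj _), Complex.mul_conj, ← Complex.ofReal_mul,
          Complex.ofReal_re, Complex.normSq_eq_norm_sq, pow_one]
      simp only [e] at h4
      rw [h4]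
      have h5 := hr.agmon (h.coeff_zero r hrI')
      have h6 := dissipation_le (wsum_nonneg 0 (coeff (ψ r))) (wsum_nonneg 2 (coeff (ψ r)))
        hr.summable_one.2 (tsum_nonneg fun k => norm_nonneg _) h5.2
      change _ - 2 * -wsum L₁ L₂ 1 (coeff (ψ r)) + _ ≤ _
      linarith

end

/-! ### Decay over one dissipation time -/

/-- A continuous function stays below `a` if it cannot reach `a` for the first time. -/
lemma lt_of_first_hitting {X : ℝ → ℝ} {s t a : ℝ} (hX : ContinuousOn X (Icc s t))
    (h : ∀ r ∈ Icc s t, (∀ x ∈ Ico s r, X x < a) → X r < a) : ∀ r ∈ Icc s t, X r < a := by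
  by_contra! hne
  obtain ⟨r₀, hr₀, har₀⟩ := hne
  have hc : IsCompact (Icc s t ∩ X ⁻¹' Ici a) :=
    isCompact_Icc.of_isClosed_subset (hX.preimage_isClosed_of_isClosed isClosed_Icc isClosed_Ici)
      inter_subset_left
  obtain ⟨r, hr, hmin⟩ := hc.exists_isLeast ⟨r₀, hr₀, har₀⟩
  refine absurd (h r hr.1 fun x hx => ?_) (not_lt.2 hr.2)
  by_contra! hax
  exact absurd (hmin ⟨⟨hx.1, hx.2.le.trans hr.1.2⟩, hax⟩) (not_le.2 hx.2)

section

variable {v : ℝ → Torus L₁ L₂ → ℝ × ℝ} {s t T M K b τ : ℝ} {ψ : ℝ → L2 L₁ L₂}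

/-- On short time intervals the energy stays comparable to its initial value. -/
lemma IsMeanFreeSolution.short_time (h : IsMeanFreeSolution v s T M ψ) (hsT : s ≤ T)
    (hK : ∀ᵐ r ∂(volume.restrict (Ioc s T)), IsBoundedDivFree K (v r)) (hb : 0 < b)
    (hT : (T - s) * (8 + 64 * (2 * latticeConst L₁ L₂) ^ 2 * b ^ 2) ≤ 1)
    (hX : wsum L₁ L₂ 0 (coeff (ψ s)) ≤ b) :
    (∀ r ∈ Icc s T, wsum L₁ L₂ 0 (coeff (ψ r)) ≤ 4 * b) ∧
      ∫ r in s..T, wsum L₁ L₂ 2 (coeff (ψ r)) ≤ 2 * b := by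
  set Λ := 2 * latticeConst L₁ L₂ with hΛ
  -- As long as X < 4b, the growth terms contribute at most (r - s)(8b + 64 Λ² b³) ≤ b, so X + ∫ D ≤
  -- 2b. This is strictly below 4b, hence 4b is never reached.
  have key : ∀ r ∈ Icc s T, (∀ x ∈ Ico s r, wsum L₁ L₂ 0 (coeff (ψ x)) < 4 * b) →
      wsum L₁ L₂ 0 (coeff (ψ r)) + ∫ x in s..r, wsum L₁ L₂ 2 (coeff (ψ x)) ≤ 2 * b := by
    intro r hr hlt
    have hr' := h.mono le_rfl hr.1 hr.2
    have h1 := hr'.energy_le hr.1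
      (ae_restrict_of_ae_restrict_of_subset (Ioc_subset_Ioc_right hr.2) hK)
    have i1 := hr'.path.intervalIntegrable_wsum_two hr.1
    have i2 : IntervalIntegrable (fun x => 2 * wsum L₁ L₂ 0 (coeff (ψ x)) +
        Λ ^ 2 * wsum L₁ L₂ 0 (coeff (ψ x)) ^ 3) volume s r := by
      simpa using hr'.path.intervalIntegrable_poly hr'.path hr.1 0 2 (Λ ^ 2) 0
    rw [← hΛ, intervalIntegral.integral_add (f := fun x => -wsum L₁ L₂ 2 (coeff (ψ x))) i1.neg i2,
      intervalIntegral.integral_neg] at h1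
    have h2 : ∫ x in s..r, (2 * wsum L₁ L₂ 0 (coeff (ψ x)) +
        Λ ^ 2 * wsum L₁ L₂ 0 (coeff (ψ x)) ^ 3) ≤
          ∫ _ in s..r, (2 * (4 * b) + Λ ^ 2 * (4 * b) ^ 3) := by
      refine intervalIntegral.integral_mono_on_of_le_Ioo hr.1 i2 intervalIntegrable_const
        fun x hx => ?_
      have h3 := (hlt x ⟨hx.1.le, hx.2⟩).le
      have h4 := wsum_nonneg (L₁ := L₁) (L₂ := L₂) 0 (coeff (ψ x))
      gcongr
    rw [intervalIntegral.integral_const, smul_eq_mul] at h2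
    have h5 : (r - s) * (2 * (4 * b) + Λ ^ 2 * (4 * b) ^ 3) ≤ b := by
      have h6 : (r - s) * (8 + 64 * Λ ^ 2 * b ^ 2) ≤ 1 := by
        refine le_trans ?_ hT
        have := hr.2
        gcongr
      have := mul_le_mul_of_nonneg_left h6 hb.le
      linarith
    linarith
  have hD : ∀ r ∈ Icc s T, 0 ≤ ∫ x in s..r, wsum L₁ L₂ 2 (coeff (ψ x)) := fun r hr =>
    intervalIntegral.integral_nonneg hr.1 fun x _ => wsum_nonneg _ _
  have hlt := lt_of_first_hitting h.path.continuousOn_wsum_zero (a := 4 * b) fun r hr hr' => by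
    linarith [key r hr hr', hD r hr]
  have hT' := right_mem_Icc.2 hsT
  have h1 := key T hT' fun x hx => hlt x (Ico_subset_Icc_self hx)
  exact ⟨fun r hr => (hlt r hr).le, by
    linarith [wsum_nonneg (L₁ := L₁) (L₂ := L₂) 0 (coeff (ψ T))]⟩

lemma IsAdvHypSolution.modes {f₀ : L2 L₁ L₂} {f : ℝ → L2 L₁ L₂} (h : IsAdvHypSolution v s T f₀ f)
    (hsT : s ≤ T) (k : ℤ × ℤ) :
    IntervalIntegrable (fun r => ((kappaSq L₁ L₂ k ^ 2 : ℝ) : ℂ) * coeff (f r) k +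
      coeff (advect (v r) (f r)) k) volume s T ∧
    ∀ r ∈ Icc s T, coeff (f r) k = coeff f₀ k - ∫ x in s..r,
      (((kappaSq L₁ L₂ k ^ 2 : ℝ) : ℂ) * coeff (f x) k + coeff (advect (v x) (f x)) k) := by
  have hσ := isParabolicSymbol_bilaplacian (L₁ := L₁) (L₂ := L₂)
  constructor
  · refine IntervalIntegrable.add (ContinuousOn.intervalIntegrable ?_)
      (h.intervalIntegrable_coeff hσ hsT k)
    rw [uIcc_of_le hsT]
    exact continuousOn_const.mul (continuousOn_coeff h.continuousOn k)
  · intro r hr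
    rw [← h.initial hσ hsT]
    exact h.coeff_sub hσ k (left_mem_Icc.2 hsT) hr

/-- Solutions of the linear equation with mean-free initial value are mean-free, and their energy
decreases. -/
lemma IsAdvHypSolution.mean_and_energy {f₀ : L2 L₁ L₂} {f : ℝ → L2 L₁ L₂}
    (h : IsAdvHypSolution v s T f₀ f) (hp : IsH2Path f s T M)
    (hK : ∀ᵐ r ∂(volume.restrict (Ioc s T)), IsBoundedDivFree K (v r)) (h0 : coeff f₀ 0 = 0) :
    ∀ r ∈ Icc s T, coeff (f r) 0 = 0 ∧ wsum L₁ L₂ 0 (coeff (f r)) ≤ wsum L₁ L₂ 0 (coeff f₀) := by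
  have hσ := isParabolicSymbol_bilaplacian (L₁ := L₁) (L₂ := L₂)
  have hmean : ∀ r ∈ Icc s T, coeff (f r) 0 = 0 := by
    intro r hr
    rw [(h.modes (hr.1.trans hr.2) 0).2 r hr, h0, zero_sub, neg_eq_zero]
    refine (intervalIntegral.integral_congr_ae_restrict (g := fun _ => (0 : ℂ)) ?_).trans
      intervalIntegral.integral_zero
    rw [uIoc_of_le hr.1]
    filter_upwards [ae_restrict_of_ae_restrict_of_subset (Ioc_subset_Ioc_right hr.2) hK,
      ae_restrict_mem measurableSet_Ioc] with x hx hxI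
    rw [hx.coeff_advect_zero (hp.inH2 x ⟨hxI.1.le, hxI.2.trans hr.2⟩).memH1, kappaSq_zero]
    simp
  intro r hr
  refine ⟨hmean r hr, ?_⟩
  have hp' := hp.mono le_rfl hr.2
  have hm := fun k => h.modes (hr.1.trans hr.2) k
  have h1 := hp'.energy_le hr.1 (fun x hx => hmean x ⟨hx.1, hx.2.trans hr.2⟩)
    (fun k => intervalIntegrable_of_Icc_subset (hm k).1 (left_mem_Icc.2 (hr.1.trans hr.2)) hr)
    (fun k x hx => by
      rw [h.initial hσ (hr.1.trans hr.2)]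
      exact (hm k).2 x ⟨hx.1, hx.2.trans hr.2⟩)
    (b := fun x k => coeff (advect (v x) (f x)) k) (N := fun _ _ => 0) (n := fun _ => 0)
    (q := fun _ => 0) (M' := 2 * K ^ 2 * M) intervalIntegrable_const ?_
  · rwa [intervalIntegral.integral_zero, add_zero, h.initial hσ (hr.1.trans hr.2)] at h1
  · filter_upwards [ae_restrict_of_ae_restrict_of_subset (Ioc_subset_Ioc_right hr.2) hK,
      ae_restrict_mem measurableSet_Ioc] with x hx hxI
    have hx' : x ∈ Icc s T := ⟨hxI.1.le, hxI.2.trans hr.2⟩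
    have hH := hp.inH2 x hx'
    have h2 := hx.tsum_advect_le hH.memH1
    have h3 := Complex.hasSum_re (hx.hasSum_advect_eq_zero hH.memH1)
    rw [Complex.zero_re] at h3
    have hM : 0 ≤ M := (wsum_nonneg _ _).trans (hp.wsum_one_le hx')
    refine ⟨fun k => (add_zero _).symm, h2.1, h2.2.trans
      (mul_le_mul_of_nonneg_left (hp.wsum_one_le hx') (by positivity)), fun k => by simp,
      by positivity, ?_⟩
    rw [h3.tsum_eq]
    have := wsum_nonneg (L₁ := L₁) (L₂ := L₂) 2 (coeff (f x))
    linarith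

/-- The difference between a solution of the nonlinear equation and the solution of the linear
equation with the same initial value. -/
lemma IsMeanFreeSolution.sub_energy_le (h : IsMeanFreeSolution v s T M ψ) (hsT : s ≤ T)
    (hK : ∀ᵐ r ∂(volume.restrict (Ioc s T)), IsBoundedDivFree K (v r)) {f : ℝ → L2 L₁ L₂}
    {M' : ℝ} (hf : IsAdvHypSolution v s T (ψ s) f) (hp : IsH2Path f s T M') :
    wsum L₁ L₂ 0 (coeff (ψ T - f T : L2 L₁ L₂)) ≤
      ∫ r in s..T, (1 / 64 * wsum L₁ L₂ 2 (coeff (ψ r)) + (wsum L₁ L₂ 0 (coeff (ψ r)) +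
        64 * (2 * latticeConst L₁ L₂) ^ 2 * wsum L₁ L₂ 0 (coeff (ψ r)) ^ 2 *
          wsum L₁ L₂ 0 (coeff (ψ r - f r : L2 L₁ L₂)))) := by
  obtain ⟨g, hg, hψ, hgr⟩ := h.modes
  have hss := left_mem_Icc.2 hsT
  have hσ := isParabolicSymbol_bilaplacian (L₁ := L₁) (L₂ := L₂)
  have hw := h.path.sub hp
  set M'' := 2 * M + 2 * M' with hM''
  have hfm := fun k => hf.modes hsT k
  have h0 := hf.mean_and_energy hp hK (h.coeff_zero s hss)
  have hw0 : ∀ r ∈ Icc s T, coeff (ψ r - f r : L2 L₁ L₂) 0 = 0 := fun r hr => by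
    rw [coeff_sub_L2, h.coeff_zero r hr, (h0 r hr).1, sub_zero]
  have hM : 0 ≤ M := (wsum_nonneg _ _).trans (h.path.wsum_zero_le s hss)
  have hMw : 0 ≤ M'' := (wsum_nonneg _ _).trans (hw.wsum_zero_le s hss)
  have h1 := hw.energy_le hsT hw0 (fun k => (hg k).sub (hfm k).1)
    (fun k r hr => by
      rw [coeff_sub_L2, coeff_sub_L2, hψ k r hr, (hfm k).2 r hr, hf.initial hσ hsT,
        intervalIntegral.integral_sub (intervalIntegrable_of_Icc_subset (hg k) hss hr)
          (intervalIntegrable_of_Icc_subset (hfm k).1 hss hr)]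
      ring)
    -- Transport acts on the difference ψ - f and so does no work on it; the term Δψ and the
    -- nonlinearity remain as forcing by ψ alone.
    (b := fun r k => coeff (advect (v r) (ψ r - f r)) k - (kappaSq L₁ L₂ k : ℝ) * coeff (ψ r) k)
    (N := fun r => nonlin (ψ r)) (n := fun r => 1 / 2 * wsum L₁ L₂ 1 (coeff (ψ r)))
    (M' := 2 * (2 * K ^ 2 * M'') + 2 * M)
    (q := fun r => 1 / 64 * wsum L₁ L₂ 2 (coeff (ψ r)) + (wsum L₁ L₂ 0 (coeff (ψ r)) +
        64 * (2 * latticeConst L₁ L₂) ^ 2 * wsum L₁ L₂ 0 (coeff (ψ r)) ^ 2 *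
          wsum L₁ L₂ 0 (coeff (ψ r - f r : L2 L₁ L₂)))) ?_ ?_
  · have e : ψ s - f s = 0 := by rw [hf.initial hσ hsT, sub_self]
    rw [e] at h1
    rwa [wsum_zero_coeff (0 : L2 L₁ L₂), norm_zero, sq, mul_zero, mul_zero, zero_add] at h1
  · simpa using h.path.intervalIntegrable_poly hw hsT (1 / 64) 1 0
      (64 * (2 * latticeConst L₁ L₂) ^ 2)
  · filter_upwards [hgr, hK, ae_restrict_mem measurableSet_Ioc] with r h1 h2 hrI
    have hrI' := Ioc_subset_Icc_self hrI
    have hr := h.path.inH2 r hrI'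
    have hwr := hw.inH2 r hrI'
    have h3 := h2.tsum_advect_sub_le hwr.memH1 hr (hw.wsum_one_le hrI') (h.path.wsum_two_le r hrI')
    refine ⟨fun k => ?_, h3.1, h3.2, norm_nonlin_le hr.memH1, ?_, ?_⟩
    · rw [h1, h2.coeff_advect_sub hr.memH1 (hp.inH2 r hrI').memH1 hwr.memH1, coeff_sub_L2]
      ring
    · have := h.path.wsum_one_le hrI'
      have : 0 ≤ 2 * (2 * K ^ 2 * M'') := by positivity
      linarith
    · obtain ⟨-, h4, h5⟩ := h2.tsum_re_advect_sub hwr hr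
      rw [h4]
      have h6 := hwr.agmon (hw0 r hrI')
      have h7 := dissipation_sub_le (wsum_nonneg 0 (coeff (ψ r))) (wsum_nonneg 2 (coeff (ψ r)))
        hr.summable_one.2 (wsum_nonneg 0 (coeff (ψ r - f r : L2 L₁ L₂)))
        (wsum_nonneg 2 (coeff (ψ r - f r : L2 L₁ L₂))) (tsum_nonneg fun k => norm_nonneg _) h6.2
      linarith

lemma wsum_zero_sub_le (f g : L2 L₁ L₂) : wsum L₁ L₂ 0 (coeff (f - g : L2 L₁ L₂)) ≤
    2 * wsum L₁ L₂ 0 (coeff f) + 2 * wsum L₁ L₂ 0 (coeff g) := by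
  have h := tsum_norm_sub_sq_le (hasSum_norm_coeff_sq f).summable (hasSum_norm_coeff_sq g).summable
    le_rfl le_rfl
  simp only [wsum_zero, coeff_sub_L2]
  exact h.2

/-- The energy decreases by a fixed factor over one dissipation time. -/
lemma IsMeanFreeSolution.contract (hv : IsAdmissibleVelocity v)
    (h : IsMeanFreeSolution v s (s + τ) M ψ) (hs : 0 ≤ s) (hτ : 0 ≤ τ)
    (hhalf : HalvesEnergy v s τ) (hb : 0 < b)
    (hsmall : τ * (8 + 10240 * (2 * latticeConst L₁ L₂) ^ 2 * b ^ 2) ≤ 1 / 32)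
    (hX : wsum L₁ L₂ 0 (coeff (ψ s)) ≤ b) :
    wsum L₁ L₂ 0 (coeff (ψ (s + τ))) ≤ 9 / 16 * b := by
  obtain ⟨K, -, hK⟩ := hv.exists_bound
  have hsT : s ≤ s + τ := le_add_of_nonneg_right hτ
  have hK' := ae_restrict_Ioc_of_Ici (t := s + τ) hs hK
  have hss := left_mem_Icc.2 hsT
  have hA := area_pos (L₁ := L₁) (L₂ := L₂)
  set Λ := 2 * latticeConst L₁ L₂ with hΛ
  obtain ⟨hX4, hD⟩ := h.short_time hsT hK' hb (by
    rw [add_sub_cancel_left]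
    have : τ * (8 + 64 * Λ ^ 2 * b ^ 2) ≤ τ * (8 + 10240 * Λ ^ 2 * b ^ 2) := by
      gcongr; norm_num
    linarith) hX
  -- The halving property is a statement about solutions of the linear equation, so an actual one is
  -- needed. H² regularity of ψ(s) is what the existence theorem requires.
  obtain ⟨f, hf, M', hp⟩ := exists_isAdvHypSolution hv hs hsT (h.path.inH2 s hss)
  have hfe := hf.mean_and_energy hp hK' (h.coeff_zero s hss)
  have hw := h.path.sub hp
  -- From ‖ψ - f‖² ≤ 2‖ψ‖² + 2‖f‖²: 10 b = 2 · 4b + 2 · b, as the energy of f does not increase.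
  -- With (4b)² and the factor 64 this is the source of 10240 = 64 · 16 · 10.
  have hwb : ∀ r ∈ Icc s (s + τ), wsum L₁ L₂ 0 (coeff (ψ r - f r : L2 L₁ L₂)) ≤ 10 * b :=
    fun r hr => by linarith [wsum_zero_sub_le (ψ r) (f r), hX4 r hr, (hfe r hr).2]
  have h1 := h.sub_energy_le hsT hK' hf hp
  have i1 := (h.path.intervalIntegrable_wsum_two hsT).const_mul (1 / 64)
  have i2 : IntervalIntegrable (fun r => wsum L₁ L₂ 0 (coeff (ψ r)) +
        64 * Λ ^ 2 * wsum L₁ L₂ 0 (coeff (ψ r)) ^ 2 *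
          wsum L₁ L₂ 0 (coeff (ψ r - f r : L2 L₁ L₂))) volume s (s + τ) := by
    simpa using h.path.intervalIntegrable_poly hw hsT 0 1 0 (64 * Λ ^ 2)
  rw [intervalIntegral.integral_add i1 i2, intervalIntegral.integral_const_mul] at h1
  have h2 : ∫ r in s..(s + τ), (wsum L₁ L₂ 0 (coeff (ψ r)) +
        64 * Λ ^ 2 * wsum L₁ L₂ 0 (coeff (ψ r)) ^ 2 *
          wsum L₁ L₂ 0 (coeff (ψ r - f r : L2 L₁ L₂))) ≤
      ∫ _ in s..(s + τ), (4 * b + 64 * Λ ^ 2 * (4 * b) ^ 2 * (10 * b)) := by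
    refine intervalIntegral.integral_mono_on hsT i2 intervalIntegrable_const fun r hr => ?_
    have := hX4 r hr
    have := hwb r hr
    have := wsum_nonneg (L₁ := L₁) (L₂ := L₂) 0 (coeff (ψ r))
    have := wsum_nonneg (L₁ := L₁) (L₂ := L₂) 0 (coeff (ψ r - f r : L2 L₁ L₂))
    gcongr
  rw [intervalIntegral.integral_const, smul_eq_mul, add_sub_cancel_left] at h2
  have h3 : τ * (4 * b + 64 * Λ ^ 2 * (4 * b) ^ 2 * (10 * b)) ≤ b / 32 := by
    have h4 := mul_le_mul_of_nonneg_right hsmall hb.le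
    have : 0 ≤ τ * b := by positivity
    linarith
  -- One b/32 comes from D/64 with ∫ D ≤ 2b, the other from the smallness of τ.
  have hwT : wsum L₁ L₂ 0 (coeff (ψ (s + τ) - f (s + τ) : L2 L₁ L₂)) ≤ b / 16 := by linarith
  have hmean : mean (ψ s) = 0 := by
    have h5 := coeff_zero_eq_mean (ψ s)
    rw [h.coeff_zero s hss] at h5
    exact_mod_cast h5.symm
  have hfT := hhalf (ψ s) f hmean hf
  have hn : ∀ (g : L2 L₁ L₂) {c : ℝ}, wsum L₁ L₂ 0 (coeff g) ≤ c ^ 2 * b → 0 ≤ c →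
      ‖g‖ ≤ c * √(area L₁ L₂ * b) := by
    intro g c hg hc
    refine abs_le_of_sq_le_sq' ?_ (by positivity) |>.2
    rw [norm_sq_eq_wsum, mul_pow, Real.sq_sqrt (by positivity)]
    linarith [mul_le_mul_of_nonneg_left hg hA.le]
  have n1 := hn (ψ s) (c := 1) (by linarith) zero_le_one
  have n2 := hn (ψ (s + τ) - f (s + τ)) (c := 1 / 4) (by linarith) (by norm_num)
  -- 1/2 from the linear solution and 1/4 = √(1/16) from the difference.
  have n3 : ‖ψ (s + τ)‖ ≤ 3 / 4 * √(area L₁ L₂ * b) := by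
    have := norm_add_le (ψ (s + τ) - f (s + τ)) (f (s + τ))
    rw [sub_add_cancel] at this
    linarith
  have n4 := pow_le_pow_left₀ (norm_nonneg _) n3 2
  rw [norm_sq_eq_wsum, mul_pow, Real.sq_sqrt (by positivity)] at n4
  exact le_of_mul_le_mul_left (by linarith) hA

/-- A uniform bound on the energy and the total dissipation. -/
lemma IsMeanFreeSolution.bound (hv : IsAdmissibleVelocity v) (hτ : 0 ≤ τ)
    (hhalf : ∀ s, 0 ≤ s → HalvesEnergy v s τ) (n : ℕ) :
    ∀ s b, 0 ≤ s → 0 < b →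
      τ * (8 + 10240 * (2 * latticeConst L₁ L₂) ^ 2 * b ^ 2) ≤ 1 / 32 → s ≤ T → T ≤ s + n * τ →
      IsMeanFreeSolution v s T M ψ → wsum L₁ L₂ 0 (coeff (ψ s)) ≤ b →
      (∀ r ∈ Icc s T, wsum L₁ L₂ 0 (coeff (ψ r)) ≤ 4 * b) ∧
        ∫ r in s..T, wsum L₁ L₂ 2 (coeff (ψ r)) ≤ 5 * b := by
  obtain ⟨K, -, hK⟩ := hv.exists_bound
  set Λ := 2 * latticeConst L₁ L₂ with hΛ
  have hshort : ∀ s b T, 0 ≤ s → 0 < b → τ * (8 + 10240 * Λ ^ 2 * b ^ 2) ≤ 1 / 32 → s ≤ T →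
      T ≤ s + τ → IsMeanFreeSolution v s T M ψ → wsum L₁ L₂ 0 (coeff (ψ s)) ≤ b →
      (∀ r ∈ Icc s T, wsum L₁ L₂ 0 (coeff (ψ r)) ≤ 4 * b) ∧
        ∫ r in s..T, wsum L₁ L₂ 2 (coeff (ψ r)) ≤ 2 * b := by
    intro s b T hs hb hsmall hsT hT h hX
    refine h.short_time hsT (ae_restrict_Ioc_of_Ici hs hK) hb ?_ hX
    have : (T - s) * (8 + 64 * Λ ^ 2 * b ^ 2) ≤ τ * (8 + 10240 * Λ ^ 2 * b ^ 2) := by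
      gcongr
      · linarith
      · norm_num
    linarith
  -- The induction counts steps of length τ, with s and b varying: after one full step the claim is
  -- used from s + τ with 9b/16. The last step may be incomplete, and then the short time bound is
  -- enough.
  induction n with
  | zero =>
    intro s b hs hb hsmall hsT hT h hX
    have := hshort s b T hs hb hsmall hsT (by simp at hT; linarith) h hX
    exact ⟨this.1, by linarith [this.2]⟩
  | succ n ih =>
    intro s b hs hb hsmall hsT hT h hX
    rcases le_or_gt T (s + τ) with hTs | hTs
    · have := hshort s b T hs hb hsmall hsT hTs h hX
      exact ⟨this.1, by linarith [this.2]⟩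
    have hsτ : s ≤ s + τ := le_add_of_nonneg_right hτ
    have ha := h.mono le_rfl hsτ hTs.le
    have hc := h.mono hsτ hTs.le le_rfl
    have h1 := hshort s b (s + τ) hs hb hsmall hsτ le_rfl ha hX
    have h2 := ih (s + τ) (9 / 16 * b) (by linarith) (by positivity) (by
      refine le_trans ?_ hsmall
      have : (9 / 16 * b) ^ 2 ≤ b ^ 2 := by
        rw [mul_pow]
        exact mul_le_of_le_one_left (sq_nonneg b) (by norm_num)
      gcongr) hTs.le (by push_cast at hT; linarith) hc
      (ha.contract hv hs hτ (hhalf s hs) hb hsmall hX)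
    refine ⟨fun r hr => ?_, ?_⟩
    · rcases le_total r (s + τ) with hr' | hr'
      · exact h1.1 r ⟨hr.1, hr'⟩
      · linarith [h2.1 r ⟨hr', hr.2⟩]
    · rw [← intervalIntegral.integral_add_adjacent_intervals
        (ha.path.intervalIntegrable_wsum_two hsτ) (hc.path.intervalIntegrable_wsum_two hTs.le)]
      -- The constant 5 closes the induction because 2 + 5 · 9/16 ≤ 5.
      linarith [h1.2, h2.2]

/-- The average of a solution changes by a multiple of the total dissipation. -/
lemma IsAKSSolution.abs_mean_le {φ₀ : L2 L₁ L₂} {φ : ℝ → L2 L₁ L₂}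
    (hv : IsAdmissibleVelocity v) (h : IsAKSSolution v T φ₀ φ) (hs : 0 < s) (hst : s ≤ t)
    (htT : t ≤ T) : |mean (φ t)| ≤ |mean (φ s)| + 1 / (2 * gap L₁ L₂) *
      ∫ r in s..t, wsum L₁ L₂ 2 (coeff (meanFreePart (φ r))) := by
  obtain ⟨K, -, hK⟩ := hv.exists_bound
  obtain ⟨M, hM⟩ := h.exists_isH2Path hv hs (hst.trans htT)
  have hσ := isParabolicSymbol_kuramotoSivashinsky (L₁ := L₁) (L₂ := L₂)
  have hg := gap_pos (L₁ := L₁) (L₂ := L₂)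
  have hp := hM.meanFreePart
  -- In mode 0 the symbol vanishes and transport has zero average, so only the average of ½|∇φ|²
  -- drives the mean.
  have e := h.coeff_sub hσ 0 ⟨hs.le, hst.trans htT⟩ ⟨hst, htT⟩
  rw [coeff_zero_eq_mean, coeff_zero_eq_mean] at e
  have hint : ‖∫ r in s..t, (((kappaSq L₁ L₂ 0 ^ 2 - kappaSq L₁ L₂ 0 : ℝ) : ℂ) * coeff (φ r) 0 +
      coeff (fun x => 1 / 2 * gradSq (φ r) x + advect (v r) (φ r) x) 0)‖ ≤
      ∫ r in s..t, 1 / (2 * gap L₁ L₂) * wsum L₁ L₂ 2 (coeff (meanFreePart (φ r))) := by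
    refine intervalIntegral.norm_integral_le_of_norm_le hst ?_
      (((hp.mono le_rfl htT).intervalIntegrable_wsum_two hst).const_mul _)
    rw [← ae_restrict_iff' measurableSet_Ioc]
    filter_upwards [ae_restrict_Ioc_of_Ici hs.le hK, ae_restrict_mem measurableSet_Ioc]
      with r hr hrI
    have hrI' : r ∈ Icc s T := ⟨hrI.1.le, hrI.2.trans htT⟩
    have h1 := (hM.inH2 r hrI').memH1
    have h2 := hp.inH2 r hrI'
    have h3 := partial_meanFreePart h1 h2.memH1
    have e2 : gradSq (meanFreePart (φ r)) = gradSq (φ r) := by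
      funext x; rw [gradSq, gradSq, h3.1, h3.2]
    rw [kappaSq_zero, hr.coeff_ks, hr.coeff_advect_zero h1, ← e2]
    have h4 := h2.memH1.norm_coeff_gradSq_le 0
    have h5 := (h2.gap_mul_le (by rw [coeff_meanFreePart, if_pos rfl])).2
    have h6 : 1 / 2 * wsum L₁ L₂ 1 (coeff (meanFreePart (φ r))) ≤
        1 / (2 * gap L₁ L₂) * wsum L₁ L₂ 2 (coeff (meanFreePart (φ r))) := by
      rw [div_mul_eq_mul_div, div_mul_eq_mul_div, div_le_div_iff₀ (by norm_num) (by positivity)]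
      linarith
    simpa using h4.trans h6
  rw [intervalIntegral.integral_const_mul] at hint
  have h7 := congrArg norm e
  rw [Complex.norm_real, Real.norm_eq_abs] at h7
  rw [h7]
  refine (norm_sub_le _ _).trans (add_le_add (le_of_eq ?_) hint)
  rw [Complex.norm_real, Real.norm_eq_abs]

end

/-- The dissipation time is controlled through `T₀`. -/
lemma T0_le {C B : ℝ} (hC : 0 < C) (hB : 0 < B) : T0 C B ≤ 3 / (C * (1 + B ^ 4)) := by
  have hB2 : B ^ 2 ≤ 4 * B ^ 2 := by nlinarith [sq_nonneg B]
  have hpos : ∀ y ∈ Icc (B ^ 2) (4 * B ^ 2), 0 < y := fun y hy => (by positivity : 0 < B ^ 2).trans_le hy.1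
  -- The integrand is at most its value at the lower end y = B², and the interval has length 3 B².
  have h1 : T0 C B ≤ ∫ _ in (B ^ 2)..(4 * B ^ 2), 1 / (C * B ^ 2 + C * (B ^ 2) ^ 3) := by
    refine intervalIntegral.integral_mono_on hB2 (ContinuousOn.intervalIntegrable ?_)
      intervalIntegrable_const fun y hy => ?_
    · rw [uIcc_of_le hB2]
      refine ContinuousOn.div (by fun_prop) (by fun_prop) fun y hy => ?_
      have := hpos y hy
      positivity
    · have := hy.1
      gcongr
  refine h1.trans (le_of_eq ?_)
  rw [intervalIntegral.integral_const, smul_eq_mul]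
  field_simp
  ring

/-! ### The uniform bound -/

/-- The infimum need not be attained, so a time of the set below 2τ is taken; the factor 2 is
absorbed in the constant. -/
lemma exists_halving_time {v : ℝ → Torus L₁ L₂ → ℝ × ℝ} {τ : ℝ} (h : IsDissipationTime v τ) :
    ∃ τ', 0 < τ' ∧ τ' < 2 * τ ∧ ∀ s, 0 ≤ s → HalvesEnergy v s τ' := by
  obtain ⟨τ', h1, h2, h3⟩ := h.2.exists_between (show τ < 2 * τ by linarith [h.1])
  exact ⟨τ', h.1.trans_le h2, h3, h1.2⟩

/-- Before any given positive time there is a positive time at which the size of a solution is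
close to that of its initial value. -/
lemma exists_initial_time {φ : ℝ → L2 L₁ L₂} {t B m : ℝ} (hφ : ContinuousOn φ (Icc 0 t))
    (ht : 0 < t) (hB : 0 < B) (h1 : ‖meanFreePart (φ 0)‖ ≤ B) (h2 : |mean (φ 0)| ≤ m) :
    ∃ ε, 0 < ε ∧ ε ≤ t ∧ ‖meanFreePart (φ ε)‖ ^ 2 ≤ 2 * B ^ 2 ∧ |mean (φ ε)| ≤ m + 1 := by
  have hc : ContinuousOn (fun r => ‖meanFreePart (φ r)‖) (Icc 0 t) :=
    (continuous_meanFreePart.comp_continuousOn hφ).norm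
  have hm : ContinuousOn (fun r => |mean (φ r)|) (Icc 0 t) := by
    have h3 := (continuousOn_coeff hφ 0).norm
    simpa only [coeff_zero_eq_mean, Complex.norm_real, Real.norm_eq_abs] using h3
  have h0 : (0 : ℝ) ∈ Icc 0 t := left_mem_Icc.2 ht.le
  -- The slack √2 doubles the energy bound, and continuity in `L²` preserves it for short times.
  have hlt1 : ‖meanFreePart (φ 0)‖ < √2 * B := by
    have : B < √2 * B := lt_mul_of_one_lt_left hB (Real.lt_sqrt_of_sq_lt (by norm_num))
    linarith
  have e1 := (hc 0 h0).eventually (gt_mem_nhds hlt1)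
  have e2 := (hm 0 h0).eventually (gt_mem_nhds (show |mean (φ 0)| < m + 1 by linarith))
  have hle : nhdsWithin (0 : ℝ) (Ioc 0 t) ≤ nhdsWithin 0 (Icc 0 t) :=
    nhdsWithin_mono _ Ioc_subset_Icc_self
  have : (nhdsWithin (0 : ℝ) (Ioc 0 t)).NeBot := by
    rw [nhdsWithin_Ioc_eq_nhdsGT ht]; infer_instance
  obtain ⟨ε, ⟨h3, h4⟩, h5⟩ := (((e1.and e2).filter_mono hle).and self_mem_nhdsWithin).exists
  refine ⟨ε, h5.1, h5.2, ?_, h4.le⟩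
  have h6 := pow_le_pow_left₀ (norm_nonneg _) h3.le 2
  rwa [mul_pow, Real.sq_sqrt (by norm_num)] at h6

variable (L₁ L₂) in
/-- The constant in the bound on the dissipation time. -/
def dissipationConst : ℝ :=
  6 * (32 * (8 + 10240 * (2 * latticeConst L₁ L₂) ^ 2 * (4 / area L₁ L₂ ^ 2)))

lemma dissipationConst_pos : 0 < dissipationConst L₁ L₂ := by
  rw [dissipationConst]; positivity

/-- The constant is made for this: 6 = 2 · 3 combines the doubled dissipation time with the 3 of
`T0_le`, 32 is the required smallness, and 4 / area² comes from the square of b = 2 B² / area. -/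
lemma small_of_le_T0 {τ B : ℝ} (hB : 0 < B) (hτ : τ ≤ 2 * T0 (dissipationConst L₁ L₂) B) :
    τ * (8 + 10240 * (2 * latticeConst L₁ L₂) ^ 2 * (2 * B ^ 2 / area L₁ L₂) ^ 2) ≤ 1 / 32 := by
  have hA := area_pos (L₁ := L₁) (L₂ := L₂)
  have hC := dissipationConst_pos (L₁ := L₁) (L₂ := L₂)
  set Q := 10240 * (2 * latticeConst L₁ L₂) ^ 2 * (4 / area L₁ L₂ ^ 2) with hQ
  have hQ0 : 0 ≤ Q := by positivity
  have e : 10240 * (2 * latticeConst L₁ L₂) ^ 2 * (2 * B ^ 2 / area L₁ L₂) ^ 2 = Q * B ^ 4 := by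
    rw [hQ]; field_simp; ring
  have hCe : dissipationConst L₁ L₂ = 6 * (32 * (8 + Q)) := rfl
  have hB4 : 0 < B ^ 4 := by positivity
  have h1 : τ ≤ 6 / (dissipationConst L₁ L₂ * (1 + B ^ 4)) := by
    have := T0_le hC hB
    calc τ ≤ 2 * (3 / (dissipationConst L₁ L₂ * (1 + B ^ 4))) := by linarith
      _ = _ := by ring
  rw [e]
  calc τ * (8 + Q * B ^ 4) ≤ 6 / (dissipationConst L₁ L₂ * (1 + B ^ 4)) *
        ((8 + Q) * (1 + B ^ 4)) := by
        refine mul_le_mul h1 ?_ (by positivity) (by positivity)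
        linarith
    _ = 1 / 32 := by rw [hCe]; field_simp

end AKS

end

/-! ### The theorem: choice of constants and conclusion. -/

theorem theorem2p11 (L₁ L₂ : ℝ) [Fact (0 < L₁)] [Fact (0 < L₂)] :
    ∃ C : ℝ, 0 < C ∧
      ∀ μ B m : ℝ, 0 < μ → 0 < B →
        ∃ C₁ : ℝ, 0 < C₁ ∧
          ∀ (v : ℝ → AKS.Torus L₁ L₂ → ℝ × ℝ) (τ : ℝ),
            AKS.IsAdmissibleVelocity v →
            AKS.IsDissipationTime v τ →
            τ ≤ min (AKS.T0 C B) (min (AKS.T1 C μ B) (1 / (4 * μ))) →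
            ∀ φ₀ : AKS.L2 L₁ L₂, ‖AKS.meanFreePart φ₀‖ ≤ B → |AKS.mean φ₀| ≤ m →
              ∀ (T : ℝ) (φ : ℝ → AKS.L2 L₁ L₂), 0 < T →
                AKS.IsAKSSolution v T φ₀ φ →
                ∀ t ∈ Set.Icc 0 T, ‖φ t‖ ≤ C₁ := by
  have hA := AKS.area_pos (L₁ := L₁) (L₂ := L₂)
  have hg := AKS.gap_pos (L₁ := L₁) (L₂ := L₂)
  refine ⟨AKS.dissipationConst L₁ L₂, AKS.dissipationConst_pos, fun μ B m _ hB => ?_⟩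
  -- Bounds the normalised energy at the starting time ε, where ‖ψ‖² ≤ 2 B².
  set b := 2 * B ^ 2 / AKS.area L₁ L₂ with hb
  have hb0 : 0 < b := by positivity
  -- The mean at time ε is at most m + 1, and it changes by at most 1 / (2 gap) times the total
  -- dissipation 5b.
  set R := m + 1 + 1 / (2 * AKS.gap L₁ L₂) * (5 * b) with hR
  refine ⟨√(AKS.area L₁ L₂ * R ^ 2 + AKS.area L₁ L₂ * (4 * b)), by positivity, ?_⟩
  intro v τ hv hτ hle φ₀ hφ₀ hm T φ hT h t ht
  have h0 := h.initial AKS.isParabolicSymbol_kuramotoSivashinsky hT.le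
  have hgoal : ‖AKS.meanFreePart (φ t)‖ ^ 2 ≤ AKS.area L₁ L₂ * (4 * b) → |AKS.mean (φ t)| ≤ R →
      ‖φ t‖ ≤ √(AKS.area L₁ L₂ * R ^ 2 + AKS.area L₁ L₂ * (4 * b)) := by
    intro h1 h2
    refine Real.le_sqrt_of_sq_le ?_
    rw [AKS.norm_sq_eq_mean]
    have h3 := pow_le_pow_left₀ (abs_nonneg _) h2 2
    rw [sq_abs] at h3
    exact add_le_add (mul_le_mul_of_nonneg_left h3 hA.le) h1
  have hAb : AKS.area L₁ L₂ * b = 2 * B ^ 2 := by rw [hb]; field_simp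
  -- Time 0 is separate because the energy estimates start at some ε > 0. For t > 0, ε depends on t
  -- and on the solution, but the resulting bounds do not.
  rcases ht.1.eq_or_lt with rfl | ht0
  · refine hgoal ?_ ?_
    · rw [h0]
      have := pow_le_pow_left₀ (norm_nonneg _) hφ₀ 2
      nlinarith [sq_nonneg B]
    · rw [h0, hR]
      have : 0 ≤ 1 / (2 * AKS.gap L₁ L₂) * (5 * b) := by positivity
      linarith
  obtain ⟨τ', hτ0, hττ, hhalf⟩ := AKS.exists_halving_time hτ
  obtain ⟨ε, hε0, hεt, hεX, hεm⟩ := AKS.exists_initial_time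
    (h.continuousOn.mono (Set.Icc_subset_Icc_right ht.2)) ht0 hB (h0 ▸ hφ₀)
    (m := m) (h0 ▸ hm)
  obtain ⟨M, hψ⟩ := h.isMeanFreeSolution hv hε0 (hεt.trans ht.2)
  have hsmall := AKS.small_of_le_T0 (L₁ := L₁) (L₂ := L₂) (τ := τ') hB (by
    linarith [hle.trans (min_le_left _ _)])
  -- Enough steps of length τ' to cover [ε, t]; the bounds obtained do not depend on n.
  obtain ⟨n, hn⟩ := exists_nat_ge ((t - ε) / τ')
  rw [div_le_iff₀ hτ0] at hn
  obtain ⟨hX, hD⟩ := AKS.IsMeanFreeSolution.bound hv hτ0.le hhalf n ε b hε0.le hb0 hsmall hεt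
    (by linarith) (hψ.mono le_rfl hεt ht.2) (by
      rw [AKS.wsum_zero_coeff, hb, ← div_eq_inv_mul]
      exact div_le_div_of_nonneg_right hεX hA.le)
  refine hgoal ?_ ?_
  · rw [AKS.norm_sq_eq_wsum]
    exact mul_le_mul_of_nonneg_left (hX t (Set.right_mem_Icc.2 hεt)) hA.le
  · refine (h.abs_mean_le hv hε0 hεt ht.2).trans (add_le_add hεm ?_)
    exact mul_le_mul_of_nonneg_left hD (by positivity)
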